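/- **Model.** Let $s\ge 1$ be an integer and $v=1/s$ (the velocity). $n$ users are placed independently and uniformly in the unit square at time $0$; the square is divided into an $s\times s$ grid of $m=1/v^2$ subsquares of side $v$. *Mobile network:* at the beginning of each slot, every user independently picks one of nine moves (stay, or go to one of the eight neighbouring subsquares), each with probability $1/9$; if the move would leave the unit square the user stays in its subsquare; its position is then redrawn uniformly inside its current subsquare. *Static network:* the users keep their initial positions. *Unicast transmission:* in each slot every user is independently designated a sender with probability $\theta\in(0,1/2)$ and is a potential receiver otherwise; each sender $i$ transmits to its nearest potential receiver $j$, and the packet is received iff $$\mathrm{SINR}_{ij}=\frac{P r_{ij}^{-\alpha}}{\eta+\sum_{l\ne i,\ l\text{ a sender}}P r_{lj}^{-\alpha}}\ \ge\ \beta ,$$ where $r_{ij}$ is the current Euclidean distance and $P,\eta,\beta>0$, $\alpha>2$ are constants. *RANDOM PUSH:* each sender transmits a message chosen uniformly among those it possesses at the beginning of the slot. There are $k$ messages; message $i$ is injected at a single user at an arbitrary fixed time, and the spreading time $T(i)$ is the number of slots from its injection until all $n$ users possess it (in the mobile network), and $T^{\mathrm{st}}(i)$ is the same quantity in the static network. **Theorem.**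 For all constants $P,\eta,\alpha,\beta,\theta$ as above and every $K$ there are constants $a,b,g,h>0$ such that, for all $n$, all $1\le k\le K$ and all $v=1/s$ with $v>\sqrt{32\log n/n}$, all sources and all injection times: 1. with probability at least $1-n^{-2}$, for all messages $i$, $$\frac{a}{v}\ \le\ T(i)\ \le\ b\,\frac{\log n}{v};$$ 2. with probability at least $1-n^{-2}$, for all messages $i$, $T^{\mathrm{st}}(i)\ge h\,\sqrt n/\log n$; 3. when a mobile and a static network are run independently with the same sources and injection times, with probability at least $1-n^{-2}$, for all messages $i$, $$T^{\mathrm{st}}(i)\ \ge\ g\,\frac{v\sqrt n}{\log^2 n}\;T(i).$$ -/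

import Mathlib

open MeasureTheory unitInterval
open scoped ENNReal

noncomputable section

namespace Gossip

/-! ### Parameters and randomness -/

/-- Physical-layer parameters: transmit power `P`, noise `η`, path-loss exponent `α`, SINR threshold
`β`, and the probability `θ` of being designated as a sender. -/
structure Phy where
  P : ℝ
  η : ℝ
  α : ℝ
  β : ℝ
  θ : ℝ
  P_pos : 0 < P
  η_pos : 0 < η
  two_lt_α : 2 < α
  β_pos : 0 < β
  θ_pos : 0 < θ
  θ_lt_half : θ < 1 / 2

/-- The primitive randomness that one user draws in one time slot: a direction, an offset inside
the subsquare, a seed for the sender designation, and a seed for the message selection. -/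
abbrev SlotSeed : Type := (Fin 3 × Fin 3) × (I × I) × I × I

/-- In one slot, the direction is uniform over the nine possibilities, the offset is uniform on the
unit square and the two other seeds are uniform on the unit interval, all independently. -/
def slotLaw : Measure SlotSeed :=
  (PMF.uniformOfFintype (Fin 3 × Fin 3)).toMeasure.prod volume

instance : IsProbabilityMeasure slotLaw := by
  unfold slotLaw; infer_instance

/-- Sample space of a network of `n` users: the initial positions in the unit square, and the seeds
of every user in every time slot. -/
abbrev Run (n : ℕ) : Type := (Fin n → I × I) × (ℕ → Fin n → SlotSeed)

/-- All primitive random variables are independent; initial positions are uniform on the square. -/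
def runLaw (n : ℕ) : Measure (Run n) :=
  (Measure.pi fun _ : Fin n => (volume : Measure (I × I))).prod
    (Measure.infinitePi fun _ : ℕ => Measure.pi fun _ : Fin n => slotLaw)

instance (n : ℕ) : IsProbabilityMeasure (runLaw n) := by
  unfold runLaw; infer_instance

variable {n k : ℕ}

/-- Initial position of user `i`. -/
def Run.init (ω : Run n) (i : Fin n) : I × I := ω.1 i
/-- Direction drawn by user `i` in slot `t` (the slot that leads from time `t` to `t + 1`). -/
def Run.dir (ω : Run n) (t : ℕ) (i : Fin n) : Fin 3 × Fin 3 := (ω.2 t i).1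
/-- Offset of user `i` inside its new subsquare in slot `t`, as a fraction of the side length. -/
def Run.offset (ω : Run n) (t : ℕ) (i : Fin n) : I × I := (ω.2 t i).2.1
/-- Seed of user `i` in slot `t` for the sender designation. -/
def Run.coin (ω : Run n) (t : ℕ) (i : Fin n) : I := (ω.2 t i).2.2.1
/-- Seed of user `i` in slot `t` for the message selection. -/
def Run.pick (ω : Run n) (t : ℕ) (i : Fin n) : I := (ω.2 t i).2.2.2

/-! ### Node positions -/

/-- The plane with the Euclidean distance. -/
abbrev Plane : Type := EuclideanSpace ℝ (Fin 2)

/-- One step of the walk on the `s × s` grid of subsquares `(x, y)` with `0 ≤ x, y < s`: move by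
`(d.1 - 1, d.2 - 1)`, or stay if that would lead out of the square. -/
def move (s : ℕ) (c : ℤ × ℤ) (d : Fin 3 × Fin 3) : ℤ × ℤ :=
  let c' : ℤ × ℤ := (c.1 + (d.1.val : ℤ) - 1, c.2 + (d.2.val : ℤ) - 1)
  if 0 ≤ c'.1 ∧ c'.1 < s ∧ 0 ≤ c'.2 ∧ c'.2 < s then c' else c

/-- The subsquare (of side `1 / s`) that contains a point of the unit square; points on the upper
and right sides of the unit square belong to the last subsquares. -/
def cellOf (s : ℕ) (p : I × I) : ℤ × ℤ :=
  (min ⌊(s : ℝ) * p.1⌋ (s - 1), min ⌊(s : ℝ) * p.2⌋ (s - 1))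

/-- The subsquare of user `i` at time `t`. -/
def cell (s : ℕ) (ω : Run n) (i : Fin n) : ℕ → ℤ × ℤ
  | 0 => cellOf s (ω.init i)
  | t + 1 => move s (cell s ω i t) (ω.dir t i)

/-- The initial position of user `i`, as a point of the plane. -/
def initPos (ω : Run n) (i : Fin n) : Plane :=
  !₂[((ω.init i).1 : ℝ), ((ω.init i).2 : ℝ)]

/-- Position of user `i` at time `t` in the mobile network with velocity `1 / s`: after each move,
it is redrawn uniformly inside the current subsquare. -/
def mobilePos (s : ℕ) (ω : Run n) : ℕ → Fin n → Plane
  | 0, i => initPos ω i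
  | t + 1, i =>
    !₂[(((cell s ω i (t + 1)).1 : ℝ) + ((ω.offset t i).1 : ℝ)) / s,
       (((cell s ω i (t + 1)).2 : ℝ) + ((ω.offset t i).2 : ℝ)) / s]

/-- Positions in the static network: nobody ever moves. -/
def staticPos (ω : Run n) (_t : ℕ) (i : Fin n) : Plane := initPos ω i

/-! ### Unicast physical layer -/

/-- The users designated as senders in slot `t`: each independently with probability `θ`. -/
def senders (φ : Phy) (ω : Run n) (t : ℕ) : Finset (Fin n) :=
  {i | (ω.coin t i : ℝ) < φ.θ}

/-- Signal-to-interference-plus-noise ratio at `j` of the signal of `i`, with set of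
transmitters `S` and node positions `x`. -/
def sinr (φ : Phy) (x : Fin n → Plane) (S : Finset (Fin n)) (i j : Fin n) : ℝ :=
  φ.P * dist (x i) (x j) ^ (-φ.α) /
    (φ.η + ∑ l ∈ S.erase i, φ.P * dist (x l) (x j) ^ (-φ.α))

/-- `i` is a sender, `j` is a potential receiver (a non-sender) nearest to `i`, and the packet from
`i` is successfully received by `j`. -/
def Delivers (φ : Phy) (x : Fin n → Plane) (S : Finset (Fin n)) (i j : Fin n) : Prop :=
  i ∈ S ∧ j ∉ S ∧ (∀ j' ∉ S, dist (x i) (x j) ≤ dist (x i) (x j')) ∧ φ.β ≤ sinr φ x S i j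

/-! ### RANDOM PUSH -/

/-- From the set `A` of messages it possesses, a user with uniform seed `u` selects message `m`:
each of the `#A` messages is selected on an interval of seeds of length `1 / #A`. -/
def Selects (u : I) (A : Finset (Fin k)) (m : Fin k) : Prop :=
  m ∈ A ∧ ⌊(u : ℝ) * (A.card : ℝ)⌋₊ = (A.filter (· < m)).card

open Classical in
/-- The set of messages possessed by user `j` at time `t`, when message `m` is injected at time
`τ m` at the user `src m`. In slot `t` every user first moves (so positions are those of time
`t + 1`), then senders are designated, and each sender pushes one of the messages
that it possesses at the beginning of the slot. -/
def holds (φ : Phy) (pos : ℕ → Fin n → Plane) (src : Fin k → Fin n) (τ : Fin k → ℕ)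
    (ω : Run n) : ℕ → Fin n → Finset (Fin k)
  | 0, j => {m | τ m = 0 ∧ src m = j}
  | t + 1, j => {m | m ∈ holds φ pos src τ ω t j ∨ (τ m = t + 1 ∧ src m = j) ∨
      ∃ i, Delivers φ (pos (t + 1)) (senders φ ω t) i j ∧
        Selects (ω.pick t i) (holds φ pos src τ ω t i) m}

/-- Time needed, counted from the injection of message `m`, until all users possess it
(`⊤` if this never happens). -/
def spreadingTime (φ : Phy) (pos : ℕ → Fin n → Plane) (src : Fin k → Fin n) (τ : Fin k → ℕ)
    (ω : Run n) (m : Fin k) : ℕ∞ :=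
  ⨅ (d : ℕ) (_ : ∀ j, m ∈ holds φ pos src τ ω (τ m + d) j), (d : ℕ∞)

/-- Spreading time of message `m` in the mobile network with velocity `1 / s`. -/
def mobileTime (φ : Phy) (s : ℕ) (src : Fin k → Fin n) (τ : Fin k → ℕ) (ω : Run n)
    (m : Fin k) : ℝ≥0∞ :=
  (spreadingTime φ (mobilePos s ω) src τ ω m : ℕ∞)

/-- Spreading time of message `m` in the static network. -/
def staticTime (φ : Phy) (src : Fin k → Fin n) (τ : Fin k → ℕ) (ω : Run n) (m : Fin k) : ℝ≥0∞ :=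
  (spreadingTime φ (staticPos ω) src τ ω m : ℕ∞)

end Gossip

end

namespace Gossip

/-! ### Resampling one coordinate of a product measure -/

section Resample

variable {ι : Type*} [DecidableEq ι] {X : ι → Type*} [∀ i, MeasurableSpace (X i)]

/-! Lower bounds. The walk on the grid is doubly stochastic, so at every time the subsquares of the
users are independent and uniform (`lintegral_prod_cell`). Since the mean occupancy `n / s ^ 2` is
at least `32 log n`, with high probability every subsquare contains a potential receiver in each of
`s` consecutive slots. A sender then reaches only nearby subsquares, a message advances by at most
three subsquares per slot, and it needs at least `s / 7` slots to be everywhere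
(`le_of_forall_mem_holds`). In the static network the same argument runs on an auxiliary grid of any
side; the finest admissible one has side of order `√(n / log n)`.

Upper bound. The potential is the ratio `(n - a) / a` of uninformed to informed users. Take an
informed user `i` and an uninformed user `j` in equal or adjacent subsquares. With probability of
order `s ^ 2 / n`, `j` becomes a receiver in the subsquare of `i`, at distance of order `n ^ (-1 /
2)` from `i`, and `i` sends the right message (`slotsLaw_meet_ge`). The interference kernel is
integrable because `α > 2`, so by Markov's inequality the other users spoil at most half of these
meetings (`slotsLaw_hit_ge_half`), and the rest are deliveries (`delivers_of_sum_kernel_lt`).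
Successful pairs form a matching, so the expected potential drops in proportion to the number of
available pairs. An isoperimetric inequality on the grid (`card_mul_card_compl_le`) provides at
least order `a (n - a) / s ^ 3` such pairs when occupancies are balanced. The powers of `a` cancel:
the expected potential contracts by `1 - κ / s` whatever the number of informed users
(`exists_contraction_of_balanced`), so no division into phases is needed. It starts at most at `n`
and exceeds `1 / n` until everyone is informed, whence order `s log n` slots.

Bounded `n`. Occupancies need not be balanced with the required probability. Only finitely many
pairs `(n, s)` remain, and a geometric tail for each suffices: all users may gather in one corner
subsquare, where every pair is available. A potential discounted by the distance to that corner
contracts in every slot (`exists_measure_not_spread_le_geometric`).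

The comparison of the two networks combines the upper bound for one with the lower bound for the
other. -/

theorem measurable_update_prod (i : ι) :
    Measurable fun p : (∀ i, X i) × X i => Function.update p.1 i p.2 := by
  refine measurable_pi_lambda _ fun j => ?_
  by_cases h : j = i
  · subst h
    simpa using measurable_snd
  · simp only [Function.update_of_ne h]
    exact (measurable_pi_apply j).comp measurable_fst

/-- On a rectangle the factor of coordinate `i` is supplied by the fresh copy and the others are
untouched, so the two laws agree on rectangles. Independence of the past is always exploited by
resampling a coordinate in this way. -/
theorem map_update_infinitePi (μ : ∀ i, Measure (X i)) [∀ i, IsProbabilityMeasure (μ i)] (i : ι) :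
    ((Measure.infinitePi μ).prod (μ i)).map (fun p => Function.update p.1 i p.2) =
      Measure.infinitePi μ := by
  refine Measure.eq_infinitePi _ fun s t ht => ?_
  rw [Measure.map_apply (measurable_update_prod i) (.pi s.countable_toSet fun _ _ => ht _)]
  have hpre : (fun p : (∀ i, X i) × X i => Function.update p.1 i p.2) ⁻¹' (s : Set ι).pi t =
      ((s.erase i : Finset ι) : Set ι).pi t ×ˢ (if i ∈ s then t i else Set.univ) := by
    ext ⟨x, y⟩
    simp only [Set.mem_preimage, Set.mem_pi, Finset.mem_coe, Finset.mem_erase, Set.mem_prod]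
    constructor
    · intro h
      refine ⟨fun j hj => by simpa [hj.1] using h j hj.2, ?_⟩
      split_ifs with hi
      · simpa using h i hi
      · trivial
    · rintro ⟨h1, h2⟩ j hj
      by_cases hji : j = i
      · subst hji
        simpa [hj] using h2
      · simpa [hji] using h1 j ⟨hji, hj⟩
  rw [hpre, Measure.prod_prod, Measure.infinitePi_pi _ fun i _ => ht i]
  split_ifs with hi
  · rw [mul_comm, Finset.mul_prod_erase s (fun j => μ j (t j)) hi]
  · rw [measure_univ, mul_one, Finset.erase_eq_of_notMem hi]

theorem lintegral_infinitePi_update (μ : ∀ i, Measure (X i)) [∀ i, IsProbabilityMeasure (μ i)]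
    (i : ι) {f : (∀ i, X i) → ℝ≥0∞} (hf : Measurable f) :
    ∫⁻ x, f x ∂(Measure.infinitePi μ) =
      ∫⁻ x, ∫⁻ y, f (Function.update x i y) ∂(μ i) ∂(Measure.infinitePi μ) := by
  conv_lhs => rw [← map_update_infinitePi μ i]
  rw [lintegral_map hf (measurable_update_prod i)]
  exact lintegral_prod _ (hf.comp (measurable_update_prod i)).aemeasurable

theorem lintegral_pi_update [Fintype ι] (μ : ∀ i, Measure (X i)) [∀ i, IsProbabilityMeasure (μ i)]
    (i : ι) {f : (∀ i, X i) → ℝ≥0∞} (hf : Measurable f) :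
    ∫⁻ x, f x ∂(Measure.pi μ) =
      ∫⁻ x, ∫⁻ y, f (Function.update x i y) ∂(μ i) ∂(Measure.pi μ) := by
  rw [← Measure.infinitePi_eq_pi]
  exact lintegral_infinitePi_update μ i hf

end Resample

/-! ### Independence between users and between slots. -/

theorem lintegral_pi_prod {ι : Type*} [Fintype ι] {X : Type*} [MeasurableSpace X]
    (μ : Measure X) [IsProbabilityMeasure μ] {f : ι → X → ℝ≥0∞} (hf : ∀ i, Measurable (f i)) :
    ∫⁻ x, ∏ i : ι, f i (x i) ∂(Measure.pi fun _ : ι => μ) = ∏ i : ι, ∫⁻ y, f i y ∂μ := by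
  have h := ProbabilityTheory.iIndepFun_pi (μ := fun _ : ι => μ) (X := f)
    (fun i => (hf i).aemeasurable)
  rw [ProbabilityTheory.lintegral_prod_eq_prod_lintegral_of_indepFun Finset.univ _ h
    (fun i => (hf i).comp (measurable_pi_apply i))]
  exact Finset.prod_congr rfl fun i _ =>
    (measurePreserving_eval (fun _ : ι => μ) i).lintegral_comp (hf i)

/-- The law of the seeds of all users in one slot. -/
noncomputable def slotsLaw (n : ℕ) : Measure (Fin n → SlotSeed) := Measure.pi fun _ => slotLaw

instance (n : ℕ) : IsProbabilityMeasure (slotsLaw n) := by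
  unfold slotsLaw; infer_instance

/-- The run in which the seeds of slot `t` are replaced. -/
def Run.resample {n : ℕ} (ω : Run n) (t : ℕ) (ξ : Fin n → SlotSeed) : Run n :=
  (ω.1, Function.update ω.2 t ξ)

theorem Run.resample_snd {n : ℕ} (ω : Run n) (t : ℕ) (ξ : Fin n → SlotSeed) :
    (ω.resample t ξ).2 t = ξ := by
  simp [Run.resample]

theorem Run.resample_snd_of_ne {n : ℕ} (ω : Run n) {t u : ℕ} (h : u ≠ t) (ξ : Fin n → SlotSeed) :
    (ω.resample t ξ).2 u = ω.2 u := by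
  simp [Run.resample, h]

theorem Run.measurable_resample {n : ℕ} (t : ℕ) :
    Measurable fun p : Run n × (Fin n → SlotSeed) => p.1.resample t p.2 := by
  refine Measurable.prodMk (by fun_prop) ?_
  exact (measurable_update_prod (X := fun _ : ℕ => Fin n → SlotSeed) t).comp
    (Measurable.prodMk (by fun_prop) (by fun_prop))

theorem lintegral_runLaw_resample {n : ℕ} (t : ℕ) {f : Run n → ℝ≥0∞} (hf : Measurable f) :
    ∫⁻ ω, f ω ∂(runLaw n) = ∫⁻ ω, ∫⁻ ξ, f (ω.resample t ξ) ∂(slotsLaw n) ∂(runLaw n) := by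
  have hg : Measurable fun ω : Run n => ∫⁻ ξ, f (ω.resample t ξ) ∂(slotsLaw n) :=
    (hf.comp (Run.measurable_resample t)).lintegral_prod_right'
  unfold runLaw
  rw [lintegral_prod _ hf.aemeasurable, lintegral_prod _ hg.aemeasurable]
  refine lintegral_congr fun x => ?_
  exact lintegral_infinitePi_update (fun _ : ℕ => slotsLaw n) t
    (f := fun y => f (x, y)) (by fun_prop)

/-- The seeds of slot `t` are independent of everything that does not depend on them. -/
theorem lintegral_past_now {n : ℕ} {α : Type*} [MeasurableSpace α] (t : ℕ) {X : Run n → α}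
    (hX : Measurable X) (hpast : ∀ ω ξ, X (ω.resample t ξ) = X ω)
    {F : α → (Fin n → SlotSeed) → ℝ≥0∞} (hF : Measurable (Function.uncurry F)) :
    ∫⁻ ω, F (X ω) (ω.2 t) ∂(runLaw n) =
      ∫⁻ ω, ∫⁻ ξ, F (X ω) ξ ∂(slotsLaw n) ∂(runLaw n) := by
  rw [lintegral_runLaw_resample t (f := fun ω => F (X ω) (ω.2 t))
    (hF.comp (hX.prodMk (by fun_prop)))]
  simp only [hpast, Run.resample_snd]

/-- Integration against the law of one seed. -/
theorem lintegral_slotLaw {f : SlotSeed → ℝ≥0∞} (hf : Measurable f) :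
    ∫⁻ ξ, f ξ ∂slotLaw = (9 : ℝ≥0∞)⁻¹ * ∑ d : Fin 3 × Fin 3, ∫⁻ u, f (d, u) := by
  unfold slotLaw
  rw [lintegral_prod _ hf.aemeasurable, lintegral_fintype, Finset.mul_sum]
  refine Finset.sum_congr rfl fun d _ => ?_
  rw [PMF.toMeasure_apply_singleton _ _ (measurableSet_singleton _), PMF.uniformOfFintype_apply,
    mul_comm]
  norm_num

/-! ### The walk on the grid of subsquares -/

/-- The subsquares of the `s × s` grid. -/
noncomputable def grid (s : ℕ) : Finset (ℤ × ℤ) := Finset.Ico 0 (s : ℤ) ×ˢ Finset.Ico 0 (s : ℤ)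

theorem mem_grid {s : ℕ} {c : ℤ × ℤ} :
    c ∈ grid s ↔ 0 ≤ c.1 ∧ c.1 < s ∧ 0 ≤ c.2 ∧ c.2 < s := by
  simp [grid, and_assoc]

theorem card_grid (s : ℕ) : (grid s).card = s ^ 2 := by
  simp [grid, sq]

theorem move_mem_grid {s : ℕ} {c : ℤ × ℤ} (hc : c ∈ grid s) (d : Fin 3 × Fin 3) :
    move s c d ∈ grid s := by
  unfold move
  dsimp only
  split_ifs with h
  · exact mem_grid.2 h
  · exact hc

theorem cellOf_mem_grid {s : ℕ} (hs : 1 ≤ s) (p : I × I) : cellOf s p ∈ grid s := by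
  have h : ∀ u : I, 0 ≤ ⌊(s : ℝ) * u⌋ := fun u =>
    Int.floor_nonneg.2 (mul_nonneg (by positivity) u.2.1)
  have := h p.1
  have := h p.2
  rw [mem_grid]
  simp only [cellOf]
  omega

theorem cell_mem_grid {n s : ℕ} (hs : 1 ≤ s) (ω : Run n) (i : Fin n) (t : ℕ) :
    cell s ω i t ∈ grid s := by
  induction t with
  | zero => exact cellOf_mem_grid hs _
  | succ t ih => exact move_mem_grid ih _

theorem abs_move_sub_le (s : ℕ) (c : ℤ × ℤ) (d : Fin 3 × Fin 3) :
    |(move s c d).1 - c.1| ≤ 1 ∧ |(move s c d).2 - c.2| ≤ 1 := by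
  have := d.1.isLt
  have := d.2.isLt
  unfold move
  dsimp only
  split_ifs <;> constructor <;> simp only [abs_le] <;> constructor <;> omega

/-- The walk is doubly stochastic: the uniform distribution on the grid is stationary. -/
theorem sum_grid_move {M : Type*} [AddCommMonoid M] (s : ℕ) (f : ℤ × ℤ → M) :
    ∑ c ∈ grid s, ∑ d : Fin 3 × Fin 3, f (move s c d) = 9 • ∑ c ∈ grid s, f c := by
  classical
  -- An involution on pairs of a subsquare and a direction: an admissible move is sent to its
  -- reversal from the arrival point, a blocked move is fixed. It exchanges arrival and starting
  -- points, which is double stochasticity.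
  let T : (ℤ × ℤ) × (Fin 3 × Fin 3) → (ℤ × ℤ) × (Fin 3 × Fin 3) := fun p =>
    (move s p.1 p.2, if (p.1.1 + (p.2.1.val : ℤ) - 1, p.1.2 + (p.2.2.val : ℤ) - 1) ∈ grid s
      then (p.2.1.rev, p.2.2.rev) else p.2)
  have hT : ∀ p, p.1 ∈ grid s → T (T p) = p := by
    rintro ⟨⟨x, y⟩, ⟨d, e⟩⟩ hp
    have := d.isLt
    have := e.isLt
    rw [mem_grid] at hp
    dsimp only at hp
    by_cases h : 0 ≤ x + (d.val : ℤ) - 1 ∧ x + (d.val : ℤ) - 1 < s ∧ 0 ≤ y + (e.val : ℤ) - 1 ∧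
        y + (e.val : ℤ) - 1 < s
    · have e1 : x + (d.val : ℤ) - 1 + (d.rev.val : ℤ) - 1 = x := by
        rw [Fin.val_rev]; omega
      have e2 : y + (e.val : ℤ) - 1 + (e.rev.val : ℤ) - 1 = y := by
        rw [Fin.val_rev]; omega
      have m1 : T ((x, y), (d, e)) = ((x + (d.val : ℤ) - 1, y + (e.val : ℤ) - 1),
          (d.rev, e.rev)) := by
        simp only [T, move]
        rw [if_pos h, if_pos (mem_grid.2 h)]
      rw [m1]
      simp only [T, move]
      rw [e1, e2, if_pos hp, if_pos (mem_grid.2 hp), Fin.rev_rev, Fin.rev_rev]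
    · have m1 : T ((x, y), (d, e)) = ((x, y), (d, e)) := by
        simp only [T, move]
        rw [if_neg h, if_neg (fun h' => h (mem_grid.1 h'))]
      rw [m1, m1]
  have key : ∑ p ∈ grid s ×ˢ (Finset.univ : Finset (Fin 3 × Fin 3)), f (move s p.1 p.2) =
      ∑ p ∈ grid s ×ˢ (Finset.univ : Finset (Fin 3 × Fin 3)), f p.1 := by
    refine Finset.sum_nbij' T T ?_ ?_ ?_ ?_ ?_
    · intro p hp
      simp only [Finset.mem_product, Finset.mem_univ, and_true] at hp ⊢
      exact move_mem_grid hp _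
    · intro p hp
      simp only [Finset.mem_product, Finset.mem_univ, and_true] at hp ⊢
      exact move_mem_grid hp _
    · intro p hp
      exact hT p (Finset.mem_product.1 hp).1
    · intro p hp
      exact hT p (Finset.mem_product.1 hp).1
    · intro p hp
      rfl
  rw [Finset.sum_product, Finset.sum_product] at key
  rw [key, Finset.smul_sum]
  simp

/-- The set lies between an open and a closed interval of length `1 / s`; the `min` only adds the
right endpoint to the last subsquare. -/
theorem volume_floor_eq {s : ℕ} (hs : 1 ≤ s) {x : ℤ} (h0 : 0 ≤ x) (h1 : x < s) :
    volume {u : I | min ⌊(s : ℝ) * u⌋ (s - 1) = x} = ENNReal.ofReal (1 / s) := by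
  have hs' : (0 : ℝ) < s := by positivity
  have hx0 : (0 : ℝ) ≤ x := by exact_mod_cast h0
  have hx1 : (x : ℝ) + 1 ≤ s := by exact_mod_cast h1
  let p : I := ⟨x / s, by positivity, by rw [div_le_one hs']; linarith⟩
  let q : I := ⟨(x + 1) / s, by positivity, by rw [div_le_one hs']; linarith⟩
  have hpq : (q : ℝ) - p = 1 / s := by simp only [p, q]; field_simp; ring
  apply le_antisymm
  · rw [← hpq, ← unitInterval.volume_Icc]
    refine measure_mono fun u hu => ?_
    have hu' : min ⌊(s : ℝ) * u⌋ (s - 1) = x := hu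
    have hle : (s : ℝ) * u ≤ s := by nlinarith [u.2.2]
    constructor
    · have : x ≤ ⌊(s : ℝ) * u⌋ := by omega
      have := Int.le_floor.1 this
      change (x : ℝ) / s ≤ u
      rw [div_le_iff₀ hs']; linarith
    · change (u : ℝ) ≤ (x + 1) / s
      rw [le_div_iff₀ hs']
      rcases min_choice ⌊(s : ℝ) * u⌋ ((s : ℤ) - 1) with h | h
      · have : ⌊(s : ℝ) * u⌋ = x := by omega
        have h3 := Int.lt_floor_add_one ((s : ℝ) * u)
        rw [this] at h3; linarith
      · have : (s : ℤ) = x + 1 := by omega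
        have h3 : (s : ℝ) = x + 1 := by exact_mod_cast this
        rw [← h3]; linarith
  · rw [← hpq, ← unitInterval.volume_Ioo]
    refine measure_mono fun u hu => ?_
    have h2 : (x : ℝ) / s < u := hu.1
    have h3 : (u : ℝ) < (x + 1) / s := hu.2
    rw [div_lt_iff₀ hs'] at h2
    rw [lt_div_iff₀ hs'] at h3
    have : ⌊(s : ℝ) * u⌋ = x := by
      rw [Int.floor_eq_iff]; constructor <;> linarith
    change min ⌊(s : ℝ) * u⌋ ((s : ℤ) - 1) = x
    rw [this]; omega

theorem measurable_cellOf (s : ℕ) : Measurable (cellOf s) := by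
  unfold cellOf
  refine Measurable.prodMk ?_ ?_
  · exact (Int.measurable_floor.comp (by fun_prop)).min measurable_const
  · exact (Int.measurable_floor.comp (by fun_prop)).min measurable_const

/-- The subsquare of a uniform point is uniform on the grid. -/
theorem lintegral_cellOf {s : ℕ} (hs : 1 ≤ s) (f : ℤ × ℤ → ℝ≥0∞) :
    ∫⁻ p : I × I, f (cellOf s p) = ENNReal.ofReal (1 / (s : ℝ) ^ 2) * ∑ c ∈ grid s, f c := by
  classical
  have h1 : ∀ p : I × I, f (cellOf s p) =
      ∑ c ∈ grid s, (cellOf s ⁻¹' {c}).indicator (fun _ => f c) p := by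
    intro p
    rw [Finset.sum_eq_single_of_mem _ (cellOf_mem_grid hs p)]
    · simp
    · intro c _ hc
      simp [hc.symm]
  simp_rw [h1]
  rw [lintegral_finsetSum _ fun c _ => measurable_const.indicator
    (measurable_cellOf s (measurableSet_singleton c)), Finset.mul_sum]
  refine Finset.sum_congr rfl fun c hc => ?_
  rw [lintegral_indicator_const (measurable_cellOf s (measurableSet_singleton c)), mul_comm]
  congr 1
  rw [mem_grid] at hc
  have : cellOf s ⁻¹' {c} = {u : I | min ⌊(s : ℝ) * u⌋ (s - 1) = c.1} ×ˢ
      {u : I | min ⌊(s : ℝ) * u⌋ (s - 1) = c.2} := by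
    ext p
    simp [cellOf, Prod.ext_iff]
  rw [this, Measure.volume_eq_prod, Measure.prod_prod, volume_floor_eq hs hc.1 hc.2.1,
    volume_floor_eq hs hc.2.2.1 hc.2.2.2, ← ENNReal.ofReal_mul (by positivity)]
  congr 1
  field_simp

/-! ### The joint law of the subsquares of the users -/

theorem measurable_cell {n : ℕ} (s : ℕ) (i : Fin n) (t : ℕ) :
    Measurable fun ω : Run n => cell s ω i t := by
  induction t with
  | zero => exact (measurable_cellOf s).comp (by unfold Run.init; fun_prop)
  | succ t ih =>
    have h : Measurable (Function.uncurry (move s)) := measurable_of_countable _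
    exact h.comp (ih.prodMk (by fun_prop : Measurable fun ω : Run n => (ω.2 t i).1))

theorem cell_resample {n : ℕ} (s : ℕ) (i : Fin n) {u t : ℕ} (h : u ≤ t) (ω : Run n)
    (ξ : Fin n → SlotSeed) : cell s (ω.resample t ξ) i u = cell s ω i u := by
  induction u with
  | zero => rfl
  | succ u ih =>
    simp only [cell, Run.dir]
    rw [ih (by omega), Run.resample_snd_of_ne ω (by omega)]

theorem measurable_seed_of_countable {α β : Type*} [MeasurableSpace α] [Countable α]
    [MeasurableSingletonClass α] [MeasurableSpace β] {γ : Type*} [MeasurableSpace γ]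
    {f : α → β → γ} (hf : ∀ a, Measurable (f a)) : Measurable (Function.uncurry f) :=
  measurable_from_prod_countable_right hf

/-- Given the past, the seeds of slot `t` are independent across users, so the inner integral splits
user by user. -/
theorem lintegral_prod_cell_seed_aux {n s : ℕ} {u t : ℕ} (h : u ≤ t)
    (G : ℤ × ℤ → SlotSeed → ℝ≥0∞) (hG : ∀ c, Measurable (G c)) :
    ∫⁻ ω, ∏ i, G (cell s ω i u) (ω.2 t i) ∂(runLaw n) =
      ∫⁻ ω, ∏ i, (∫⁻ ξ, G (cell s ω i u) ξ ∂slotLaw) ∂(runLaw n) := by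
  have hG' : Measurable (Function.uncurry G) := measurable_seed_of_countable hG
  rw [lintegral_past_now (α := Fin n → ℤ × ℤ) t (X := fun ω i => cell s ω i u)
    (F := fun c ξ => ∏ i, G (c i) (ξ i))]
  · refine lintegral_congr fun ω => ?_
    exact lintegral_pi_prod slotLaw (f := fun i => G (cell s ω i u)) fun i => hG _
  · exact measurable_pi_lambda _ fun i => measurable_cell s i u
  · intro ω ξ
    funext i
    exact cell_resample s i h ω ξ
  · refine Finset.measurable_prod _ fun i _ => ?_
    exact hG'.comp (by fun_prop : Measurable fun p : (Fin n → ℤ × ℤ) × (Fin n → SlotSeed) =>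
      (p.1 i, p.2 i))

/-- At every time, the subsquares of the users are independent and uniform on the grid. -/
theorem lintegral_prod_cell {n s : ℕ} (hs : 1 ≤ s) (t : ℕ) (f : ℤ × ℤ → ℝ≥0∞) :
    ∫⁻ ω, ∏ i, f (cell s ω i t) ∂(runLaw n) =
      (ENNReal.ofReal (1 / (s : ℝ) ^ 2) * ∑ c ∈ grid s, f c) ^ n := by
  induction t generalizing f with
  | zero =>
    have hf : Measurable fun p : I × I => f (cellOf s p) :=
      (measurable_of_countable f).comp (measurable_cellOf s)
    have hF : Measurable fun ω : Run n => ∏ i, f (cellOf s (ω.1 i)) :=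
      Finset.measurable_prod _ fun i _ => hf.comp (by fun_prop)
    change ∫⁻ ω, ∏ i, f (cellOf s (ω.1 i)) ∂(runLaw n) = _
    unfold runLaw
    rw [lintegral_prod _ hF.aemeasurable]
    simp only [lintegral_const, measure_univ, mul_one]
    rw [lintegral_pi_prod (f := fun (_ : Fin n) p => f (cellOf s p)) volume fun _ => hf]
    rw [lintegral_cellOf hs]
    simp
  | succ t ih =>
    have h1 := lintegral_prod_cell_seed_aux (n := n) (s := s) le_rfl (u := t)
      (fun c ξ => f (move s c ξ.1)) fun c => (measurable_of_countable fun d => f (move s c d)).comp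
        measurable_fst
    change ∫⁻ ω, ∏ i, f (move s (cell s ω i t) (ω.2 t i).1) ∂(runLaw n) = _
    rw [h1, ih (fun c => ∫⁻ ξ, f (move s c ξ.1) ∂slotLaw)]
    congr 2
    have h2 : ∀ c, ∫⁻ ξ, f (move s c ξ.1) ∂slotLaw =
        (9 : ℝ≥0∞)⁻¹ * ∑ d : Fin 3 × Fin 3, f (move s c d) := by
      intro c
      rw [lintegral_slotLaw (f := fun ξ => f (move s c ξ.1))
        ((measurable_of_countable fun d => f (move s c d)).comp measurable_fst)]
      simp
    simp_rw [h2]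
    rw [← Finset.mul_sum, sum_grid_move, nsmul_eq_mul, ← mul_assoc]
    norm_num
    rw [ENNReal.inv_mul_cancel (by norm_num) (by norm_num), one_mul]

/-- The subsquare may be read earlier than the slot of the seeds: `u = t` serves the mobile network
and `u = 0` the static one. -/
theorem lintegral_prod_cell_seed {n s : ℕ} (hs : 1 ≤ s) {u t : ℕ} (h : u ≤ t)
    (G : ℤ × ℤ → SlotSeed → ℝ≥0∞) (hG : ∀ c, Measurable (G c)) :
    ∫⁻ ω, ∏ i, G (cell s ω i u) (ω.2 t i) ∂(runLaw n) =
      (ENNReal.ofReal (1 / (s : ℝ) ^ 2) * ∑ c ∈ grid s, ∫⁻ ξ, G c ξ ∂slotLaw) ^ n := by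
  rw [lintegral_prod_cell_seed_aux h G hG,
    lintegral_prod_cell hs u fun c => ∫⁻ ξ, G c ξ ∂slotLaw]

theorem volume_coin_ge (φ : Phy) : volume {u : I | φ.θ ≤ u} = ENNReal.ofReal (1 - φ.θ) := by
  have h1 := φ.θ_pos
  have h2 := φ.θ_lt_half
  let p : I := ⟨φ.θ, h1.le, by linarith⟩
  have : {u : I | φ.θ ≤ u} = Set.Ici p := rfl
  rw [this, unitInterval.volume_Ici]

theorem volume_coin_lt (φ : Phy) : volume {u : I | (u : ℝ) < φ.θ} = ENNReal.ofReal φ.θ := by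
  have h1 := φ.θ_pos
  have h2 := φ.θ_lt_half
  let p : I := ⟨φ.θ, h1.le, by linarith⟩
  have : {u : I | (u : ℝ) < φ.θ} = Set.Iio p := rfl
  rw [this, unitInterval.volume_Iio]

theorem notMem_senders {n : ℕ} {φ : Phy} {ω : Run n} {t : ℕ} {i : Fin n} :
    i ∉ senders φ ω t ↔ φ.θ ≤ (ω.2 t i).2.2.1 := by
  unfold senders Run.coin
  rw [Finset.mem_filter]
  simp

/-- A given subsquare contains no potential receiver with exponentially small probability. -/
theorem measure_no_receiver_le {n s : ℕ} (hs : 1 ≤ s) (φ : Phy) {u t : ℕ} (hu : u ≤ t)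
    (h : ℤ × ℤ → Fin 3 × Fin 3 → ℤ × ℤ)
    (hh : ∀ f : ℤ × ℤ → ℝ≥0∞, ∑ c ∈ grid s, ∑ d, f (h c d) = 9 • ∑ c ∈ grid s, f c)
    {c : ℤ × ℤ} (hc : c ∈ grid s) :
    runLaw n {ω | ∀ i, ¬ (h (cell s ω i u) (ω.2 t i).1 = c ∧ i ∉ senders φ ω t)} ≤
      ENNReal.ofReal (Real.exp (-(n / (s : ℝ) ^ 2 / 2))) := by
  classical
  have hs' : (0 : ℝ) < s := by positivity
  -- The map `h` will be `move` for mobile users and the projection to the subsquare for static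
  -- ones; `hh` says that it preserves the uniform law on the grid.
  let A : ℤ × ℤ → Set SlotSeed := fun c' => {ξ | h c' ξ.1 = c ∧ φ.θ ≤ ξ.2.2.1}
  have hA : ∀ c', MeasurableSet (A c') := fun c' => by
    refine MeasurableSet.inter ?_ ?_
    · exact measurable_fst (measurable_of_countable (fun d => h c' d) (measurableSet_singleton c))
    · exact measurableSet_le measurable_const (measurable_subtype_coe.comp
        (by fun_prop : Measurable fun ξ : SlotSeed => ξ.2.2.1))
  let G : ℤ × ℤ → SlotSeed → ℝ≥0∞ := fun c' => (A c')ᶜ.indicator fun _ => 1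
  have hG : ∀ c', Measurable (G c') := fun c' => measurable_const.indicator (hA c').compl
  have hmeas : MeasurableSet {ω : Run n |
      ∀ i, ¬ (h (cell s ω i u) (ω.2 t i).1 = c ∧ i ∉ senders φ ω t)} := by
    simp only [notMem_senders]
    rw [Set.ofPred_forall]
    refine MeasurableSet.iInter fun i => MeasurableSet.compl (MeasurableSet.inter ?_ ?_)
    · have hm : Measurable (Function.uncurry h) := measurable_of_countable _
      exact (hm.comp ((measurable_cell s i u).prodMk
        (by fun_prop : Measurable fun ω : Run n => (ω.2 t i).1))) (measurableSet_singleton c)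
    · exact measurableSet_le measurable_const (measurable_subtype_coe.comp
        (by fun_prop : Measurable fun ω : Run n => (ω.2 t i).2.2.1))
  have h1 : runLaw n {ω | ∀ i, ¬ (h (cell s ω i u) (ω.2 t i).1 = c ∧ i ∉ senders φ ω t)} =
      ∫⁻ ω, ∏ i, G (cell s ω i u) (ω.2 t i) ∂(runLaw n) := by
    rw [← lintegral_indicator_one hmeas]
    refine lintegral_congr fun ω => ?_
    by_cases hω : ∀ i, ¬ (h (cell s ω i u) (ω.2 t i).1 = c ∧ i ∉ senders φ ω t)
    · rw [Set.indicator_of_mem (by exact hω), Finset.prod_eq_one, Pi.one_apply]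
      intro i _
      have := hω i
      rw [notMem_senders] at this
      exact Set.indicator_of_mem (by exact this) _
    · rw [Set.indicator_of_notMem (by exact hω)]
      push Not at hω
      obtain ⟨i, hi1, hi2⟩ := hω
      rw [notMem_senders] at hi2
      refine (Finset.prod_eq_zero (Finset.mem_univ i) ?_).symm
      refine Set.indicator_of_notMem ?_ _
      simp only [Set.mem_compl_iff, not_not]
      exact ⟨hi1, hi2⟩
  rw [h1, lintegral_prod_cell_seed hs hu G hG]
  have h2 : ∀ c', slotLaw (A c') =
      (9 : ℝ≥0∞)⁻¹ * ∑ d, if h c' d = c then ENNReal.ofReal (1 - φ.θ) else 0 := by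
    intro c'
    rw [← lintegral_indicator_one (hA c'),
      lintegral_slotLaw (f := (A c').indicator 1) (measurable_one.indicator (hA c'))]
    congr 1
    refine Finset.sum_congr rfl fun d _ => ?_
    split_ifs with hd
    · have : ∀ v : (I × I) × I × I, (A c').indicator (1 : SlotSeed → ℝ≥0∞) (d, v) =
          ((Set.univ : Set (I × I)) ×ˢ ({u : I | φ.θ ≤ u} ×ˢ (Set.univ : Set I))).indicator 1 v := by
        intro v
        simp [A, Set.indicator, hd]
      simp_rw [this]
      rw [lintegral_indicator_one (MeasurableSet.univ.prod ((measurableSet_le measurable_const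
        (by fun_prop)).prod .univ)), Measure.volume_eq_prod, Measure.prod_prod,
        Measure.volume_eq_prod, Measure.prod_prod, volume_coin_ge]
      simp
    · have : ∀ v : (I × I) × I × I, (A c').indicator (1 : SlotSeed → ℝ≥0∞) (d, v) = 0 := by
        intro v
        simp [A, hd]
      simp [this]
  have h3 : ∑ c' ∈ grid s, slotLaw (A c') = ENNReal.ofReal (1 - φ.θ) := by
    simp_rw [h2]
    rw [← Finset.mul_sum, hh fun c' => if c' = c then ENNReal.ofReal (1 - φ.θ) else 0]
    rw [Finset.sum_ite_eq' _ c, if_pos hc, nsmul_eq_mul, ← mul_assoc]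
    norm_num
    rw [ENNReal.inv_mul_cancel (by norm_num) (by norm_num), one_mul]
  have h4 : ∀ c', ∫⁻ ξ, G c' ξ ∂slotLaw = 1 - slotLaw (A c') := by
    intro c'
    rw [lintegral_indicator_const (hA c').compl, one_mul, prob_compl_eq_one_sub (hA c')]
  have h5 : ∑ c' ∈ grid s, ∫⁻ ξ, G c' ξ ∂slotLaw + ENNReal.ofReal (1 - φ.θ) =
      ENNReal.ofReal ((s : ℝ) ^ 2) := by
    rw [← h3, ← Finset.sum_add_distrib]
    have : ∀ c' ∈ grid s, ∫⁻ ξ, G c' ξ ∂slotLaw + slotLaw (A c') = 1 := fun c' _ => by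
      rw [h4, tsub_add_cancel_of_le prob_le_one]
    rw [Finset.sum_congr rfl this]
    simp [card_grid]
  have h6 : ∑ c' ∈ grid s, ∫⁻ ξ, G c' ξ ∂slotLaw =
      ENNReal.ofReal ((s : ℝ) ^ 2 - (1 - φ.θ)) := by
    rw [ENNReal.ofReal_sub _ (by linarith [φ.θ_lt_half])]
    exact ENNReal.eq_sub_of_add_eq (by simp) h5
  rw [h6, ← ENNReal.ofReal_mul (by positivity)]
  -- A given user is a receiver in `c` with probability `(1 - θ) / s ^ 2`, which `θ < 1 / 2` makes
  -- at least `1 / (2 s ^ 2)`.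
  have h7 : 1 / (s : ℝ) ^ 2 * ((s : ℝ) ^ 2 - (1 - φ.θ)) ≤
      Real.exp (-(1 / (s : ℝ) ^ 2 / 2)) := by
    have h8 : 1 / (s : ℝ) ^ 2 * ((s : ℝ) ^ 2 - (1 - φ.θ)) = 1 - (1 - φ.θ) * (1 / (s : ℝ) ^ 2) := by
      field_simp
    have h9 := Real.add_one_le_exp (-(1 / (s : ℝ) ^ 2 / 2))
    have : 0 < 1 / (s : ℝ) ^ 2 := by positivity
    rw [h8]
    nlinarith [φ.θ_lt_half]
  calc ENNReal.ofReal (1 / (s : ℝ) ^ 2 * ((s : ℝ) ^ 2 - (1 - φ.θ))) ^ n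
      ≤ ENNReal.ofReal (Real.exp (-(1 / (s : ℝ) ^ 2 / 2))) ^ n := by
        gcongr
    _ = _ := by
        rw [← ENNReal.ofReal_pow (Real.exp_pos _).le, ← Real.exp_nat_mul]
        congr 2
        ring

/-! ### Concentration of the number of users in a subsquare -/

/-- The number of users located in the subsquare `c`. -/
def occupancy {n : ℕ} (x : Fin n → ℤ × ℤ) (c : ℤ × ℤ) : ℕ :=
  (Finset.univ.filter fun i => x i = c).card

/-- The occupancy is binomial; each of the `n` factors `1 + (z - 1) / s ^ 2` is bounded by an
exponential. -/
theorem lintegral_pow_occupancy_le {n s : ℕ} (hs : 1 ≤ s) (t : ℕ) {c : ℤ × ℤ} (hc : c ∈ grid s)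
    {z : ℝ} (hz : 0 ≤ z) :
    ∫⁻ ω, ENNReal.ofReal (z ^ occupancy (fun i => cell s ω i t) c) ∂(runLaw n) ≤
      ENNReal.ofReal (Real.exp ((z - 1) * (n / (s : ℝ) ^ 2))) := by
  classical
  have hs' : (1 : ℝ) ≤ (s : ℝ) ^ 2 := one_le_pow₀ (by exact_mod_cast hs)
  have h1 : ∀ ω : Run n, ENNReal.ofReal (z ^ occupancy (fun i => cell s ω i t) c) =
      ∏ i, (fun c' => ENNReal.ofReal (if c' = c then z else 1)) (cell s ω i t) := by
    intro ω
    dsimp only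
    rw [← ENNReal.ofReal_prod_of_nonneg (by intros; split_ifs <;> linarith)]
    rw [Finset.prod_ite]
    simp [occupancy]
  simp_rw [h1]
  rw [lintegral_prod_cell hs t fun c' => ENNReal.ofReal (if c' = c then z else 1),
    ← ENNReal.ofReal_sum_of_nonneg
    (by intros; split_ifs <;> linarith), ← ENNReal.ofReal_mul (by positivity)]
  have h2 : ∑ c' ∈ grid s, (if c' = c then z else 1) = (s : ℝ) ^ 2 - 1 + z := by
    have : ∀ c', (if c' = c then z else 1) = 1 + if c' = c then z - 1 else 0 := by
      intro c'; split_ifs <;> ring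
    simp_rw [this]
    rw [Finset.sum_add_distrib, Finset.sum_ite_eq' _ c, if_pos hc]
    simp [card_grid]; ring
  rw [h2]
  have h3 : 1 / (s : ℝ) ^ 2 * ((s : ℝ) ^ 2 - 1 + z) ≤ Real.exp ((z - 1) * (1 / (s : ℝ) ^ 2)) := by
    have h8 : 1 / (s : ℝ) ^ 2 * ((s : ℝ) ^ 2 - 1 + z) = (z - 1) * (1 / (s : ℝ) ^ 2) + 1 := by
      field_simp; ring
    rw [h8]
    exact Real.add_one_le_exp _
  calc ENNReal.ofReal (1 / (s : ℝ) ^ 2 * ((s : ℝ) ^ 2 - 1 + z)) ^ n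
      ≤ ENNReal.ofReal (Real.exp ((z - 1) * (1 / (s : ℝ) ^ 2))) ^ n := by
        gcongr
    _ = _ := by
        rw [← ENNReal.ofReal_pow (Real.exp_pos _).le, ← Real.exp_nat_mul]
        congr 2
        ring

theorem measurable_occupancy {n : ℕ} (s t : ℕ) (c : ℤ × ℤ) :
    Measurable fun ω : Run n => occupancy (fun i => cell s ω i t) c := by
  have h : Measurable fun x : Fin n → ℤ × ℤ => occupancy x c := measurable_of_countable _
  exact h.comp (measurable_pi_lambda _ fun i => measurable_cell s i t)

/-- Markov's inequality for `z ^ occupancy`; a base `z < 1` controls the lower tail and `z > 1` the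
upper one. -/
theorem measure_occupancy_aux {n s : ℕ} (hs : 1 ≤ s) (t : ℕ) {c : ℤ × ℤ} (hc : c ∈ grid s)
    {z a : ℝ} (hz : 0 < z) :
    runLaw n {ω | z ^ a ≤ z ^ occupancy (fun i => cell s ω i t) c} ≤
      ENNReal.ofReal (Real.exp ((z - 1) * (n / (s : ℝ) ^ 2) - a * Real.log z)) := by
  have hza : 0 < z ^ a := Real.rpow_pos_of_pos hz a
  have hm : Measurable fun ω : Run n =>
      ENNReal.ofReal (z ^ occupancy (fun i => cell s ω i t) c) :=
    (measurable_of_countable fun m : ℕ => ENNReal.ofReal (z ^ m)).comp (measurable_occupancy s t c)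
  have h1 := meas_ge_le_lintegral_div hm.aemeasurable (μ := runLaw n)
    (ε := ENNReal.ofReal (z ^ a)) (by simp [hza]) (by simp)
  have h2 : {ω : Run n | z ^ a ≤ z ^ occupancy (fun i => cell s ω i t) c} ⊆
      {ω | ENNReal.ofReal (z ^ a) ≤ ENNReal.ofReal (z ^ occupancy (fun i => cell s ω i t) c)} :=
    fun ω hω => ENNReal.ofReal_le_ofReal hω
  refine (measure_mono h2).trans (h1.trans ?_)
  refine (ENNReal.div_le_div_right (lintegral_pow_occupancy_le hs t hc hz.le) _).trans ?_
  rw [← ENNReal.ofReal_div_of_pos hza, Real.rpow_def_of_pos hz, ← Real.exp_sub, mul_comm a]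

/-- The number of users in a subsquare is of the order of its mean. -/
theorem measure_occupancy_unbalanced_le {n s : ℕ} (hs : 1 ≤ s) (t : ℕ) {c : ℤ × ℤ}
    (hc : c ∈ grid s) :
    runLaw n {ω | ¬ ((n / (s : ℝ) ^ 2) / 8 ≤ occupancy (fun i => cell s ω i t) c ∧
      (occupancy (fun i => cell s ω i t) c : ℝ) ≤ 4 * (n / (s : ℝ) ^ 2))} ≤
      ENNReal.ofReal (2 * Real.exp (-(0.4 * (n / (s : ℝ) ^ 2)))) := by
  set N : ℝ := n / (s : ℝ) ^ 2 with hN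
  have hN0 : 0 ≤ N := by positivity
  have hl2 := Real.log_two_lt_d9
  have hl1 := Real.log_two_gt_d9
  have hsub : {ω : Run n | ¬ (N / 8 ≤ occupancy (fun i => cell s ω i t) c ∧
      (occupancy (fun i => cell s ω i t) c : ℝ) ≤ 4 * N)} ⊆
      {ω | (1 / 2 : ℝ) ^ (N / 8) ≤ (1 / 2 : ℝ) ^ occupancy (fun i => cell s ω i t) c} ∪
      {ω | (2 : ℝ) ^ (4 * N) ≤ (2 : ℝ) ^ occupancy (fun i => cell s ω i t) c} := by
    intro ω hω
    have hω' : ¬ (N / 8 ≤ occupancy (fun i => cell s ω i t) c ∧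
      (occupancy (fun i => cell s ω i t) c : ℝ) ≤ 4 * N) := hω
    rw [not_and_or, not_le, not_le] at hω'
    rcases hω' with h | h
    · left
      change (1 / 2 : ℝ) ^ (N / 8) ≤ _
      rw [← Real.rpow_natCast]
      exact Real.rpow_le_rpow_of_exponent_ge (by norm_num) (by norm_num) h.le
    · right
      change (2 : ℝ) ^ (4 * N) ≤ _
      rw [← Real.rpow_natCast]
      exact Real.rpow_le_rpow_of_exponent_le (by norm_num) h.le
  refine (measure_mono hsub).trans ((measure_union_le _ _).trans ?_)
  -- Base `1 / 2` at level `N / 8` gives the exponent `-(1 / 2 - log 2 / 8) N`, base `2` at level `4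
  -- N` gives `(1 - 4 log 2) N`; both are at most `-0.4 N`.
  refine (add_le_add (measure_occupancy_aux hs t hc (by norm_num))
    (measure_occupancy_aux hs t hc (by norm_num))).trans ?_
  rw [← ENNReal.ofReal_add (Real.exp_pos _).le (Real.exp_pos _).le, two_mul, ← hN]
  refine ENNReal.ofReal_le_ofReal (add_le_add ?_ ?_) <;> rw [Real.exp_le_exp]
  · rw [one_div, Real.log_inv]
    nlinarith
  · nlinarith

/-! ### The plane -/

theorem abs_sub_le_dist (x y : Plane) (k : Fin 2) : |x k - y k| ≤ dist x y := by
  rw [dist_eq_norm]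
  exact (Real.norm_eq_abs _).symm.le.trans (PiLp.norm_apply_le (x - y) k)

theorem dist_le_of_abs_sub_le {x y : Plane} {a : ℝ} (h0 : |x 0 - y 0| ≤ a) (h1 : |x 1 - y 1| ≤ a) :
    dist x y ≤ 3 / 2 * a := by
  have ha : 0 ≤ a := (abs_nonneg _).trans h0
  rw [EuclideanSpace.dist_eq]
  refine Real.sqrt_le_iff.2 ⟨by positivity, ?_⟩
  rw [Fin.sum_univ_two, Real.dist_eq, Real.dist_eq]
  nlinarith [pow_le_pow_left₀ (abs_nonneg _) h0 2, pow_le_pow_left₀ (abs_nonneg _) h1 2, sq_nonneg a]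

/-! ### Spreading times -/

section Holds

variable {n k : ℕ} {φ : Phy} {pos : ℕ → Fin n → Plane} {src : Fin k → Fin n} {τ : Fin k → ℕ}
  {ω : Run n}

theorem mem_holds_zero {m : Fin k} {j : Fin n} :
    m ∈ holds φ pos src τ ω 0 j ↔ τ m = 0 ∧ src m = j := by
  rw [holds, Finset.mem_filter]
  simp

theorem mem_holds_succ {t : ℕ} {m : Fin k} {j : Fin n} :
    m ∈ holds φ pos src τ ω (t + 1) j ↔ m ∈ holds φ pos src τ ω t j ∨ (τ m = t + 1 ∧ src m = j) ∨
      ∃ i, Delivers φ (pos (t + 1)) (senders φ ω t) i j ∧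
        Selects (ω.pick t i) (holds φ pos src τ ω t i) m := by
  classical
  rw [holds, Finset.mem_filter]
  simp

theorem holds_mono {t u : ℕ} (h : t ≤ u) {m : Fin k} {j : Fin n}
    (hm : m ∈ holds φ pos src τ ω t j) : m ∈ holds φ pos src τ ω u j := by
  induction u, h using Nat.le_induction with
  | base => exact hm
  | succ u _ ih => exact mem_holds_succ.2 (Or.inl ih)

theorem notMem_holds_of_lt {t : ℕ} {m : Fin k} (h : t < τ m) (j : Fin n) :
    m ∉ holds φ pos src τ ω t j := by
  induction t generalizing j with
  | zero =>
    rw [mem_holds_zero]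
    omega
  | succ t ih =>
    rw [mem_holds_succ]
    rintro (h1 | h1 | ⟨i, _, h2⟩)
    · exact ih (by omega) _ h1
    · omega
    · exact ih (by omega) _ h2.1

theorem mem_holds_injection {m : Fin k} {j : Fin n} :
    m ∈ holds φ pos src τ ω (τ m) j ↔ src m = j := by
  rcases h : τ m with _ | t
  · rw [mem_holds_zero]
    simp [h]
  · rw [mem_holds_succ]
    constructor
    · rintro (h1 | h1 | ⟨i, _, h2⟩)
      · exact absurd h1 (notMem_holds_of_lt (by omega) _)
      · exact h1.2
      · exact absurd h2.1 (notMem_holds_of_lt (by omega) _)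
    · exact fun h1 => Or.inr (Or.inl ⟨h, h1⟩)

theorem le_spreadingTime {m : Fin k} {x : ℝ}
    (h : ∀ d : ℕ, (∀ j, m ∈ holds φ pos src τ ω (τ m + d) j) → x ≤ d) :
    ENNReal.ofReal x ≤ ((spreadingTime φ pos src τ ω m : ℕ∞) : ℝ≥0∞) := by
  have h1 : ((⌈x⌉₊ : ℕ) : ℕ∞) ≤ spreadingTime φ pos src τ ω m :=
    le_iInf₂ fun d hd => by exact_mod_cast Nat.ceil_le.2 (h d hd)
  calc ENNReal.ofReal x ≤ ENNReal.ofReal (⌈x⌉₊ : ℝ) := ENNReal.ofReal_le_ofReal (Nat.le_ceil x)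
    _ = (((⌈x⌉₊ : ℕ) : ℕ∞) : ℝ≥0∞) := by simp
    _ ≤ _ := by exact_mod_cast h1

theorem spreadingTime_le {m : Fin k} {d : ℕ} (h : ∀ j, m ∈ holds φ pos src τ ω (τ m + d) j) :
    ((spreadingTime φ pos src τ ω m : ℕ∞) : ℝ≥0∞) ≤ ENNReal.ofReal d := by
  have h1 : spreadingTime φ pos src τ ω m ≤ d := iInf₂_le d h
  calc ((spreadingTime φ pos src τ ω m : ℕ∞) : ℝ≥0∞) ≤ (((d : ℕ) : ℕ∞) : ℝ≥0∞) := by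
        exact_mod_cast h1
    _ = _ := by simp

theorem one_le_of_forall_mem_holds (hn : 2 ≤ n) {m : Fin k} {d : ℕ}
    (h : ∀ j, m ∈ holds φ pos src τ ω (τ m + d) j) : 1 ≤ d := by
  by_contra hd
  obtain rfl : d = 0 := by omega
  simp only [add_zero, mem_holds_injection] at h
  have h0 := h ⟨0, by omega⟩
  have h1 := h ⟨1, by omega⟩
  rw [h0] at h1
  simp at h1

/-- As long as every subsquare contains a potential receiver, information travels by at most three
subsquares per slot. -/
theorem abs_sub_le_of_mem_holds {s : ℕ} (hs : 1 ≤ s) (C : ℕ → Fin n → ℤ × ℤ)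
    (hgrid : ∀ t i, C t i ∈ grid s)
    (hmove : ∀ t i, |(C (t + 1) i).1 - (C t i).1| ≤ 1)
    (hpos : ∀ t i, ((C (t + 1) i).1 : ℝ) ≤ s * pos (t + 1) i 0 ∧
      s * pos (t + 1) i 0 ≤ (C (t + 1) i).1 + 1 ∧ ((C (t + 1) i).2 : ℝ) ≤ s * pos (t + 1) i 1 ∧
      s * pos (t + 1) i 1 ≤ (C (t + 1) i).2 + 1)
    (m : Fin k) (d : ℕ)
    (hrec : ∀ t, τ m ≤ t → t < τ m + d → ∀ c ∈ grid s, ∃ i, C (t + 1) i = c ∧ i ∉ senders φ ω t)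
    {j : Fin n} (hj : m ∈ holds φ pos src τ ω (τ m + d) j) :
    |(C (τ m + d) j).1 - (C (τ m) (src m)).1| ≤ 3 * d := by
  induction d generalizing j with
  | zero =>
    rw [add_zero, mem_holds_injection] at hj
    simp [hj]
  | succ d ih =>
    have ih' := fun j => ih (fun t h1 h2 => hrec t h1 (by omega)) (j := j)
    rw [← add_assoc, mem_holds_succ] at hj
    rw [← add_assoc]
    push_cast
    rcases hj with h | h | ⟨i, hdel, hsel⟩
    · have h1 := ih' j h
      have h2 := hmove (τ m + d) j
      rw [abs_le] at *
      omega
    · omega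
    · have h1 := ih' i hsel.1
      have h2 := hmove (τ m + d) i
      -- The sender shares its subsquare with a receiver, so its nearest receiver is within `√2 / s
      -- ≤ (3 / 2) / s`. The subsquares then differ by at most `5 / 2`, hence by at most `2`, in
      -- each coordinate; the move of the sender itself adds the third unit.
      obtain ⟨j', hj', hj'S⟩ := hrec (τ m + d) (by omega) (by omega) _ (hgrid (τ m + d + 1) i)
      have h3 := hdel.2.2.1 j' hj'S
      have hs' : (0 : ℝ) < s := by positivity
      have hi := hpos (τ m + d) i
      have hp := hpos (τ m + d) j'
      have hq := hpos (τ m + d) j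
      rw [hj'] at hp
      set x := pos (τ m + d + 1)
      have h4 : dist (x i) (x j') ≤ 3 / 2 * (1 / s) := by
        apply dist_le_of_abs_sub_le <;> rw [le_div_iff₀ hs', ← abs_of_pos hs', ← abs_mul, abs_le] <;> constructor <;> linarith
      have h5 : |x i 0 - x j 0| * s ≤ 3 / 2 := by
        have := (abs_sub_le_dist (x i) (x j) 0).trans (h3.trans h4)
        calc |x i 0 - x j 0| * s ≤ (3 / 2 * (1 / s)) * s := by gcongr
          _ = 3 / 2 := by field_simp
      rw [← abs_of_pos hs', ← abs_mul, abs_le] at h5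
      have h6 : ((C (τ m + d + 1) j).1 : ℝ) - (C (τ m + d + 1) i).1 < 3 := by linarith
      have h7 : ((C (τ m + d + 1) i).1 : ℝ) - (C (τ m + d + 1) j).1 < 3 := by linarith
      have h8 : (C (τ m + d + 1) j).1 - (C (τ m + d + 1) i).1 < 3 := by exact_mod_cast h6
      have h9 : (C (τ m + d + 1) i).1 - (C (τ m + d + 1) j).1 < 3 := by exact_mod_cast h7
      rw [abs_le] at *
      omega

/-- Receivers in the opposite subsquares `(0, 0)` and `(s - 1, 0)` both hold the message in the end,
and each is within `3 d` of the source subsquare. Hence `s - 1 ≤ 6 d`, and `d ≥ 1` gives `s ≤ 7 d`.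
-/
theorem le_of_forall_mem_holds (hn : 2 ≤ n) {s : ℕ} (hs : 1 ≤ s) (C : ℕ → Fin n → ℤ × ℤ)
    (hgrid : ∀ t i, C t i ∈ grid s)
    (hmove : ∀ t i, |(C (t + 1) i).1 - (C t i).1| ≤ 1)
    (hpos : ∀ t i, ((C (t + 1) i).1 : ℝ) ≤ s * pos (t + 1) i 0 ∧
      s * pos (t + 1) i 0 ≤ (C (t + 1) i).1 + 1 ∧ ((C (t + 1) i).2 : ℝ) ≤ s * pos (t + 1) i 1 ∧
      s * pos (t + 1) i 1 ≤ (C (t + 1) i).2 + 1)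
    (m : Fin k)
    (hrec : ∀ t ∈ Finset.Ico (τ m) (τ m + s), ∀ c ∈ grid s,
      ∃ i, C (t + 1) i = c ∧ i ∉ senders φ ω t) :
    ENNReal.ofReal (s / 7) ≤ ((spreadingTime φ pos src τ ω m : ℕ∞) : ℝ≥0∞) := by
  refine le_spreadingTime fun d hd => ?_
  have h1 := one_le_of_forall_mem_holds hn hd
  -- Only `s` slots have to be controlled: for `d ≥ s` the bound is immediate.
  by_cases hds : s ≤ d
  · have : (s : ℝ) ≤ d := by exact_mod_cast hds
    have : (0 : ℝ) ≤ s := by positivity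
    linarith
  · have hrec' : ∀ t, τ m ≤ t → t < τ m + d → ∀ c ∈ grid s,
        ∃ i, C (t + 1) i = c ∧ i ∉ senders φ ω t := fun t h2 h3 =>
      hrec t (Finset.mem_Ico.2 ⟨h2, by omega⟩)
    have key := fun j => abs_sub_le_of_mem_holds hs C hgrid hmove hpos m d hrec' (hd j)
    have hlast := hrec' (τ m + d - 1) (by omega) (by omega)
    rw [show τ m + d - 1 + 1 = τ m + d by omega] at hlast
    obtain ⟨p, hp, _⟩ := hlast (0, 0) (mem_grid.2 (by simp; omega))
    obtain ⟨q, hq, _⟩ := hlast ((s : ℤ) - 1, 0) (mem_grid.2 (by simp; omega))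
    have hp' := key p
    have hq' := key q
    rw [hp] at hp'
    rw [hq] at hq'
    rw [abs_le] at hp' hq'
    have : s ≤ 7 * d := by
      dsimp only at hp' hq'
      omega
    have : (s : ℝ) ≤ 7 * d := by exact_mod_cast this
    linarith

end Holds

/-! ### Probability that a message spreads too fast. -/

theorem cellOf_bounds {s : ℕ} (hs : 1 ≤ s) (p : I × I) :
    ((cellOf s p).1 : ℝ) ≤ s * p.1 ∧ (s : ℝ) * p.1 ≤ (cellOf s p).1 + 1 ∧
      ((cellOf s p).2 : ℝ) ≤ s * p.2 ∧ (s : ℝ) * p.2 ≤ (cellOf s p).2 + 1 := by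
  have key : ∀ u : I, ((min ⌊(s : ℝ) * u⌋ ((s : ℤ) - 1) : ℤ) : ℝ) ≤ s * u ∧
      (s : ℝ) * u ≤ ((min ⌊(s : ℝ) * u⌋ ((s : ℤ) - 1) : ℤ) : ℝ) + 1 := by
    intro u
    have h1 := Int.floor_le ((s : ℝ) * u)
    have h2 := Int.lt_floor_add_one ((s : ℝ) * u)
    have hs' : (0 : ℝ) < s := by positivity
    have h3 : (s : ℝ) * u ≤ s := by nlinarith [u.2.2]
    push_cast
    constructor
    · exact (min_le_left _ _).trans h1
    · rcases min_choice (⌊(s : ℝ) * u⌋ : ℝ) ((s : ℝ) - 1) with h | h <;> rw [h] <;> linarith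
  exact ⟨(key p.1).1, (key p.1).2, (key p.2).1, (key p.2).2⟩

/-- Union bound over `s` slots and `s ^ 2` subsquares, for an abstract trajectory `C` so as to cover
both networks. -/
theorem measure_exists_no_receiver_le {n s : ℕ} (φ : Phy) (hs : 1 ≤ s) (T : ℕ)
    (C : Run n → ℕ → Fin n → ℤ × ℤ)
    (hC : ∀ t, ∀ c ∈ grid s, runLaw n {ω | ∀ i, ¬ (C ω (t + 1) i = c ∧ i ∉ senders φ ω t)} ≤
      ENNReal.ofReal (Real.exp (-(n / (s : ℝ) ^ 2 / 2)))) :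
    runLaw n {ω | ¬ ∀ t ∈ Finset.Ico T (T + s), ∀ c ∈ grid s,
      ∃ i, C ω (t + 1) i = c ∧ i ∉ senders φ ω t} ≤
      ENNReal.ofReal ((s : ℝ) ^ 3 * Real.exp (-(n / (s : ℝ) ^ 2 / 2))) := by
  have hsub : {ω : Run n | ¬ ∀ t ∈ Finset.Ico T (T + s), ∀ c ∈ grid s,
      ∃ i, C ω (t + 1) i = c ∧ i ∉ senders φ ω t} ⊆
      ⋃ p ∈ Finset.Ico T (T + s) ×ˢ grid s,
        {ω | ∀ i, ¬ (C ω (p.1 + 1) i = p.2 ∧ i ∉ senders φ ω p.1)} := by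
    intro ω hω
    have hω' : ¬ ∀ t ∈ Finset.Ico T (T + s), ∀ c ∈ grid s,
      ∃ i, C ω (t + 1) i = c ∧ i ∉ senders φ ω t := hω
    push Not at hω'
    obtain ⟨t, ht, c, hc, h⟩ := hω'
    refine Set.mem_iUnion₂.2 ⟨(t, c), Finset.mem_product.2 ⟨ht, hc⟩, ?_⟩
    rintro i ⟨h1, h2⟩
    exact h2 (h i h1)
  refine (measure_mono hsub).trans ((measure_biUnion_finset_le _ _).trans ?_)
  refine (Finset.sum_le_sum fun p hp => hC p.1 p.2 (Finset.mem_product.1 hp).2).trans ?_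
  rw [Finset.sum_const, Finset.card_product, card_grid, Nat.card_Ico, nsmul_eq_mul,
    ENNReal.ofReal_mul (by positivity)]
  gcongr
  rw [show T + s - T = s by omega, ← ENNReal.ofReal_natCast]
  apply ENNReal.ofReal_le_ofReal
  push_cast
  exact le_of_eq (by ring)

theorem measure_mobileTime_lt_le {n k s : ℕ} (φ : Phy) (hn : 2 ≤ n) (hs : 1 ≤ s)
    (src : Fin k → Fin n) (τ : Fin k → ℕ) (m : Fin k) :
    runLaw n {ω | ¬ ENNReal.ofReal (s / 7) ≤ mobileTime φ s src τ ω m} ≤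
      ENNReal.ofReal ((s : ℝ) ^ 3 * Real.exp (-(n / (s : ℝ) ^ 2 / 2))) := by
  refine (measure_mono ?_).trans (measure_exists_no_receiver_le φ hs (τ m)
    (fun ω t i => cell s ω i t) fun t c hc =>
    measure_no_receiver_le hs φ (le_refl t) (move s) (sum_grid_move s) hc)
  intro ω hω hrec
  have hs' : (0 : ℝ) < s := by positivity
  refine hω (le_of_forall_mem_holds hn hs (fun t i => cell s ω i t)
    (fun t i => cell_mem_grid hs ω i t) (fun t i => (abs_move_sub_le s _ _).1) ?_ m hrec)
  intro t i
  have h1 := (ω.offset t i).1.2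
  have h2 := (ω.offset t i).2.2
  simp only [mobilePos, PiLp.toLp_apply, Matrix.cons_val_zero, Matrix.cons_val_one,
    mul_div_cancel₀ _ hs'.ne']
  refine ⟨?_, ?_, ?_, ?_⟩ <;> linarith [h1.1, h1.2, h2.1, h2.2]

/-- The static network does not know `s`: the grid is auxiliary and its side is optimised later.
Subsquares are frozen at time `0`, while the sender coins are those of the current slot. -/
theorem measure_staticTime_lt_le {n k s : ℕ} (φ : Phy) (hn : 2 ≤ n) (hs : 1 ≤ s)
    (src : Fin k → Fin n) (τ : Fin k → ℕ) (m : Fin k) :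
    runLaw n {ω | ¬ ENNReal.ofReal (s / 7) ≤ staticTime φ src τ ω m} ≤
      ENNReal.ofReal ((s : ℝ) ^ 3 * Real.exp (-(n / (s : ℝ) ^ 2 / 2))) := by
  refine (measure_mono ?_).trans (measure_exists_no_receiver_le φ hs (τ m)
    (fun ω _ i => cell s ω i 0) fun t c hc =>
    measure_no_receiver_le hs φ (Nat.zero_le t) (fun c _ => c) (fun f => ?_) hc)
  · intro ω hω hrec
    refine hω (le_of_forall_mem_holds hn hs (fun _ i => cell s ω i 0)
      (fun t i => cell_mem_grid hs ω i 0) (fun t i => by simp) ?_ m hrec)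
    intro t i
    simpa [staticPos, initPos, cell] using cellOf_bounds hs (ω.init i)
  · simp [Finset.smul_sum]

/-! ### The total weight of the interferers -/

/-- The integral over the plane of the interference kernel at unit scale. -/
noncomputable def kernelMass (α : ℝ) : ℝ≥0∞ := ∫⁻ z : ℝ × ℝ, ENNReal.ofReal ((1 + ‖z‖) ^ (-α))

/-- Integrability at infinity in dimension two: this is the role of `α > 2`. -/
theorem kernelMass_lt_top {α : ℝ} (hα : 2 < α) : kernelMass α < ⊤ := by
  refine finite_integral_one_add_norm (E := ℝ × ℝ) (μ := volume) ?_
  simpa using hα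

/-- Scaling and translation invariance of Lebesgue measure. The parameter `a` will be the side `s`
of the grid, which blows subsquares up to unit cells. -/
theorem lintegral_kernel {α r a : ℝ} (hr : 0 < r) (ha : 0 < a) (y : ℝ × ℝ) :
    ∫⁻ z : ℝ × ℝ, ENNReal.ofReal ((r + ‖a⁻¹ • z - y‖) ^ (-α)) =
      ENNReal.ofReal (a ^ 2 * r ^ (2 - α)) * kernelMass α := by
  have h1 : ∀ z : ℝ × ℝ, ENNReal.ofReal ((r + ‖a⁻¹ • z - y‖) ^ (-α)) =
      ENNReal.ofReal (r ^ (-α)) *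
        ENNReal.ofReal ((1 + ‖(a * r)⁻¹ • z - r⁻¹ • y‖) ^ (-α)) := by
    intro z
    rw [← ENNReal.ofReal_mul (by positivity), ← Real.mul_rpow hr.le (by positivity)]
    congr 2
    have : (a * r)⁻¹ • z - r⁻¹ • y = r⁻¹ • (a⁻¹ • z - y) := by
      rw [smul_sub, smul_smul, mul_inv, mul_comm]
    rw [this, norm_smul, Real.norm_of_nonneg (by positivity)]
    field_simp
  simp_rw [h1]
  have hm : Measurable fun z : ℝ × ℝ => ENNReal.ofReal ((1 + ‖z - r⁻¹ • y‖) ^ (-α)) := by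
    fun_prop
  rw [lintegral_const_mul _ (by fun_prop)]
  have h2 : ∫⁻ z : ℝ × ℝ, ENNReal.ofReal ((1 + ‖(a * r)⁻¹ • z - r⁻¹ • y‖) ^ (-α)) =
      ENNReal.ofReal ((a * r) ^ 2) * kernelMass α := by
    rw [← lintegral_map (f := fun z : ℝ × ℝ => ENNReal.ofReal ((1 + ‖z - r⁻¹ • y‖) ^ (-α)))
      (g := fun z => (a * r)⁻¹ • z) hm (by fun_prop)]
    rw [Measure.map_addHaar_smul volume (by positivity), lintegral_smul_measure, smul_eq_mul]
    congr 1
    · rw [Module.finrank_prod, Module.finrank_self, inv_pow, inv_inv, abs_of_pos (by positivity)]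
    · exact lintegral_sub_right_eq_self (fun z => ENNReal.ofReal ((1 + ‖z‖) ^ (-α))) (r⁻¹ • y)
  rw [h2, ← mul_assoc, ← ENNReal.ofReal_mul (by positivity)]
  congr 2
  rw [show 2 - α = 2 + -α by ring, Real.rpow_add hr, Real.rpow_two]
  ring

/-- The unit cell of `ℝ × ℝ` with lower left corner `c`. -/
def unitCell (c : ℤ × ℤ) : Set (ℝ × ℝ) := Set.Ico (c.1 : ℝ) (c.1 + 1) ×ˢ Set.Ico (c.2 : ℝ) (c.2 + 1)

theorem measurableSet_unitCell (c : ℤ × ℤ) : MeasurableSet (unitCell c) :=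
  measurableSet_Ico.prod measurableSet_Ico

theorem mem_unitCell_iff {c : ℤ × ℤ} {z : ℝ × ℝ} : z ∈ unitCell c ↔ (⌊z.1⌋, ⌊z.2⌋) = c := by
  simp only [unitCell, Set.mem_prod, Set.mem_Ico, Prod.ext_iff, Int.floor_eq_iff]

theorem lintegral_offset (c : ℤ × ℤ) {F : ℝ × ℝ → ℝ≥0∞} (hF : Measurable F) :
    ∫⁻ o : I × I, F ((c.1 : ℝ) + o.1, (c.2 : ℝ) + o.2) = ∫⁻ z in unitCell c, F z := by
  have hmp : MeasurePreserving (Prod.map ((↑) : I → ℝ) ((↑) : I → ℝ)) volume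
      ((volume : Measure (ℝ × ℝ)).restrict (Set.Ico 0 1 ×ˢ Set.Ico 0 1)) := by
    have h := unitInterval.measurePreserving_coe.prod unitInterval.measurePreserving_coe
    rw [Measure.prod_restrict] at h
    convert! h using 1
    refine Measure.restrict_congr_set ?_
    exact Measure.set_prod_ae_eq Ico_ae_eq_Icc Ico_ae_eq_Icc
  have h1 := hmp.lintegral_comp (f := fun z => F (((c.1 : ℝ), (c.2 : ℝ)) + z)) (by fun_prop)
  have h2 : ∀ o : I × I, F ((c.1 : ℝ) + o.1, (c.2 : ℝ) + o.2) =
      (fun z => F (((c.1 : ℝ), (c.2 : ℝ)) + z)) (Prod.map ((↑) : I → ℝ) ((↑) : I → ℝ) o) :=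
    fun o => rfl
  simp_rw [h2]
  rw [h1, ← lintegral_indicator (measurableSet_Ico.prod measurableSet_Ico),
    ← lintegral_indicator (measurableSet_unitCell c),
    ← lintegral_add_left_eq_self ((unitCell c).indicator F) (((c.1 : ℝ), (c.2 : ℝ)) : ℝ × ℝ)]
  refine lintegral_congr fun z => ?_
  have h3 : ((((c.1 : ℝ), (c.2 : ℝ)) : ℝ × ℝ) + z ∈ unitCell c) ↔
      z ∈ Set.Ico (0 : ℝ) 1 ×ˢ Set.Ico (0 : ℝ) 1 := by
    simp [unitCell]
  by_cases hz : z ∈ Set.Ico (0 : ℝ) 1 ×ˢ Set.Ico (0 : ℝ) 1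
  · rw [Set.indicator_of_mem hz, Set.indicator_of_mem (h3.2 hz)]
  · rw [Set.indicator_of_notMem hz, Set.indicator_of_notMem (fun h => hz (h3.1 h))]

theorem sum_lintegral_offset_le (s : ℕ) {F : ℝ × ℝ → ℝ≥0∞} (hF : Measurable F) :
    ∑ c ∈ grid s, ∫⁻ o : I × I, F ((c.1 : ℝ) + o.1, (c.2 : ℝ) + o.2) ≤ ∫⁻ z, F z := by
  simp_rw [lintegral_offset _ hF]
  rw [← lintegral_biUnion_finset (fun c _ c' _ hcc' => ?_) fun c _ => measurableSet_unitCell c]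
  · exact setLIntegral_le_lintegral _ _
  · refine Set.disjoint_left.2 fun z h1 h2 => hcc' ?_
    rw [← mem_unitCell_iff.1 h1, mem_unitCell_iff.1 h2]

/-- New position of a user of subsquare `c` that draws the seed `ξ`. -/
noncomputable def place (s : ℕ) (c : ℤ × ℤ) (ξ : SlotSeed) : ℝ × ℝ :=
  ((((move s c ξ.1).1 : ℝ) + (ξ.2.1.1 : ℝ)) / s, (((move s c ξ.1).2 : ℝ) + (ξ.2.1.2 : ℝ)) / s)

theorem measurable_place (s : ℕ) (c : ℤ × ℤ) : Measurable (place s c) := by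
  have h1 : Measurable fun d : Fin 3 × Fin 3 => ((move s c d).1 : ℝ) := measurable_of_countable _
  have h2 : Measurable fun d : Fin 3 × Fin 3 => ((move s c d).2 : ℝ) := measurable_of_countable _
  unfold place
  refine Measurable.prodMk (Measurable.div_const (Measurable.add ?_ ?_) _)
    (Measurable.div_const (Measurable.add ?_ ?_) _)
  · exact h1.comp measurable_fst
  · exact measurable_subtype_coe.comp (by fun_prop : Measurable fun ξ : SlotSeed => ξ.2.1.1)
  · exact h2.comp measurable_fst
  · exact measurable_subtype_coe.comp (by fun_prop : Measurable fun ξ : SlotSeed => ξ.2.1.2)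

/-- If no subsquare holds more than `M` users, the expected weight of the users around any point
after a slot is at most `M` times its value for one uniform user per subsquare. -/
theorem sum_lintegral_kernel_place_le {n s : ℕ} (hs : 1 ≤ s) {c : Fin n → ℤ × ℤ}
    (hc : ∀ l, c l ∈ grid s) {M : ℝ} (hM : ∀ c' ∈ grid s, (occupancy c c' : ℝ) ≤ M)
    {α r : ℝ} (hr : 0 < r) (y : ℝ × ℝ) :
    ∑ l, ∫⁻ ξ, ENNReal.ofReal ((r + ‖place s (c l) ξ - y‖) ^ (-α)) ∂slotLaw ≤
      ENNReal.ofReal M * (ENNReal.ofReal ((s : ℝ) ^ 2 * r ^ (2 - α)) * kernelMass α) := by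
  have hs' : (0 : ℝ) < s := by positivity
  set F : ℝ × ℝ → ℝ≥0∞ := fun z => ENNReal.ofReal ((r + ‖(s : ℝ)⁻¹ • z - y‖) ^ (-α)) with hF
  have hFm : Measurable F := by rw [hF]; fun_prop
  let g : ℤ × ℤ → ℝ≥0∞ := fun c' => ∫⁻ o : I × I, F ((c'.1 : ℝ) + o.1, (c'.2 : ℝ) + o.2)
  have h1 : ∀ c', ∫⁻ ξ, ENNReal.ofReal ((r + ‖place s c' ξ - y‖) ^ (-α)) ∂slotLaw =
      (9 : ℝ≥0∞)⁻¹ * ∑ d, g (move s c' d) := by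
    intro c'
    have hp := measurable_place s c'
    rw [lintegral_slotLaw (f := fun ξ => ENNReal.ofReal ((r + ‖place s c' ξ - y‖) ^ (-α)))
      (by fun_prop)]
    congr 1
    refine Finset.sum_congr rfl fun d _ => ?_
    have h2 : ∀ u : (I × I) × I × I, ENNReal.ofReal ((r + ‖place s c' (d, u) - y‖) ^ (-α)) =
        (fun o : I × I => F (((move s c' d).1 : ℝ) + o.1, ((move s c' d).2 : ℝ) + o.2)) u.1 := by
      intro u
      simp only [hF, place, Prod.smul_mk, smul_eq_mul, div_eq_inv_mul]
    simp_rw [h2]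
    exact (measurePreserving_fst (μ := (volume : Measure (I × I)))
      (ν := (volume : Measure (I × I)))).lintegral_comp
      (f := fun o : I × I => F (((move s c' d).1 : ℝ) + o.1, ((move s c' d).2 : ℝ) + o.2))
      (by fun_prop)
  simp_rw [h1]
  have h3 : ∑ l, (9 : ℝ≥0∞)⁻¹ * ∑ d, g (move s (c l) d) =
      ∑ c' ∈ grid s, (occupancy c c' : ℝ≥0∞) * ((9 : ℝ≥0∞)⁻¹ * ∑ d, g (move s c' d)) := by
    rw [← Finset.sum_fiberwise_of_maps_to (s := Finset.univ) (t := grid s) (g := c)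
      fun l _ => hc l]
    refine Finset.sum_congr rfl fun c' _ => ?_
    rw [Finset.sum_congr rfl (g := fun _ => (9 : ℝ≥0∞)⁻¹ * ∑ d, g (move s c' d))
      (fun l hl => by rw [(Finset.mem_filter.1 hl).2]), Finset.sum_const, nsmul_eq_mul]
    rfl
  rw [h3]
  calc ∑ c' ∈ grid s, (occupancy c c' : ℝ≥0∞) * ((9 : ℝ≥0∞)⁻¹ * ∑ d, g (move s c' d))
      ≤ ∑ c' ∈ grid s, ENNReal.ofReal M * ((9 : ℝ≥0∞)⁻¹ * ∑ d, g (move s c' d)) := by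
        refine Finset.sum_le_sum fun c' hc' => ?_
        gcongr
        rw [← ENNReal.ofReal_natCast]
        exact ENNReal.ofReal_le_ofReal (hM c' hc')
    -- Double stochasticity of the walk removes the averaging over directions.
    _ = ENNReal.ofReal M * ∑ c' ∈ grid s, g c' := by
        rw [← Finset.mul_sum, ← Finset.mul_sum, sum_grid_move s g, nsmul_eq_mul]
        congr 1
        rw [← mul_assoc]
        norm_num
        rw [ENNReal.inv_mul_cancel (by norm_num) (by norm_num), one_mul]
    _ ≤ _ := by
        gcongr
        rw [← lintegral_kernel hr hs' y]
        exact sum_lintegral_offset_le s hFm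

/-! ### A sufficient condition for a successful transmission -/

/-- A point of `ℝ × ℝ` as a point of the Euclidean plane. -/
noncomputable def toPlane (z : ℝ × ℝ) : Plane := !₂[z.1, z.2]

/-- Interference is estimated in the sup norm of `ℝ × ℝ`, which is within a factor `√2 ≤ 3 / 2` of
the Euclidean distance of the model. -/
theorem norm_sub_le_dist_toPlane (z z' : ℝ × ℝ) : ‖z - z'‖ ≤ dist (toPlane z) (toPlane z') := by
  rw [Prod.norm_def, max_le_iff]
  exact ⟨abs_sub_le_dist (toPlane z) (toPlane z') 0, abs_sub_le_dist (toPlane z) (toPlane z') 1⟩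

theorem dist_toPlane_le (z z' : ℝ × ℝ) : dist (toPlane z) (toPlane z') ≤ 3 / 2 * ‖z - z'‖ := by
  apply dist_le_of_abs_sub_le
  · exact norm_fst_le (z - z')
  · exact norm_snd_le (z - z')

/-- A single user within distance `r` would already contribute `(2 r) ^ (-α)`. -/
theorem lt_norm_of_sum_kernel_lt {ι : Type*} {L : Finset ι} {x : ι → ℝ × ℝ} {y : ℝ × ℝ}
    {r α : ℝ} (hr : 0 < r) (hα : 0 < α)
    (hW : ∑ l ∈ L, (r + ‖x l - y‖) ^ (-α) < (2 * r) ^ (-α)) {l : ι} (hl : l ∈ L) :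
    r < ‖x l - y‖ := by
  by_contra h
  have h1 : (r + ‖x l - y‖) ^ (-α) ≤ ∑ l ∈ L, (r + ‖x l - y‖) ^ (-α) :=
    Finset.single_le_sum (f := fun l => (r + ‖x l - y‖) ^ (-α)) (fun l _ => by positivity) hl
  have h2 : (2 * r) ^ (-α) ≤ (r + ‖x l - y‖) ^ (-α) :=
    Real.rpow_le_rpow_of_nonpos (by positivity) (by linarith) (by linarith)
  linarith

/-- A small total weight does two things. It keeps all third users farther than `r` from `j`, while
`i` is within `ρ r ≤ r / 4`, so `j` is the nearest receiver whoever else sends. It also bounds the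
interference by `P r ^ (-α)`; as `r ≤ 1`, the noise is at most `η r ^ (-α)`, and the choice of `ρ`
lets the signal win. The positions must differ because `0 ^ (-α) = 0`: coincident users would have
no signal. -/
theorem delivers_of_sum_kernel_lt {n : ℕ} (φ : Phy) {x : Fin n → ℝ × ℝ} {S : Finset (Fin n)}
    {i j : Fin n} (hi : i ∈ S) (hj : j ∉ S) {r ρ : ℝ} (hr : 0 < r) (hr1 : r ≤ 1) (hρ : 0 < ρ)
    (hρ4 : ρ ≤ 1 / 4) (hρφ : φ.β * (φ.η + φ.P) ≤ φ.P * (2 * ρ) ^ (-φ.α))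
    (hpos : 0 < ‖x i - x j‖) (hnear : ‖x i - x j‖ ≤ ρ * r)
    (hW : ∑ l ∈ (Finset.univ.erase j).erase i, (r + ‖x l - x j‖) ^ (-φ.α) < (2 * r) ^ (-φ.α)) :
    Delivers φ (fun l => toPlane (x l)) S i j := by
  have hα : 0 < φ.α := by linarith [φ.two_lt_α]
  have hP := φ.P_pos
  have hη := φ.η_pos
  have hβ := φ.β_pos
  have hfar : ∀ l, l ≠ i → l ≠ j → r < ‖x l - x j‖ := fun l hli hlj =>
    lt_norm_of_sum_kernel_lt hr hα hW (by simp [hli, hlj])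
  have hd0 : 0 < dist (toPlane (x i)) (toPlane (x j)) :=
    hpos.trans_le (norm_sub_le_dist_toPlane _ _)
  have hd1 : dist (toPlane (x i)) (toPlane (x j)) ≤ 2 * ρ * r := by
    have := dist_toPlane_le (x i) (x j)
    nlinarith
  refine ⟨hi, hj, fun j' hj' => ?_, ?_⟩
  · by_cases hjj : j' = j
    · rw [hjj]
    · have hj'i : j' ≠ i := fun h => hj' (h ▸ hi)
      have h1 := hfar j' hj'i hjj
      have h2 : ‖x j' - x j‖ ≤ ‖x i - x j‖ + ‖x i - x j'‖ := by
        rw [norm_sub_rev (x i) (x j')]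
        calc ‖x j' - x j‖ = ‖(x i - x j) + (x j' - x i)‖ := by congr 1; abel
          _ ≤ _ := norm_add_le _ _
      have h3 := norm_sub_le_dist_toPlane (x i) (x j')
      dsimp only
      nlinarith
  · have hsum : ∑ l ∈ S.erase i, φ.P * dist (toPlane (x l)) (toPlane (x j)) ^ (-φ.α) ≤
        φ.P * r ^ (-φ.α) := by
      rw [← Finset.mul_sum]
      refine mul_le_mul_of_nonneg_left ?_ hP.le
      have h1 : ∑ l ∈ S.erase i, dist (toPlane (x l)) (toPlane (x j)) ^ (-φ.α) ≤
          ∑ l ∈ (Finset.univ.erase j).erase i,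
            2 ^ φ.α * (r + ‖x l - x j‖) ^ (-φ.α) := by
        calc ∑ l ∈ S.erase i, dist (toPlane (x l)) (toPlane (x j)) ^ (-φ.α)
            ≤ ∑ l ∈ S.erase i, 2 ^ φ.α * (r + ‖x l - x j‖) ^ (-φ.α) := by
              refine Finset.sum_le_sum fun l hl => ?_
              have hl' := Finset.mem_erase.1 hl
              have h2 := hfar l hl'.1 fun h => hj (h ▸ hl'.2)
              have h3 := norm_sub_le_dist_toPlane (x l) (x j)
              -- Beyond distance `r`, half of `r + ‖x l - x j‖` is a lower bound for the distance;
              -- the lost factor `2 ^ α` turns `(2 r) ^ (-α)` into `r ^ (-α)`.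
              calc dist (toPlane (x l)) (toPlane (x j)) ^ (-φ.α)
                  ≤ ((r + ‖x l - x j‖) / 2) ^ (-φ.α) :=
                    Real.rpow_le_rpow_of_nonpos (by positivity) (by linarith) (by linarith)
                _ = 2 ^ φ.α * (r + ‖x l - x j‖) ^ (-φ.α) := by
                    rw [Real.div_rpow (by positivity) (by norm_num), Real.rpow_neg zero_le_two,
                      div_inv_eq_mul, mul_comm]
          _ ≤ _ := by
              refine Finset.sum_le_sum_of_subset_of_nonneg ?_ fun l _ _ => by positivity
              intro l hl
              have hl' := Finset.mem_erase.1 hl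
              simp only [Finset.mem_erase, Finset.mem_univ, and_true]
              exact ⟨hl'.1, fun h => hj (h ▸ hl'.2)⟩
      rw [← Finset.mul_sum] at h1
      refine h1.trans ?_
      calc (2 : ℝ) ^ φ.α * ∑ l ∈ (Finset.univ.erase j).erase i, (r + ‖x l - x j‖) ^ (-φ.α)
          ≤ 2 ^ φ.α * (2 * r) ^ (-φ.α) := by gcongr
        _ = r ^ (-φ.α) := by
            rw [Real.mul_rpow zero_le_two hr.le, ← mul_assoc, ← Real.rpow_add two_pos]
            simp
    have hsum0 : 0 ≤ ∑ l ∈ S.erase i, φ.P * dist (toPlane (x l)) (toPlane (x j)) ^ (-φ.α) :=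
      Finset.sum_nonneg fun l _ => by positivity
    have hr2 : 1 ≤ r ^ (-φ.α) := Real.one_le_rpow_of_pos_of_le_one_of_nonpos hr hr1 (by linarith)
    unfold sinr
    rw [le_div_iff₀ (by linarith)]
    calc φ.β * (φ.η + ∑ l ∈ S.erase i, φ.P * dist (toPlane (x l)) (toPlane (x j)) ^ (-φ.α))
        ≤ φ.β * (φ.η * r ^ (-φ.α) + φ.P * r ^ (-φ.α)) := by
          gcongr
          nlinarith
      _ = φ.β * (φ.η + φ.P) * r ^ (-φ.α) := by ring
      _ ≤ φ.P * (2 * ρ) ^ (-φ.α) * r ^ (-φ.α) := by gcongr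
      _ = φ.P * (2 * ρ * r) ^ (-φ.α) := by
          rw [Real.mul_rpow (by positivity) hr.le, mul_assoc]
      _ ≤ φ.P * dist (toPlane (x i)) (toPlane (x j)) ^ (-φ.α) := by
          gcongr ?_ * ?_
          exact Real.rpow_le_rpow_of_nonpos hd0 hd1 (by linarith)

/-! ### Probability of a successful transmission between two given users -/

/-- With `q` the rank of `m` in `A`, all seeds in `[q / #A, (q + 1) / #A)` select `m`, and `#A ≤ k`.
-/
theorem volume_Selects_ge {k : ℕ} {A : Finset (Fin k)} {m : Fin k} (hm : m ∈ A) :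
    ENNReal.ofReal (1 / k) ≤ volume {u : I | Selects u A m} := by
  have hq : (A.filter (· < m)).card < A.card :=
    Finset.card_lt_card (Finset.filter_ssubset.2 ⟨m, hm, lt_irrefl m⟩)
  have hqk : A.card ≤ k := by simpa using A.card_le_univ
  set q := (A.filter (· < m)).card with hqdef
  have hA : (0 : ℝ) < A.card := by
    have : 0 < A.card := by omega
    exact_mod_cast this
  have hq1 : (q : ℝ) + 1 ≤ A.card := by exact_mod_cast hq
  let a : I := ⟨q / A.card, by positivity, by rw [div_le_one hA]; linarith⟩
  let b : I := ⟨(q + 1) / A.card, by positivity, by rw [div_le_one hA]; linarith⟩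
  have hab : (b : ℝ) - a = 1 / A.card := by simp only [a, b]; field_simp; ring
  calc ENNReal.ofReal (1 / k) ≤ ENNReal.ofReal (b - a) := by
        rw [hab]
        apply ENNReal.ofReal_le_ofReal
        apply one_div_le_one_div_of_le hA
        exact_mod_cast hqk
    _ = volume (Set.Ico a b) := (unitInterval.volume_Ico _ _).symm
    _ ≤ _ := by
        refine measure_mono fun u hu => ⟨hm, ?_⟩
        have h1 : (q : ℝ) / A.card ≤ u := hu.1
        have h2 : (u : ℝ) < (q + 1) / A.card := hu.2
        rw [div_le_iff₀ hA] at h1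
        rw [lt_div_iff₀ hA] at h2
        rw [Nat.floor_eq_iff (mul_nonneg u.2.1 hA.le)]
        exact ⟨h1, h2⟩

theorem measurableSet_Selects {k : ℕ} (A : Finset (Fin k)) (m : Fin k) :
    MeasurableSet {u : I | Selects u A m} := by
  unfold Selects
  refine MeasurableSet.inter (MeasurableSet.const _) ?_
  have h : Measurable fun u : I => ⌊(u : ℝ) * (A.card : ℝ)⌋₊ :=
    Nat.measurable_floor.comp (by fun_prop)
  exact h (measurableSet_singleton _)

/-- Points of the unit interval at distance at most `ε` from `u`, other than `u`. -/
def near (ε : ℝ) (u : I) : Set I := {u' | 0 < |(u' : ℝ) - u| ∧ |(u' : ℝ) - u| ≤ ε}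

/-- Close to an endpoint only one side of `u` is available; the interval is taken on the side of the
midpoint. -/
theorem volume_near_ge {ε : ℝ} (h0 : 0 < ε) (h1 : ε ≤ 1 / 2) (u : I) :
    ENNReal.ofReal ε ≤ volume (near ε u) := by
  have hu0 := u.2.1
  have hu1 := u.2.2
  by_cases h : (u : ℝ) ≤ 1 / 2
  · let b : I := ⟨u + ε, by linarith, by linarith⟩
    have hb : (b : ℝ) = u + ε := rfl
    calc ENNReal.ofReal ε = ENNReal.ofReal (b - u) := by rw [hb, add_sub_cancel_left]
      _ = volume (Set.Ioc u b) := (unitInterval.volume_Ioc _ _).symm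
      _ ≤ _ := by
        refine measure_mono fun v hv => ?_
        have h2 : (u : ℝ) < v := hv.1
        have h3 : (v : ℝ) ≤ u + ε := hv.2
        refine ⟨abs_pos.2 (by linarith), abs_le.2 ⟨by linarith, by linarith⟩⟩
  · push Not at h
    let b : I := ⟨u - ε, by linarith, by linarith⟩
    have hb : (b : ℝ) = u - ε := rfl
    calc ENNReal.ofReal ε = ENNReal.ofReal (u - b) := by rw [hb, sub_sub_cancel]
      _ = volume (Set.Ico b u) := (unitInterval.volume_Ico _ _).symm
      _ ≤ _ := by
        refine measure_mono fun v hv => ?_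
        have h2 : (u : ℝ) - ε ≤ v := hv.1
        have h3 : (v : ℝ) < u := hv.2
        refine ⟨abs_pos.2 (by linarith), abs_le.2 ⟨by linarith, by linarith⟩⟩

section Hit

variable {n k : ℕ}

/-- The set of seeds with which a user of the subsquare `c'` stays there, at an offset close to `o`,
and pushes message `m` out of its set `A` of messages. -/
def aim (φ : Phy) (s : ℕ) (c' : ℤ × ℤ) (ε : ℝ) (A : Finset (Fin k)) (m : Fin k) (o : I × I) :
    Set SlotSeed :=
  {ξ | move s c' ξ.1 = c' ∧ ξ.2.1.1 ∈ near ε o.1 ∧ ξ.2.1.2 ∈ near ε o.2 ∧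
    (ξ.2.2.1 : ℝ) < φ.θ ∧ Selects ξ.2.2.2 A m}

/-- The set of seeds with which a user of subsquare `c` moves to `c'` and becomes a potential
receiver. -/
def land (φ : Phy) (s : ℕ) (c c' : ℤ × ℤ) : Set SlotSeed :=
  {ξ | move s c ξ.1 = c' ∧ φ.θ ≤ (ξ.2.2.1 : ℝ)}

/-- User `j` moves next to user `i`, and only `i` is designated as a sender, of message `m`. -/
def meet (φ : Phy) (s : ℕ) (c : Fin n → ℤ × ℤ) (A : Fin n → Finset (Fin k)) (m : Fin k) (ε : ℝ)
    (i j : Fin n) : Set (Fin n → SlotSeed) :=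
  {ξ | ξ j ∈ land φ s (c j) (c i) ∧ ξ i ∈ aim φ s (c i) ε (A i) m (ξ j).2.1}

/-- Total weight around user `j` of the users other than `i` and `j`. -/
noncomputable def crowd (α : ℝ) (s : ℕ) (c : Fin n → ℤ × ℤ) (r : ℝ) (i j : Fin n)
    (ξ : Fin n → SlotSeed) : ℝ :=
  ∑ l ∈ (Finset.univ.erase j).erase i, (r + ‖place s (c l) (ξ l) - place s (c j) (ξ j)‖) ^ (-α)

/-- User `i` meets user `j` in a place that is not crowded. -/
def hit (φ : Phy) (s : ℕ) (c : Fin n → ℤ × ℤ) (A : Fin n → Finset (Fin k)) (m : Fin k) (ρ r : ℝ)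
    (i j : Fin n) : Set (Fin n → SlotSeed) :=
  meet φ s c A m (ρ * r * s) i j ∩ {ξ | crowd φ.α s c r i j ξ < (2 * r) ^ (-φ.α)}

theorem slotLaw_prod (D : Set (Fin 3 × Fin 3)) (O : Set (I × I)) (U V : Set I) :
    slotLaw (D ×ˢ (O ×ˢ (U ×ˢ V))) =
      (PMF.uniformOfFintype (Fin 3 × Fin 3)).toMeasure D * (volume O * (volume U * volume V)) := by
  unfold slotLaw
  rw [Measure.prod_prod, Measure.volume_eq_prod, Measure.prod_prod,
    show volume (U ×ˢ V) = volume U * volume V from Measure.prod_prod U V]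

theorem move_stay (s : ℕ) (c : ℤ × ℤ) : move s c (1, 1) = c := by
  unfold move
  simp

theorem exists_move_eq {s : ℕ} {c c' : ℤ × ℤ} (hc' : c' ∈ grid s) (h1 : |c'.1 - c.1| ≤ 1)
    (h2 : |c'.2 - c.2| ≤ 1) : ∃ d, move s c d = c' := by
  rw [abs_le] at h1 h2
  refine ⟨(⟨(c'.1 - c.1 + 1).toNat, by omega⟩, ⟨(c'.2 - c.2 + 1).toNat, by omega⟩), ?_⟩
  have e1 : c.1 + (((c'.1 - c.1 + 1).toNat : ℕ) : ℤ) - 1 = c'.1 := by omega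
  have e2 : c.2 + (((c'.2 - c.2 + 1).toNat : ℕ) : ℤ) - 1 = c'.2 := by omega
  unfold move
  dsimp only
  rw [e1, e2, if_pos (mem_grid.1 hc')]

theorem toMeasure_uniform_singleton (d : Fin 3 × Fin 3) :
    (PMF.uniformOfFintype (Fin 3 × Fin 3)).toMeasure {d} = ENNReal.ofReal (1 / 9) := by
  rw [PMF.toMeasure_apply_singleton _ _ (measurableSet_singleton _), PMF.uniformOfFintype_apply]
  rw [one_div, ENNReal.ofReal_inv_of_pos (by norm_num)]
  norm_num

/-- At least one direction out of nine leads there, and the coin designates a receiver with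
probability at least `1 / 2`. -/
theorem slotLaw_land_ge (φ : Phy) {s : ℕ} {c c' : ℤ × ℤ} (hc' : c' ∈ grid s)
    (h1 : |c'.1 - c.1| ≤ 1) (h2 : |c'.2 - c.2| ≤ 1) :
    ENNReal.ofReal (1 / 18) ≤ slotLaw (land φ s c c') := by
  obtain ⟨d, hd⟩ := exists_move_eq hc' h1 h2
  have hsub : ({d} : Set (Fin 3 × Fin 3)) ×ˢ ((Set.univ : Set (I × I)) ×ˢ
      ({u : I | φ.θ ≤ u} ×ˢ (Set.univ : Set I))) ⊆ land φ s c c' := by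
    rintro ξ ⟨hξ1, -, hξ2, -⟩
    refine ⟨?_, hξ2⟩
    rw [Set.mem_singleton_iff.1 hξ1, hd]
  refine le_trans ?_ (measure_mono hsub)
  rw [slotLaw_prod, toMeasure_uniform_singleton, volume_coin_ge, measure_univ, measure_univ,
    one_mul, mul_one, ← ENNReal.ofReal_mul (by norm_num)]
  apply ENNReal.ofReal_le_ofReal
  linarith [φ.θ_lt_half]

theorem slotLaw_aim_ge (φ : Phy) (s : ℕ) (c' : ℤ × ℤ) {ε : ℝ} (h0 : 0 < ε)
    (h1 : ε ≤ 1 / 2) {A : Finset (Fin k)} {m : Fin k} (hm : m ∈ A) (o : I × I) :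
    ENNReal.ofReal (ε ^ 2 * φ.θ / (9 * k)) ≤ slotLaw (aim φ s c' ε A m o) := by
  have hθ := φ.θ_pos
  have hsub : ({(1, 1)} : Set (Fin 3 × Fin 3)) ×ˢ ((near ε o.1 ×ˢ near ε o.2) ×ˢ
      ({u : I | (u : ℝ) < φ.θ} ×ˢ {u : I | Selects u A m})) ⊆ aim φ s c' ε A m o := by
    rintro ξ ⟨hξ1, ⟨hξ2, hξ3⟩, hξ4, hξ5⟩
    refine ⟨?_, hξ2, hξ3, hξ4, hξ5⟩
    rw [Set.mem_singleton_iff.1 hξ1, move_stay]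
  refine le_trans ?_ (measure_mono hsub)
  rw [slotLaw_prod, toMeasure_uniform_singleton, volume_coin_lt, Measure.volume_eq_prod,
    Measure.prod_prod]
  calc ENNReal.ofReal (ε ^ 2 * φ.θ / (9 * k)) =
      ENNReal.ofReal (1 / 9) * ((ENNReal.ofReal ε * ENNReal.ofReal ε) *
        (ENNReal.ofReal φ.θ * ENNReal.ofReal (1 / k))) := by
        rw [← ENNReal.ofReal_mul h0.le, ← ENNReal.ofReal_mul hθ.le,
          ← ENNReal.ofReal_mul (by positivity), ← ENNReal.ofReal_mul (by positivity)]
        congr 1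
        field_simp
    _ ≤ _ := by
        gcongr
        · exact volume_near_ge h0 h1 _
        · exact volume_near_ge h0 h1 _
        · exact volume_Selects_ge hm

theorem measurableSet_land (φ : Phy) (s : ℕ) (c c' : ℤ × ℤ) : MeasurableSet (land φ s c c') := by
  refine MeasurableSet.inter ?_ ?_
  · exact measurable_fst (measurable_of_countable (fun d => move s c d) (measurableSet_singleton c'))
  · exact measurableSet_le measurable_const (measurable_subtype_coe.comp
        (by fun_prop : Measurable fun ξ : SlotSeed => ξ.2.2.1))

theorem measurableSet_aim (φ : Phy) (s : ℕ) (c' : ℤ × ℤ) (ε : ℝ) (A : Finset (Fin k))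
    (m : Fin k) : MeasurableSet {p : SlotSeed × (I × I) | p.1 ∈ aim φ s c' ε A m p.2} := by
  have hnear : ∀ {f g : SlotSeed × (I × I) → I}, Measurable f → Measurable g →
      MeasurableSet {p | f p ∈ near ε (g p)} := by
    intro f g hf hg
    have h : Measurable fun p => |(f p : ℝ) - g p| := by
      have h1 := measurable_subtype_coe.comp hf
      have h2 := measurable_subtype_coe.comp hg
      exact measurable_norm.comp (h1.sub h2)
    exact (measurableSet_lt measurable_const h).inter (measurableSet_le h measurable_const)
  refine MeasurableSet.inter ?_ (MeasurableSet.inter (hnear (by fun_prop) (by fun_prop))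
    (MeasurableSet.inter (hnear (by fun_prop) (by fun_prop)) (MeasurableSet.inter ?_ ?_)))
  · have h : Measurable fun p : SlotSeed × (I × I) => p.1.1 := by fun_prop
    exact h (measurable_of_countable (fun d => move s c' d) (measurableSet_singleton c'))
  · exact measurableSet_lt (measurable_subtype_coe.comp
        (by fun_prop : Measurable fun p : SlotSeed × (I × I) => p.1.2.2.1)) measurable_const
  · exact (by fun_prop : Measurable fun p : SlotSeed × (I × I) => p.1.2.2.2)
      (measurableSet_Selects A m)

variable (φ : Phy) (s : ℕ) (c : Fin n → ℤ × ℤ) (A : Fin n → Finset (Fin k)) (m : Fin k)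

theorem measurableSet_meet (ε : ℝ) (i j : Fin n) : MeasurableSet (meet φ s c A m ε i j) := by
  refine MeasurableSet.inter ?_ ?_
  · exact (measurable_pi_apply (X := fun _ : Fin n => SlotSeed) j) (measurableSet_land φ s (c j) (c i))
  · exact (by fun_prop : Measurable fun ξ : Fin n → SlotSeed => (ξ i, (ξ j).2.1))
      (measurableSet_aim φ s (c i) ε (A i) m)

theorem measurable_kernel_place (α r : ℝ) (l j : Fin n) :
    Measurable fun ξ : Fin n → SlotSeed =>
      (r + ‖place s (c l) (ξ l) - place s (c j) (ξ j)‖) ^ (-α) := by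
  have h1 := (measurable_place s (c l)).comp (measurable_pi_apply (X := fun _ : Fin n => SlotSeed) l)
  have h2 := (measurable_place s (c j)).comp (measurable_pi_apply (X := fun _ : Fin n => SlotSeed) j)
  have h3 := measurable_norm.comp (h1.sub h2)
  exact (h3.const_add r).pow_const (-α)

theorem measurable_crowd (α r : ℝ) (i j : Fin n) : Measurable (crowd α s c r i j) :=
  Finset.measurable_sum _ fun l _ => measurable_kernel_place s c α r l j

theorem measurableSet_hit (ρ r : ℝ) (i j : Fin n) : MeasurableSet (hit φ s c A m ρ r i j) :=
  (measurableSet_meet φ s c A m _ i j).inter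
    (measurableSet_lt (measurable_crowd s c φ.α r i j) measurable_const)

variable {φ s c A m}

/-- The bound for `aim` is uniform in the offset of `j`, so resampling the seed of `i` factors the
two probabilities; `162 = 18 * 9`. -/
theorem slotsLaw_meet_ge {ε : ℝ} (h0 : 0 < ε) (h1 : ε ≤ 1 / 2) {i j : Fin n} (hij : i ≠ j)
    (hci : c i ∈ grid s) (hc1 : |(c i).1 - (c j).1| ≤ 1) (hc2 : |(c i).2 - (c j).2| ≤ 1)
    (hm : m ∈ A i) :
    ENNReal.ofReal (ε ^ 2 * φ.θ / (162 * k)) ≤ slotsLaw n (meet φ s c A m ε i j) := by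
  have hθ := φ.θ_pos
  have hmeas := measurableSet_meet φ s c A m ε i j
  have hland := measurableSet_land φ s (c j) (c i)
  rw [← lintegral_indicator_one hmeas]
  unfold slotsLaw
  rw [lintegral_pi_update (fun _ => slotLaw) i (measurable_one.indicator hmeas)]
  calc ENNReal.ofReal (ε ^ 2 * φ.θ / (162 * k))
      = ENNReal.ofReal (ε ^ 2 * φ.θ / (9 * k)) * ENNReal.ofReal (1 / 18) := by
        rw [← ENNReal.ofReal_mul (by positivity)]
        congr 1
        field_simp
        norm_num
    _ ≤ ENNReal.ofReal (ε ^ 2 * φ.θ / (9 * k)) * slotLaw (land φ s (c j) (c i)) := by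
        gcongr
        exact slotLaw_land_ge φ hci hc1 hc2
    _ = ∫⁻ ξ : Fin n → SlotSeed, (land φ s (c j) (c i)).indicator
          (fun _ => ENNReal.ofReal (ε ^ 2 * φ.θ / (9 * k))) (ξ j) ∂(Measure.pi fun _ => slotLaw) := by
        rw [(measurePreserving_eval (fun _ : Fin n => slotLaw) j).lintegral_comp
          (measurable_const.indicator hland), lintegral_indicator_const hland]
    _ ≤ _ := by
        refine lintegral_mono fun ξ => ?_
        by_cases hξ : ξ j ∈ land φ s (c j) (c i)
        · rw [Set.indicator_of_mem hξ]
          refine (slotLaw_aim_ge φ s (c i) h0 h1 hm (ξ j).2.1).trans ?_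
          have haim : MeasurableSet (aim φ s (c i) ε (A i) m (ξ j).2.1) :=
            (by fun_prop : Measurable fun ξ' : SlotSeed => (ξ', (ξ j).2.1))
              (measurableSet_aim φ s (c i) ε (A i) m)
          rw [← lintegral_indicator_one haim]
          refine lintegral_mono fun ξ' => ?_
          by_cases hξ' : ξ' ∈ aim φ s (c i) ε (A i) m (ξ j).2.1
          · rw [Set.indicator_of_mem hξ', Set.indicator_of_mem]
            · exact le_rfl
            · simp only [meet, Set.mem_ofPred_eq, Function.update_self,
                Function.update_of_ne hij.symm]
              exact ⟨hξ, hξ'⟩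
          · rw [Set.indicator_of_notMem hξ']
            exact zero_le
        · rw [Set.indicator_of_notMem hξ]
          exact zero_le

/-- `meet` involves only the seeds of `i` and `j`. Any other user can therefore be resampled on this
event, and the total expected weight is bounded uniformly in the position of `j`. -/
theorem setLIntegral_crowd_le (hs : 1 ≤ s) (hc : ∀ l, c l ∈ grid s) {M : ℝ}
    (hM : ∀ c' ∈ grid s, (occupancy c c' : ℝ) ≤ M) {α r : ℝ} (hr : 0 < r) (ε : ℝ) (i j : Fin n) :
    ∫⁻ ξ in meet φ s c A m ε i j, ENNReal.ofReal (crowd α s c r i j ξ) ∂(slotsLaw n) ≤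
      slotsLaw n (meet φ s c A m ε i j) *
        (ENNReal.ofReal M * (ENNReal.ofReal ((s : ℝ) ^ 2 * r ^ (2 - α)) * kernelMass α)) := by
  have hmeas := measurableSet_meet φ s c A m ε i j
  set E := meet φ s c A m ε i j with hE
  have hk : ∀ l, Measurable fun ξ : Fin n → SlotSeed =>
      ENNReal.ofReal ((r + ‖place s (c l) (ξ l) - place s (c j) (ξ j)‖) ^ (-α)) := fun l =>
    (measurable_kernel_place s c α r l j).ennreal_ofReal
  rw [← lintegral_indicator hmeas]
  have h1 : ∀ ξ, E.indicator (fun ξ => ENNReal.ofReal (crowd α s c r i j ξ)) ξ =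
      ∑ l ∈ (Finset.univ.erase j).erase i, E.indicator (fun ξ =>
        ENNReal.ofReal ((r + ‖place s (c l) (ξ l) - place s (c j) (ξ j)‖) ^ (-α))) ξ := by
    intro ξ
    by_cases hξ : ξ ∈ E
    · simp only [Set.indicator_of_mem hξ, crowd]
      exact ENNReal.ofReal_sum_of_nonneg fun l _ => by positivity
    · simp [Set.indicator_of_notMem hξ]
  simp_rw [h1]
  rw [lintegral_finsetSum _ fun l _ => (hk l).indicator hmeas]
  have h2 : ∀ l ∈ (Finset.univ.erase j).erase i, ∫⁻ ξ, E.indicator (fun ξ =>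
        ENNReal.ofReal ((r + ‖place s (c l) (ξ l) - place s (c j) (ξ j)‖) ^ (-α))) ξ
          ∂(slotsLaw n) =
      ∫⁻ ξ, E.indicator (fun ξ => ∫⁻ ξ', ENNReal.ofReal
        ((r + ‖place s (c l) ξ' - place s (c j) (ξ j)‖) ^ (-α)) ∂slotLaw) ξ ∂(slotsLaw n) := by
    intro l hl
    simp only [Finset.mem_erase, Finset.mem_univ, and_true] at hl
    unfold slotsLaw
    rw [lintegral_pi_update (fun _ => slotLaw) l ((hk l).indicator hmeas)]
    refine lintegral_congr fun ξ => ?_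
    have h3 : ∀ ξ', Function.update ξ l ξ' ∈ E ↔ ξ ∈ E := by
      intro ξ'
      simp only [hE, meet, Set.mem_ofPred_eq, Function.update_of_ne (Ne.symm hl.1),
        Function.update_of_ne (Ne.symm hl.2)]
    by_cases hξ : ξ ∈ E
    · simp only [Set.indicator_of_mem hξ, Set.indicator_of_mem ((h3 _).2 hξ), Function.update_self,
        Function.update_of_ne (Ne.symm hl.2)]
    · simp only [Set.indicator_of_notMem hξ, Set.indicator_of_notMem (mt (h3 _).1 hξ),
        lintegral_zero]
  rw [Finset.sum_congr rfl h2, ← lintegral_finsetSum']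
  swap
  · intro l _
    refine (Measurable.indicator ?_ hmeas).aemeasurable
    have h4 : Measurable fun p : (Fin n → SlotSeed) × SlotSeed => ENNReal.ofReal
        ((r + ‖place s (c l) p.2 - place s (c j) (p.1 j)‖) ^ (-α)) := by
      have h5 := (measurable_place s (c l)).comp
        (measurable_snd : Measurable fun p : (Fin n → SlotSeed) × SlotSeed => p.2)
      have h6 := (measurable_place s (c j)).comp
        (by fun_prop : Measurable fun p : (Fin n → SlotSeed) × SlotSeed => p.1 j)
      exact (((measurable_norm.comp (h5.sub h6)).const_add r).pow_const (-α)).ennreal_ofReal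
    exact h4.lintegral_prod_right'
  calc _ ≤ ∫⁻ ξ, E.indicator (fun _ => ENNReal.ofReal M *
        (ENNReal.ofReal ((s : ℝ) ^ 2 * r ^ (2 - α)) * kernelMass α)) ξ ∂(slotsLaw n) := by
        refine lintegral_mono fun ξ => ?_
        by_cases hξ : ξ ∈ E
        · simp only [Set.indicator_of_mem hξ]
          exact (Finset.sum_le_univ_sum_of_nonneg fun _ => zero_le).trans
            (sum_lintegral_kernel_place_le hs hc hM hr (place s (c j) (ξ j)))
        · simp [Set.indicator_of_notMem hξ]
    _ = _ := by
        rw [lintegral_indicator_const hmeas, mul_comm]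

/-- Markov's inequality conditionally on the meeting: `hMr` makes the mean crowd at most half of the
threshold. -/
theorem slotsLaw_hit_ge_half (hs : 1 ≤ s) (hc : ∀ l, c l ∈ grid s) {M : ℝ} (hM0 : 0 ≤ M)
    (hM : ∀ c' ∈ grid s, (occupancy c c' : ℝ) ≤ M) {ρ r : ℝ} (hr : 0 < r)
    (hMr : M * ((s : ℝ) ^ 2 * r ^ (2 - φ.α) * (kernelMass φ.α).toReal) ≤ (2 * r) ^ (-φ.α) / 2)
    (i j : Fin n) :
    slotsLaw n (meet φ s c A m (ρ * r * s) i j) ≤ 2 * slotsLaw n (hit φ s c A m ρ r i j) := by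
  have hT : 0 < (2 * r) ^ (-φ.α) := by positivity
  set E := meet φ s c A m (ρ * r * s) i j with hE
  set T := (2 * r) ^ (-φ.α) with hTdef
  have hmeas : MeasurableSet E := measurableSet_meet φ s c A m _ i j
  have hcm := measurable_crowd s c φ.α r i j
  have h1 : slotsLaw n (E ∩ {ξ | ¬ crowd φ.α s c r i j ξ < T}) ≤ slotsLaw n E / 2 := by
    have h2 := meas_ge_le_lintegral_div (μ := (slotsLaw n).restrict E)
      (f := fun ξ => ENNReal.ofReal (crowd φ.α s c r i j ξ)) hcm.ennreal_ofReal.aemeasurable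
      (ε := ENNReal.ofReal T) (by simpa using hT) (by simp)
    have h3 : {ξ | ENNReal.ofReal T ≤ ENNReal.ofReal (crowd φ.α s c r i j ξ)} =
        {ξ | ¬ crowd φ.α s c r i j ξ < T} := by
      ext ξ
      simp only [Set.mem_ofPred_eq, not_lt]
      refine ENNReal.ofReal_le_ofReal_iff ?_
      exact Finset.sum_nonneg fun l _ => by positivity
    have h5 : MeasurableSet {ξ | ¬ crowd φ.α s c r i j ξ < T} :=
      (measurableSet_lt hcm measurable_const).compl
    rw [h3, Measure.restrict_apply h5,
      Set.inter_comm] at h2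
    refine h2.trans ?_
    refine (ENNReal.div_le_div_right (setLIntegral_crowd_le hs hc hM hr _ i j) _).trans ?_
    have h4 : ENNReal.ofReal M * (ENNReal.ofReal ((s : ℝ) ^ 2 * r ^ (2 - φ.α)) * kernelMass φ.α) ≤
        ENNReal.ofReal T / 2 := by
      rw [← ENNReal.ofReal_toReal (kernelMass_lt_top φ.two_lt_α).ne,
        ← ENNReal.ofReal_mul (by positivity), ← ENNReal.ofReal_mul hM0]
      refine (ENNReal.ofReal_le_ofReal hMr).trans ?_
      rw [ENNReal.ofReal_div_of_pos two_pos]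
      simp
    calc _ ≤ slotsLaw n E * (ENNReal.ofReal T / 2) / ENNReal.ofReal T := by
          gcongr
      _ = slotsLaw n E / 2 := by
          have hT' : ENNReal.ofReal T ≠ 0 := by simpa using hT
          rw [← mul_div_assoc, ENNReal.div_right_comm,
            ENNReal.mul_div_cancel_right hT' ENNReal.ofReal_ne_top]
  have h2 : slotsLaw n E ≤ slotsLaw n (hit φ s c A m ρ r i j) + slotsLaw n E / 2 := by
    calc slotsLaw n E ≤ slotsLaw n (hit φ s c A m ρ r i j ∪
          (E ∩ {ξ | ¬ crowd φ.α s c r i j ξ < T})) := by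
          refine measure_mono fun ξ hξ => ?_
          by_cases h : crowd φ.α s c r i j ξ < T
          · exact Or.inl ⟨hξ, h⟩
          · exact Or.inr ⟨hξ, h⟩
      _ ≤ _ := (measure_union_le _ _).trans (add_le_add_right h1 _)
  have h3 : slotsLaw n E - slotsLaw n E / 2 ≤ slotsLaw n (hit φ s c A m ρ r i j) :=
    tsub_le_iff_right.2 h2
  rw [ENNReal.sub_half (measure_ne_top _ _)] at h3
  rw [mul_comm]
  exact (ENNReal.div_le_iff_le_mul (by simp) (by simp)).1 h3

end Hit

/-! ### An isoperimetric inequality on the grid -/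

/-- Equal or neighbouring subsquares. -/
abbrev Near (p q : ℤ × ℤ) : Prop := |p.1 - q.1| ≤ 1 ∧ |p.2 - q.2| ≤ 1

/-- Telescoping along a path by `f x (1 - f z) ≤ f x (1 - f y) + f y (1 - f z)`: reading `f` as
probabilities of independent bits, if `x` is on and `z` is off, the change happens before or after
`y`. The two halves are the two orientations. -/
theorem mul_one_sub_le_sum_aux {f g : ℤ → ℝ} (hf0 : ∀ x, 0 ≤ f x) (hf1 : ∀ x, f x ≤ 1)
    {a b : ℤ} (hg : ∀ x ∈ Finset.Ico a b, ∀ y ∈ Finset.Ico a b, |x - y| ≤ 1 →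
      f x * (1 - f y) ≤ g x) (d : ℕ) :
    (∀ x, a ≤ x → x + d < b → f x * (1 - f (x + d)) ≤ ∑ u ∈ Finset.Icc x (x + d), g u) ∧
    (∀ x, a ≤ x - d → x < b → f x * (1 - f (x - d)) ≤ ∑ u ∈ Finset.Icc (x - d) x, g u) := by
  have tri : ∀ x y z, f x * (1 - f z) ≤ f x * (1 - f y) + f y * (1 - f z) := by
    intro x y z
    nlinarith [mul_nonneg (hf0 y) (sub_nonneg.2 (hf1 x)), hf0 x, hf0 y, hf1 x, hf1 y, hf1 z,
      mul_nonneg (mul_nonneg (hf0 y) (sub_nonneg.2 (hf1 x))) (sub_nonneg.2 (hf1 z)),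
      mul_nonneg (mul_nonneg (hf0 x) (sub_nonneg.2 (hf1 y))) (hf0 z)]
  induction d with
  | zero =>
    constructor <;> intro x h1 h2 <;> simp only [Nat.cast_zero, add_zero, sub_zero, Finset.Icc_self,
      Finset.sum_singleton] at * <;>
    exact hg x (Finset.mem_Ico.2 ⟨h1, h2⟩) x (Finset.mem_Ico.2 ⟨h1, h2⟩) (by simp)
  | succ d ih =>
    constructor
    · intro x h1 h2
      push_cast at h2 ⊢
      have h3 := ih.1 (x + 1) (by omega) (by omega)
      have h4 := hg x (Finset.mem_Ico.2 ⟨h1, by omega⟩) (x + 1)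
        (Finset.mem_Ico.2 ⟨by omega, by omega⟩) (by simp)
      have h5 : Finset.Icc x (x + (d + 1)) = insert x (Finset.Icc (x + 1) (x + 1 + d)) := by
        ext u
        simp only [Finset.mem_Icc, Finset.mem_insert]
        omega
      rw [h5, Finset.sum_insert (by simp)]
      have h6 := tri x (x + 1) (x + 1 + d)
      rw [show x + ((d : ℤ) + 1) = x + 1 + d by ring]
      linarith
    · intro x h1 h2
      push_cast at h1 ⊢
      have h3 := ih.2 (x - 1) (by omega) (by omega)
      have h4 := hg x (Finset.mem_Ico.2 ⟨by omega, h2⟩) (x - 1)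
        (Finset.mem_Ico.2 ⟨by omega, by omega⟩) (by simp)
      have h5 : Finset.Icc (x - (d + 1)) x = insert x (Finset.Icc (x - 1 - d) (x - 1)) := by
        ext u
        simp only [Finset.mem_Icc, Finset.mem_insert]
        omega
      rw [h5, Finset.sum_insert (by simp)]
      have h6 := tri x (x - 1) (x - 1 - d)
      rw [show x - ((d : ℤ) + 1) = x - 1 - d by ring]
      linarith

theorem mul_one_sub_le_sum {f : ℤ → ℝ} (hf0 : ∀ x, 0 ≤ f x) (hf1 : ∀ x, f x ≤ 1) {s : ℕ}
    {x y : ℤ} (hx : x ∈ Finset.Ico 0 (s : ℤ)) (hy : y ∈ Finset.Ico 0 (s : ℤ)) :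
    f x * (1 - f y) ≤ ∑ u ∈ Finset.Ico 0 (s : ℤ), ∑ v ∈ Finset.Ico 0 (s : ℤ),
      if |u - v| ≤ 1 then f u * (1 - f v) else 0 := by
  have hnn : ∀ u v, 0 ≤ if |u - v| ≤ 1 then f u * (1 - f v) else 0 := by
    intro u v
    split_ifs
    · exact mul_nonneg (hf0 u) (sub_nonneg.2 (hf1 v))
    · exact le_rfl
  set g : ℤ → ℝ := fun u => ∑ v ∈ Finset.Ico 0 (s : ℤ),
      if |u - v| ≤ 1 then f u * (1 - f v) else 0 with hgdef
  have hg0 : ∀ u, 0 ≤ g u := fun u => Finset.sum_nonneg fun v _ => hnn u v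
  have hg : ∀ x ∈ Finset.Ico 0 (s : ℤ), ∀ y ∈ Finset.Ico 0 (s : ℤ), |x - y| ≤ 1 →
      f x * (1 - f y) ≤ g x := by
    intro x _ y hy hxy
    have := Finset.single_le_sum (f := fun v => if |x - v| ≤ 1 then f x * (1 - f v) else 0)
      (fun v _ => hnn x v) hy
    rw [if_pos hxy] at this
    exact this
  have aux := mul_one_sub_le_sum_aux hf0 hf1 hg
  rw [Finset.mem_Ico] at hx hy
  rcases le_total x y with h | h
  · have h1 := (aux (y - x).toNat).1 x hx.1 (by omega)
    rw [show x + ((y - x).toNat : ℤ) = y by omega] at h1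
    refine h1.trans (Finset.sum_le_sum_of_subset_of_nonneg ?_ fun u _ _ => hg0 u)
    intro u
    simp only [Finset.mem_Icc, Finset.mem_Ico]
    omega
  · have h1 := (aux (x - y).toNat).2 x (by omega) hx.2
    rw [show x - ((x - y).toNat : ℤ) = y by omega] at h1
    refine h1.trans (Finset.sum_le_sum_of_subset_of_nonneg ?_ fun u _ _ => hg0 u)
    intro u
    simp only [Finset.mem_Icc, Finset.mem_Ico]
    omega

/-- Summing over the L-shaped paths that join two subsquares. -/
theorem sum_mul_one_sub_le {F : ℤ × ℤ → ℝ} (hF0 : ∀ p, 0 ≤ F p) (hF1 : ∀ p, F p ≤ 1) (s : ℕ) :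
    ∑ p ∈ grid s, ∑ q ∈ grid s, F p * (1 - F q) ≤
      2 * (s : ℝ) ^ 3 * ∑ p ∈ grid s, ∑ q ∈ grid s,
        if Near p q then F p * (1 - F q) else 0 := by
  set J := Finset.Ico 0 (s : ℤ) with hJ
  have hJc : (J.card : ℝ) = s := by simp [hJ]
  set H : ℤ → ℝ := fun y => ∑ u ∈ J, ∑ v ∈ J,
    if |u - v| ≤ 1 then F (u, y) * (1 - F (v, y)) else 0 with hH
  set V : ℤ → ℝ := fun x => ∑ u ∈ J, ∑ v ∈ J,
    if |u - v| ≤ 1 then F (x, u) * (1 - F (x, v)) else 0 with hV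
  set Y := ∑ p ∈ grid s, ∑ q ∈ grid s, if Near p q then F p * (1 - F q) else 0 with hY
  have hnn : ∀ p q, 0 ≤ if Near p q then F p * (1 - F q) else 0 := by
    intro p q
    split_ifs
    · exact mul_nonneg (hF0 p) (sub_nonneg.2 (hF1 q))
    · exact le_rfl
  have hYe : Y = ∑ x ∈ J, ∑ y ∈ J, ∑ x' ∈ J, ∑ y' ∈ J,
      if Near (x, y) (x', y') then F (x, y) * (1 - F (x', y')) else 0 := by
    rw [hY, grid, Finset.sum_product]
    refine Finset.sum_congr rfl fun x _ => Finset.sum_congr rfl fun y _ => ?_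
    rw [Finset.sum_product]
  have hHY : ∑ y ∈ J, H y ≤ Y := by
    rw [hYe, hH, Finset.sum_comm]
    refine Finset.sum_le_sum fun x _ => Finset.sum_le_sum fun y hy =>
      Finset.sum_le_sum fun x' _ => ?_
    refine le_trans (le_of_eq ?_) (Finset.single_le_sum (f := fun y' =>
      if Near (x, y) (x', y') then F (x, y) * (1 - F (x', y')) else 0) (fun y' _ => hnn _ _) hy)
    simp [Near]
  have hVY : ∑ x ∈ J, V x ≤ Y := by
    rw [hYe, hV]
    refine Finset.sum_le_sum fun x hx => Finset.sum_le_sum fun y _ => ?_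
    refine le_trans (le_of_eq ?_) (Finset.single_le_sum (f := fun x' => ∑ y' ∈ J,
      if Near (x, y) (x', y') then F (x, y) * (1 - F (x', y')) else 0)
      (fun x' _ => Finset.sum_nonneg fun y' _ => hnn _ _) hx)
    simp [Near]
  -- Go along the row of `y` from `x` to `x'`, then along the column of `x'` from `y` to `y'`.
  have key : ∀ x ∈ J, ∀ y ∈ J, ∀ x' ∈ J, ∀ y' ∈ J,
      F (x, y) * (1 - F (x', y')) ≤ H y + V x' := by
    intro x hx y hy x' hx' y' hy'
    have h1 : F (x, y) * (1 - F (x', y)) ≤ H y :=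
      mul_one_sub_le_sum (f := fun u => F (u, y)) (fun _ => hF0 _) (fun _ => hF1 _) hx hx'
    have h2 : F (x', y) * (1 - F (x', y')) ≤ V x' :=
      mul_one_sub_le_sum (f := fun u => F (x', u)) (fun _ => hF0 _) (fun _ => hF1 _) hy hy'
    have a0 := hF0 (x, y)
    have b0 := hF0 (x', y)
    have c0 := hF0 (x', y')
    have a1 := sub_nonneg.2 (hF1 (x, y))
    have b1 := sub_nonneg.2 (hF1 (x', y))
    have c1 := sub_nonneg.2 (hF1 (x', y'))
    nlinarith [mul_nonneg (mul_nonneg b0 a1) c1, mul_nonneg (mul_nonneg a0 b1) c0]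
  calc ∑ p ∈ grid s, ∑ q ∈ grid s, F p * (1 - F q)
      = ∑ x ∈ J, ∑ y ∈ J, ∑ x' ∈ J, ∑ y' ∈ J, F (x, y) * (1 - F (x', y')) := by
        rw [grid, Finset.sum_product]
        refine Finset.sum_congr rfl fun x _ => Finset.sum_congr rfl fun y _ => ?_
        rw [Finset.sum_product]
    _ ≤ ∑ x ∈ J, ∑ y ∈ J, ∑ x' ∈ J, ∑ y' ∈ J, (H y + V x') :=
        Finset.sum_le_sum fun x hx => Finset.sum_le_sum fun y hy => Finset.sum_le_sum fun x' hx' =>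
          Finset.sum_le_sum fun y' hy' => key x hx y hy x' hx' y' hy'
    -- Each row `y` and each column `x'` serves `s ^ 3` of the `s ^ 4` pairs.
    _ = (s : ℝ) ^ 3 * ∑ y ∈ J, H y + (s : ℝ) ^ 3 * ∑ x ∈ J, V x := by
        simp only [Finset.sum_add_distrib, Finset.sum_const, nsmul_eq_mul, hJc, ← Finset.mul_sum]
        ring
    _ ≤ _ := by
        have : (0 : ℝ) ≤ (s : ℝ) ^ 3 := by positivity
        nlinarith [mul_le_mul_of_nonneg_left hHY this, mul_le_mul_of_nonneg_left hVY this]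

theorem sum_comp_cell {n s : ℕ} {c : Fin n → ℤ × ℤ} (hc : ∀ l, c l ∈ grid s) (S : Finset (Fin n))
    (f : ℤ × ℤ → ℝ) :
    ∑ i ∈ S, f (c i) = ∑ p ∈ grid s, ((S.filter fun i => c i = p).card : ℝ) * f p := by
  rw [← Finset.sum_fiberwise_of_maps_to (t := grid s) (g := c) fun l _ => hc l]
  refine Finset.sum_congr rfl fun p _ => ?_
  rw [Finset.sum_congr rfl (g := fun _ => f p)
    (fun l hl => by rw [(Finset.mem_filter.1 hl).2]), Finset.sum_const, nsmul_eq_mul]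

/-- The pairs of a user of `S` and a user outside `S` that can meet after one move. -/
def contacts {n : ℕ} (c : Fin n → ℤ × ℤ) (S : Finset (Fin n)) : Finset (Fin n × Fin n) :=
  (S ×ˢ Sᶜ).filter fun p => Near (c p.1) (c p.2)

theorem card_contacts {n : ℕ} (c : Fin n → ℤ × ℤ) (S : Finset (Fin n)) :
    ((contacts c S).card : ℝ) = ∑ i ∈ S, ∑ j ∈ Sᶜ, if Near (c i) (c j) then (1 : ℝ) else 0 := by
  rw [contacts, Finset.card_filter, Finset.sum_product]
  push_cast
  rfl

/-- Let `F p` be the fraction of the users of `p` that belong to `S`. Both counts are sums of `F p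
(1 - F q)` weighted by products of two occupancies; replacing the weights by constants costs `(m₁ /
m₀) ^ 2`, and the path inequality for `F` compares the sums. -/
theorem card_mul_card_compl_le {n s : ℕ} {c : Fin n → ℤ × ℤ} (hc : ∀ l, c l ∈ grid s)
    (S : Finset (Fin n)) {m₀ m₁ : ℝ} (hm₀ : 0 < m₀)
    (hocc : ∀ p ∈ grid s, m₀ ≤ occupancy c p ∧ (occupancy c p : ℝ) ≤ m₁) :
    (S.card : ℝ) * (Sᶜ.card : ℝ) ≤ (m₁ / m₀) ^ 2 * (2 * (s : ℝ) ^ 3) * (contacts c S).card := by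
  set a : ℤ × ℤ → ℝ := fun p => ((S.filter fun i => c i = p).card : ℝ) with ha
  set b : ℤ × ℤ → ℝ := fun p => ((Sᶜ.filter fun i => c i = p).card : ℝ) with hb
  have ha0 : ∀ p, 0 ≤ a p := fun p => by positivity
  have hb0 : ∀ p, 0 ≤ b p := fun p => by positivity
  have hab : ∀ p, a p + b p = occupancy c p := by
    intro p
    simp only [ha, hb, occupancy]
    rw [← Nat.cast_add, ← Finset.card_union_of_disjoint
      (Finset.disjoint_filter_filter disjoint_compl_right), ← Finset.filter_union,
      Finset.union_compl]
  set F : ℤ × ℤ → ℝ := fun p => a p / (a p + b p) with hF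
  have hF0 : ∀ p, 0 ≤ F p := fun p => div_nonneg (ha0 p) (add_nonneg (ha0 p) (hb0 p))
  have hF1 : ∀ p, F p ≤ 1 := fun p =>
    div_le_one_of_le₀ (by linarith [hb0 p]) (add_nonneg (ha0 p) (hb0 p))
  have hm : ∀ p ∈ grid s, m₀ ≤ a p + b p ∧ a p + b p ≤ m₁ := fun p hp => by
    rw [hab]; exact hocc p hp
  have hFab : ∀ p ∈ grid s, ∀ q ∈ grid s,
      a p * b q = (a p + b p) * (a q + b q) * (F p * (1 - F q)) := by
    intro p hp q hq
    have h1 : a p + b p ≠ 0 := by linarith [(hm p hp).1]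
    have h2 : a q + b q ≠ 0 := by linarith [(hm q hq).1]
    simp only [hF]
    field_simp
    ring
  have hFF : ∀ p q, 0 ≤ F p * (1 - F q) := fun p q =>
    mul_nonneg (hF0 p) (sub_nonneg.2 (hF1 q))
  have h1 : (S.card : ℝ) * Sᶜ.card = ∑ p ∈ grid s, ∑ q ∈ grid s, a p * b q := by
    have e1 := sum_comp_cell hc S fun _ => 1
    have e2 := sum_comp_cell hc Sᶜ fun _ => 1
    simp only [Finset.sum_const, nsmul_eq_mul, mul_one] at e1 e2
    rw [e1, e2, Finset.sum_mul_sum]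
  have h2 : ((contacts c S).card : ℝ) =
      ∑ p ∈ grid s, ∑ q ∈ grid s, if Near p q then a p * b q else 0 := by
    rw [card_contacts]
    rw [sum_comp_cell hc S fun p => ∑ j ∈ Sᶜ, if Near p (c j) then (1 : ℝ) else 0]
    refine Finset.sum_congr rfl fun p _ => ?_
    rw [sum_comp_cell hc Sᶜ fun q => if Near p q then (1 : ℝ) else 0, Finset.mul_sum]
    refine Finset.sum_congr rfl fun q _ => ?_
    split_ifs <;> simp [ha, hb]
  have h3 : ∑ p ∈ grid s, ∑ q ∈ grid s, a p * b q ≤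
      m₁ ^ 2 * ∑ p ∈ grid s, ∑ q ∈ grid s, F p * (1 - F q) := by
    simp only [Finset.mul_sum]
    refine Finset.sum_le_sum fun p hp => Finset.sum_le_sum fun q hq => ?_
    rw [hFab p hp q hq, sq]
    have hp' := hm p hp
    have hq' := hm q hq
    refine mul_le_mul_of_nonneg_right ?_ (hFF p q)
    exact mul_le_mul hp'.2 hq'.2 (by linarith) (by linarith)
  have h4 : m₀ ^ 2 * ∑ p ∈ grid s, ∑ q ∈ grid s, (if Near p q then F p * (1 - F q) else 0) ≤
      (contacts c S).card := by
    rw [h2]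
    simp only [Finset.mul_sum]
    refine Finset.sum_le_sum fun p hp => Finset.sum_le_sum fun q hq => ?_
    split_ifs
    · rw [hFab p hp q hq, sq]
      refine mul_le_mul_of_nonneg_right ?_ (hFF p q)
      exact mul_le_mul (hm p hp).1 (hm q hq).1 hm₀.le (by linarith [(hm p hp).1])
    · simp
  have h5 := sum_mul_one_sub_le hF0 hF1 s
  set Y := ∑ p ∈ grid s, ∑ q ∈ grid s, (if Near p q then F p * (1 - F q) else 0)
  have h6 : Y ≤ (contacts c S).card / m₀ ^ 2 := by
    rw [le_div_iff₀ (by positivity)]; linarith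
  calc (S.card : ℝ) * Sᶜ.card ≤ m₁ ^ 2 * (2 * (s : ℝ) ^ 3 * Y) := by
        rw [h1]
        exact h3.trans (mul_le_mul_of_nonneg_left h5 (by positivity))
    _ ≤ m₁ ^ 2 * (2 * (s : ℝ) ^ 3 * ((contacts c S).card / m₀ ^ 2)) := by gcongr
    _ = _ := by
        field_simp

theorem card_contacts_of_eq {n : ℕ} {c : Fin n → ℤ × ℤ} (hc : ∀ i j, c i = c j)
    (S : Finset (Fin n)) : (contacts c S).card = S.card * Sᶜ.card := by
  rw [contacts, Finset.filter_true_of_mem, Finset.card_product]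
  intro p _
  have h := hc p.1 p.2
  simp [Near, h]

/-! ### Expected progress in one slot -/

section OneSlot

variable {n k : ℕ}

/-- Positions after a slot that starts with the users in the subsquares `c`. -/
noncomputable def slotPos (s : ℕ) (c : Fin n → ℤ × ℤ) (ξ : Fin n → SlotSeed) (i : Fin n) : Plane :=
  toPlane (place s (c i) (ξ i))

/-- Users designated as senders by the seeds `ξ`. -/
noncomputable def slotSenders (φ : Phy) (ξ : Fin n → SlotSeed) : Finset (Fin n) :=
  Finset.univ.filter fun i => ((ξ i).2.2.1 : ℝ) < φ.θ

theorem mem_slotSenders {φ : Phy} {ξ : Fin n → SlotSeed} {i : Fin n} :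
    i ∈ slotSenders φ ξ ↔ ((ξ i).2.2.1 : ℝ) < φ.θ := by
  simp [slotSenders]

open Classical in
/-- Messages held after a slot by user `j`, when `A` are the messages held before and `B` those
injected during the slot. -/
noncomputable def slotHolds (φ : Phy) (s : ℕ) (c : Fin n → ℤ × ℤ) (A B : Fin n → Finset (Fin k))
    (ξ : Fin n → SlotSeed) (j : Fin n) : Finset (Fin k) :=
  Finset.univ.filter fun m => m ∈ A j ∨ m ∈ B j ∨
    ∃ i, Delivers φ (slotPos s c ξ) (slotSenders φ ξ) i j ∧ Selects (ξ i).2.2.2 (A i) m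

theorem mem_slotHolds {φ : Phy} {s : ℕ} {c : Fin n → ℤ × ℤ} {A B : Fin n → Finset (Fin k)}
    {ξ : Fin n → SlotSeed} {j : Fin n} {m : Fin k} :
    m ∈ slotHolds φ s c A B ξ j ↔ m ∈ A j ∨ m ∈ B j ∨
    ∃ i, Delivers φ (slotPos s c ξ) (slotSenders φ ξ) i j ∧ Selects (ξ i).2.2.2 (A i) m := by
  simp [slotHolds]

/-- The users that possess message `m`. -/
def informed (A : Fin n → Finset (Fin k)) (m : Fin k) : Finset (Fin n) :=
  Finset.univ.filter fun i => m ∈ A i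

theorem mem_informed {A : Fin n → Finset (Fin k)} {m : Fin k} {i : Fin n} :
    i ∈ informed A m ↔ m ∈ A i := by
  simp [informed]

/-- Ratio of uninformed to informed users. -/
noncomputable def oddsAgainst (n a : ℕ) : ℝ := ((n : ℝ) - a) / a

theorem oddsAgainst_anti {a b : ℕ} (ha : 1 ≤ a) (hab : a ≤ b) :
    oddsAgainst n b ≤ oddsAgainst n a := by
  have h1 : (0 : ℝ) < a := by positivity
  have h2 : (a : ℝ) ≤ b := by exact_mod_cast hab
  have h0 : (0 : ℝ) ≤ n := by positivity
  unfold oddsAgainst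
  rw [div_le_div_iff₀ (by linarith) h1]
  nlinarith

/-- `n / a - n / (a + d) = n d / (a (a + d))`, and `d ≤ a` bounds the denominator by `2 a ^ 2`. -/
theorem oddsAgainst_add_le {a d b : ℕ} (ha : 1 ≤ a) (hda : d ≤ a) (hb : a + d ≤ b) :
    oddsAgainst n b ≤ oddsAgainst n a - n / (2 * (a : ℝ) ^ 2) * d := by
  refine (oddsAgainst_anti (by omega) hb).trans ?_
  have h1 : (0 : ℝ) < a := by positivity
  have h2 : (d : ℝ) ≤ a := by exact_mod_cast hda
  have h0 : (0 : ℝ) ≤ n := by positivity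
  have hd : (0 : ℝ) ≤ d := by positivity
  unfold oddsAgainst
  push_cast
  rw [show ((n : ℝ) - a) / a - n / (2 * (a : ℝ) ^ 2) * d =
    (2 * a * (n - a) - n * d) / (2 * (a : ℝ) ^ 2) by field_simp,
    div_le_div_iff₀ (by linarith) (by positivity)]
  have key : (2 * a * (n - a) - n * d) * ((a : ℝ) + d) - (n - (a + d)) * (2 * (a : ℝ) ^ 2) =
    n * d * (a - d) := by ring
  nlinarith [mul_nonneg (mul_nonneg h0 hd) (sub_nonneg.2 h2)]

variable {φ : Phy} {s : ℕ} {c : Fin n → ℤ × ℤ} {A : Fin n → Finset (Fin k)} {m : Fin k}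
  {ρ r : ℝ} {i j : Fin n} {ξ : Fin n → SlotSeed}

theorem norm_place_sub_of_mem_meet {ε : ℝ} (hs : 1 ≤ s) (h : ξ ∈ meet φ s c A m ε i j) :
    0 < ‖place s (c i) (ξ i) - place s (c j) (ξ j)‖ ∧
      ‖place s (c i) (ξ i) - place s (c j) (ξ j)‖ ≤ ε / s := by
  have hs' : (0 : ℝ) < s := by positivity
  obtain ⟨⟨hj1, hj2⟩, hi1, hi2, hi3, hi4, hi5⟩ := h
  have e : place s (c i) (ξ i) - place s (c j) (ξ j) =
      ((((ξ i).2.1.1 : ℝ) - (ξ j).2.1.1) / s, (((ξ i).2.1.2 : ℝ) - (ξ j).2.1.2) / s) := by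
    simp only [place, hi1, hj1, Prod.mk_sub_mk]
    congr 1 <;> ring
  rw [e, Prod.norm_def]
  dsimp only
  rw [Real.norm_eq_abs, Real.norm_eq_abs, abs_div, abs_div, abs_of_pos hs']
  refine ⟨lt_max_of_lt_left (div_pos hi2.1 hs'), max_le ?_ ?_⟩
  · exact div_le_div_of_nonneg_right hi2.2 hs'.le
  · exact div_le_div_of_nonneg_right hi3.2 hs'.le

theorem delivers_of_mem_hit (hs : 1 ≤ s) (hr : 0 < r) (hr1 : r ≤ 1) (hρ : 0 < ρ)
    (hρ4 : ρ ≤ 1 / 4) (hρφ : φ.β * (φ.η + φ.P) ≤ φ.P * (2 * ρ) ^ (-φ.α))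
    (h : ξ ∈ hit φ s c A m ρ r i j) :
    Delivers φ (slotPos s c ξ) (slotSenders φ ξ) i j ∧ Selects (ξ i).2.2.2 (A i) m := by
  have hs' : (0 : ℝ) < s := by positivity
  obtain ⟨h1, h2⟩ := h
  have h3 := norm_place_sub_of_mem_meet hs h1
  rw [mul_div_assoc, div_self hs'.ne', mul_one] at h3
  obtain ⟨⟨hj1, hj2⟩, hi1, hi2, hi3, hi4, hi5⟩ := h1
  refine ⟨?_, hi5⟩
  exact delivers_of_sum_kernel_lt φ (x := fun l => place s (c l) (ξ l)) (mem_slotSenders.2 hi4)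
    (fun h => absurd (mem_slotSenders.1 h) (not_lt.2 hj2)) hr hr1 hρ hρ4 hρφ h3.1 h3.2 h2

theorem isolated_of_mem_hit (hs : 1 ≤ s) (hr : 0 < r) (hρ4 : ρ ≤ 1 / 4)
    (h : ξ ∈ hit φ s c A m ρ r i j) :
    ‖place s (c i) (ξ i) - place s (c j) (ξ j)‖ ≤ r / 4 ∧
      ∀ l, l ≠ i → l ≠ j → r < ‖place s (c l) (ξ l) - place s (c j) (ξ j)‖ := by
  have hs' : (0 : ℝ) < s := by positivity
  obtain ⟨h1, h2⟩ := h
  have h3 := norm_place_sub_of_mem_meet hs h1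
  rw [mul_div_assoc, div_self hs'.ne', mul_one] at h3
  refine ⟨by nlinarith [h3.2], fun l hli hlj => ?_⟩
  exact lt_norm_of_sum_kernel_lt (x := fun l => place s (c l) (ξ l)) hr
    (by linarith [φ.two_lt_α]) h2 (by simp [hli, hlj])

open Classical in
/-- The pairs of an informed and an uninformed user that hit one another. -/
noncomputable def hits (φ : Phy) (s : ℕ) (c : Fin n → ℤ × ℤ) (A : Fin n → Finset (Fin k))
    (m : Fin k) (ρ r : ℝ) (ξ : Fin n → SlotSeed) : Finset (Fin n × Fin n) :=
  (contacts c (informed A m)).filter fun p => ξ ∈ hit φ s c A m ρ r p.1 p.2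

/-- Hits form a matching: partners are within `r / 4` and any third user is farther than `r` from
the receiver. So each hit informs a new user, and there are at most as many hits as informed users,
as `oddsAgainst_add_le` requires. Other deliveries and injections only help. -/
theorem oddsAgainst_slotHolds_le (hs : 1 ≤ s) (hr : 0 < r) (hr1 : r ≤ 1) (hρ : 0 < ρ)
    (hρ4 : ρ ≤ 1 / 4) (hρφ : φ.β * (φ.η + φ.P) ≤ φ.P * (2 * ρ) ^ (-φ.α))
    (hne : (informed A m).Nonempty) (B : Fin n → Finset (Fin k)) :
    oddsAgainst n (informed (slotHolds φ s c A B ξ) m).card ≤ oddsAgainst n (informed A m).card -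
      n / (2 * ((informed A m).card : ℝ) ^ 2) * (hits φ s c A m ρ r ξ).card := by
  classical
  set S := informed A m with hS
  have hmem : ∀ p ∈ hits φ s c A m ρ r ξ, p.1 ∈ S ∧ p.2 ∉ S ∧ ξ ∈ hit φ s c A m ρ r p.1 p.2 := by
    intro p hp
    simp only [hits, contacts, Finset.mem_filter, Finset.mem_product, Finset.mem_compl] at hp
    exact ⟨hp.1.1.1, hp.1.1.2, hp.2⟩
  have hinj1 : Set.InjOn Prod.fst (hits φ s c A m ρ r ξ : Set (Fin n × Fin n)) := by
    rintro ⟨i, j⟩ hp ⟨i', j'⟩ hp' (rfl : i = i')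
    have h1 := isolated_of_mem_hit hs hr hρ4 (hmem _ hp).2.2
    have h2 := isolated_of_mem_hit hs hr hρ4 (hmem _ hp').2.2
    have h3 := (hmem _ hp').2.1
    have h4 := (hmem _ hp).1
    dsimp only at *
    by_contra hne
    have hjj : j' ≠ j := fun h => hne (by rw [h])
    have h5 := h1.2 j' (fun h => h3 (h ▸ h4)) hjj
    have h6 := norm_sub_le_norm_sub_add_norm_sub (place s (c j') (ξ j')) (place s (c i) (ξ i))
      (place s (c j) (ξ j))
    rw [norm_sub_rev (place s (c j') (ξ j')) (place s (c i) (ξ i))] at h6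
    linarith [h1.1, h2.1]
  have hinj2 : Set.InjOn Prod.snd (hits φ s c A m ρ r ξ : Set (Fin n × Fin n)) := by
    rintro ⟨i, j⟩ hp ⟨i', j'⟩ hp' (rfl : j = j')
    have h1 := isolated_of_mem_hit hs hr hρ4 (hmem _ hp).2.2
    have h2 := isolated_of_mem_hit hs hr hρ4 (hmem _ hp').2.2
    have h3 := (hmem _ hp').2.1
    have h4 := (hmem _ hp').1
    dsimp only at *
    by_contra hne
    have hii : i' ≠ i := fun h => hne (by rw [h])
    have h5 := h1.2 i' hii (fun h => h3 (h ▸ h4))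
    linarith [h2.1]
  have hle : (hits φ s c A m ρ r ξ).card ≤ S.card := by
    rw [← Finset.card_image_of_injOn hinj1]
    refine Finset.card_le_card fun i hi => ?_
    obtain ⟨p, hp, rfl⟩ := Finset.mem_image.1 hi
    exact (hmem p hp).1
  refine oddsAgainst_add_le hne.card_pos hle ?_
  rw [← Finset.card_image_of_injOn hinj2, ← Finset.card_union_of_disjoint]
  · refine Finset.card_le_card fun i hi => ?_
    rw [mem_informed, mem_slotHolds]
    rcases Finset.mem_union.1 hi with h | h
    · exact Or.inl (mem_informed.1 h)
    · obtain ⟨p, hp, rfl⟩ := Finset.mem_image.1 h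
      exact Or.inr (Or.inr ⟨p.1, delivers_of_mem_hit hs hr hr1 hρ hρ4 hρφ (hmem p hp).2.2⟩)
  · rw [Finset.disjoint_left]
    intro i hi h
    obtain ⟨p, hp, rfl⟩ := Finset.mem_image.1 h
    exact (hmem p hp).2.1 hi

theorem oddsAgainst_nonneg {a : ℕ} (h : a ≤ n) : 0 ≤ oddsAgainst n a := by
  have : (a : ℝ) ≤ n := by exact_mod_cast h
  exact div_nonneg (by linarith) (by positivity)

theorem card_le_fin (S : Finset (Fin n)) : S.card ≤ n := by
  simpa using S.card_le_univ

/-- The expected odds decrease in proportion to the number of possible contacts. -/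
theorem lintegral_oddsAgainst_slotHolds_le_aux (hs : 1 ≤ s) (hr : 0 < r) (hr1 : r ≤ 1)
    (hρ : 0 < ρ) (hρ4 : ρ ≤ 1 / 4) (hρφ : φ.β * (φ.η + φ.P) ≤ φ.P * (2 * ρ) ^ (-φ.α))
    (hne : (informed A m).Nonempty) (B : Fin n → Finset (Fin k)) {q : ℝ} (hq : 0 ≤ q)
    (hhit : ∀ p ∈ contacts c (informed A m),
      ENNReal.ofReal q ≤ slotsLaw n (hit φ s c A m ρ r p.1 p.2)) :
    ∫⁻ ξ, ENNReal.ofReal (oddsAgainst n (informed (slotHolds φ s c A B ξ) m).card) ∂(slotsLaw n) ≤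
      ENNReal.ofReal (oddsAgainst n (informed A m).card -
        n / (2 * ((informed A m).card : ℝ) ^ 2) * (q * (contacts c (informed A m)).card)) := by
  classical
  set S := informed A m with hS
  set g : ℝ := n / (2 * (S.card : ℝ) ^ 2) with hg
  have hg0 : 0 ≤ g := by positivity
  have hD : ∀ ξ, ENNReal.ofReal (g * (hits φ s c A m ρ r ξ).card) =
      ENNReal.ofReal g * ∑ p ∈ contacts c S, (hit φ s c A m ρ r p.1 p.2).indicator 1 ξ := by
    intro ξ
    rw [ENNReal.ofReal_mul hg0, ENNReal.ofReal_natCast, hits, Finset.card_filter]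
    push_cast
    congr 1
  have hDm : Measurable fun ξ : Fin n → SlotSeed =>
      ENNReal.ofReal (g * (hits φ s c A m ρ r ξ).card) := by
    simp_rw [hD]
    exact (Finset.measurable_sum _ fun p _ =>
      measurable_one.indicator (measurableSet_hit φ s c A m ρ r p.1 p.2)).const_mul _
  have hDint : ENNReal.ofReal (g * (q * (contacts c S).card)) ≤
      ∫⁻ ξ, ENNReal.ofReal (g * (hits φ s c A m ρ r ξ).card) ∂(slotsLaw n) := by
    simp_rw [hD]
    rw [lintegral_const_mul _ (Finset.measurable_sum _ fun p _ =>
      measurable_one.indicator (measurableSet_hit φ s c A m ρ r p.1 p.2)),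
      lintegral_finsetSum _ fun p _ =>
      measurable_one.indicator (measurableSet_hit φ s c A m ρ r p.1 p.2),
      ENNReal.ofReal_mul hg0]
    gcongr
    calc ENNReal.ofReal (q * (contacts c S).card) = ∑ p ∈ contacts c S, ENNReal.ofReal q := by
          rw [Finset.sum_const, nsmul_eq_mul, mul_comm, ENNReal.ofReal_mul (by positivity),
            ENNReal.ofReal_natCast]
      _ ≤ _ := by
          refine Finset.sum_le_sum fun p hp => ?_
          rw [lintegral_indicator_one (measurableSet_hit φ s c A m ρ r p.1 p.2)]
          exact hhit p hp
  -- Kept as a sum rather than a difference, so that only the number of hits has to be measurable.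
  have hpt : ∀ ξ, ENNReal.ofReal (oddsAgainst n (informed (slotHolds φ s c A B ξ) m).card) +
      ENNReal.ofReal (g * (hits φ s c A m ρ r ξ).card) ≤ ENNReal.ofReal (oddsAgainst n S.card) := by
    intro ξ
    rw [← ENNReal.ofReal_add (oddsAgainst_nonneg (card_le_fin _)) (by positivity)]
    apply ENNReal.ofReal_le_ofReal
    have := oddsAgainst_slotHolds_le (c := c) (ξ := ξ) hs hr hr1 hρ hρ4 hρφ hne B
    linarith
  have hsum : ∫⁻ ξ, ENNReal.ofReal (oddsAgainst n (informed (slotHolds φ s c A B ξ) m).card)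
        ∂(slotsLaw n) + ENNReal.ofReal (g * (q * (contacts c S).card)) ≤
      ENNReal.ofReal (oddsAgainst n S.card) := by
    refine (add_le_add_right hDint _).trans ?_
    rw [← lintegral_add_right _ hDm]
    refine (lintegral_mono hpt).trans ?_
    simp
  rw [ENNReal.ofReal_sub _ (by positivity)]
  exact ENNReal.le_sub_of_add_le_right ENNReal.ofReal_ne_top hsum

end OneSlot

/-- For such `ρ` the signal from distance `2 ρ r` beats `β (η + P) r ^ (-α)` at every scale `r`. -/
theorem exists_separation (φ : Phy) :
    ∃ ρ : ℝ, 0 < ρ ∧ ρ ≤ 1 / 4 ∧ φ.β * (φ.η + φ.P) ≤ φ.P * (2 * ρ) ^ (-φ.α) := by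
  have hP := φ.P_pos
  have hη := φ.η_pos
  have hβ := φ.β_pos
  have hα : 0 < φ.α := by linarith [φ.two_lt_α]
  set K := φ.β * (φ.η + φ.P) / φ.P with hK
  have hK0 : 0 < K := by positivity
  refine ⟨min (1 / 4) (K ^ (-φ.α⁻¹) / 2), lt_min (by norm_num) (by positivity), min_le_left _ _, ?_⟩
  have h1 : 2 * min (1 / 4) (K ^ (-φ.α⁻¹) / 2) ≤ K ^ (-φ.α⁻¹) := by
    linarith [min_le_right (1 / 4) (K ^ (-φ.α⁻¹) / 2)]
  have h0 : 0 < 2 * min (1 / 4) (K ^ (-φ.α⁻¹) / 2) :=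
    mul_pos two_pos (lt_min (by norm_num) (by positivity))
  have h2 := Real.rpow_le_rpow_of_nonpos h0 h1 (by linarith : -φ.α ≤ 0)
  rw [← Real.rpow_mul hK0.le, neg_mul_neg, inv_mul_cancel₀ hα.ne', Real.rpow_one] at h2
  calc φ.β * (φ.η + φ.P) = φ.P * K := by rw [hK]; field_simp
    _ ≤ _ := by gcongr

/-- The expected odds decrease in proportion to the number of possible contacts, as long as no
subsquare holds more than a constant times the mean number of users. -/
theorem exists_lintegral_oddsAgainst_le (φ : Phy) {C : ℝ} (hC : 0 < C) :
    ∃ κ : ℝ, 0 < κ ∧ κ ≤ 1 ∧ ∀ (n k s : ℕ) (c : Fin n → ℤ × ℤ) (A B : Fin n → Finset (Fin k))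
      (m : Fin k), 1 ≤ s → s ^ 2 ≤ n → (∀ l, c l ∈ grid s) →
      (∀ c' ∈ grid s, (occupancy c c' : ℝ) ≤ C * (n / (s : ℝ) ^ 2)) → (informed A m).Nonempty →
      ∫⁻ ξ, ENNReal.ofReal (oddsAgainst n (informed (slotHolds φ s c A B ξ) m).card)
        ∂(slotsLaw n) ≤ ENNReal.ofReal (oddsAgainst n (informed A m).card -
        n / (2 * ((informed A m).card : ℝ) ^ 2) *
          (κ / k * ((s : ℝ) ^ 2 / n) * (contacts c (informed A m)).card)) := by
  obtain ⟨ρ, hρ, hρ4, hρφ⟩ := exists_separation φ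
  have hθ := φ.θ_pos
  set J := (kernelMass φ.α).toReal with hJ
  have hJ0 : 0 ≤ J := ENNReal.toReal_nonneg
  -- With `r ^ 2 = Δ / n` the mean crowd is at most `C Δ J r ^ (-α)`; this `Δ` makes it at most half
  -- of the threshold `(2 r) ^ (-α)`. The `+ 1` avoids dividing by `J = 0`.
  set Δ : ℝ := min 1 (2 ^ (-φ.α) / (2 * C * (J + 1))) with hΔ
  have hΔ0 : 0 < Δ := lt_min one_pos (by positivity)
  have hΔ1 : Δ ≤ 1 := min_le_left _ _
  have hΔ2 : C * Δ * J ≤ 2 ^ (-φ.α) / 2 := by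
    calc C * Δ * J ≤ C * (2 ^ (-φ.α) / (2 * C * (J + 1))) * (J + 1) := by
          gcongr
          · exact min_le_right _ _
          · linarith
      _ = 2 ^ (-φ.α) / 2 := by field_simp
  refine ⟨ρ ^ 2 * Δ * φ.θ / 324, by positivity, ?_, ?_⟩
  · have h1 : ρ ^ 2 ≤ 1 := by nlinarith
    have h2 : ρ ^ 2 * Δ ≤ 1 := by nlinarith [sq_nonneg ρ]
    have h3 : 0 ≤ ρ ^ 2 * Δ := by positivity
    nlinarith [φ.θ_lt_half]
  · intro n k s c A B m hs hsn hc hocc hne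
    have hs' : (0 : ℝ) < s := by positivity
    have hsn' : (s : ℝ) ^ 2 ≤ n := by exact_mod_cast hsn
    have hn' : (0 : ℝ) < n := lt_of_lt_of_le (by positivity) hsn'
    have hk' : (0 : ℝ) < k := by
      have := m.pos
      exact_mod_cast this
    -- The scale of the distance between nearest users: at the mean density `n`, a disc of radius
    -- `r` contains of the order of `Δ` users.
    set r : ℝ := Real.sqrt (Δ / n) with hr
    have hr0 : 0 < r := Real.sqrt_pos.2 (by positivity)
    have hr2 : r ^ 2 = Δ / n := Real.sq_sqrt (by positivity)
    have hn1 : (1 : ℝ) ≤ n := by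
      have : (1 : ℝ) ≤ s := by exact_mod_cast hs
      nlinarith
    have hrs : (r * s) ^ 2 ≤ 1 := by
      rw [mul_pow, hr2, div_mul_eq_mul_div, div_le_one hn']
      nlinarith
    have hrs1 : r * s ≤ 1 := by nlinarith [mul_pos hr0 hs']
    have hr1 : r ≤ 1 := by
      have : r ^ 2 ≤ 1 := by
        rw [hr2, div_le_one hn']
        linarith
      nlinarith
    have hε0 : 0 < ρ * r * s := by positivity
    have hε1 : ρ * r * s ≤ 1 / 2 := by
      rw [mul_assoc]
      nlinarith [mul_pos hr0 hs']
    have hMr : C * (n / (s : ℝ) ^ 2) * ((s : ℝ) ^ 2 * r ^ (2 - φ.α) * J) ≤ (2 * r) ^ (-φ.α) / 2 := by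
      rw [Real.mul_rpow zero_le_two hr0.le, show 2 - φ.α = 2 + -φ.α by ring, Real.rpow_add hr0,
        Real.rpow_two, hr2]
      calc C * (n / (s : ℝ) ^ 2) * ((s : ℝ) ^ 2 * (Δ / n * r ^ (-φ.α)) * J)
          = (C * Δ * J) * r ^ (-φ.α) := by field_simp
        _ ≤ (2 ^ (-φ.α) / 2) * r ^ (-φ.α) := by gcongr
        _ = _ := by ring
    refine lintegral_oddsAgainst_slotHolds_le_aux (ρ := ρ) (r := r) hs hr0 hr1 hρ hρ4 hρφ hne B
      (by positivity) ?_
    intro p hp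
    simp only [contacts, Finset.mem_filter, Finset.mem_product, Finset.mem_compl] at hp
    obtain ⟨⟨hp1, hp2⟩, hp3, hp4⟩ := hp
    have hij : p.1 ≠ p.2 := fun h => hp2 (h ▸ hp1)
    have h1 := slotsLaw_meet_ge (φ := φ) hε0 hε1 hij (hc p.1) hp3 hp4 (mem_informed.1 hp1)
    have h2 := h1.trans (slotsLaw_hit_ge_half hs hc (by positivity) hocc hr0 hMr p.1 p.2)
    -- Since `(ρ r s) ^ 2 = ρ ^ 2 Δ s ^ 2 / n`, a given pair hits with probability of order `s ^ 2 /
    -- n`; `324 = 2 * 162`.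
    have h3 : ENNReal.ofReal ((ρ * r * s) ^ 2 * φ.θ / (162 * k)) =
        2 * ENNReal.ofReal (ρ ^ 2 * Δ * φ.θ / 324 / k * ((s : ℝ) ^ 2 / n)) := by
      rw [show (2 : ℝ≥0∞) = ENNReal.ofReal 2 by simp, ← ENNReal.ofReal_mul zero_le_two]
      congr 1
      rw [mul_pow, mul_pow, hr2]
      field_simp
      norm_num
    rw [h3] at h2
    exact (ENNReal.mul_le_mul_iff_right (by simp) (by simp)).1 h2

/-! ### The network as a Markov chain -/

/-- Subsquares of the users, and messages that they hold. -/
def NetState (n k : ℕ) : Type := (Fin n → ℤ × ℤ) × (Fin n → Finset (Fin k))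

instance (n k : ℕ) : MeasurableSpace (NetState n k) := ⊤

instance (n k : ℕ) : Countable (NetState n k) :=
  inferInstanceAs (Countable ((Fin n → ℤ × ℤ) × (Fin n → Finset (Fin k))))

instance (n k : ℕ) : MeasurableSingletonClass (NetState n k) := ⟨fun _ => trivial⟩

section Chain

variable {n k : ℕ} (φ : Phy) (s : ℕ) (src : Fin k → Fin n) (τ : Fin k → ℕ)

/-- Messages injected at user `j` at time `t + 1`. -/
def injected (src : Fin k → Fin n) (τ : Fin k → ℕ) (t : ℕ) (j : Fin n) : Finset (Fin k) :=
  Finset.univ.filter fun m => τ m = t + 1 ∧ src m = j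

/-- Transition of the network in slot `t`. -/
noncomputable def netStep (t : ℕ) (x : NetState n k) (ξ : Fin n → SlotSeed) : NetState n k :=
  (fun i => move s (x.1 i) (ξ i).1, slotHolds φ s x.1 x.2 (injected src τ t) ξ)

/-- State of the mobile network at time `t`. -/
noncomputable def netState (t : ℕ) (ω : Run n) : NetState n k :=
  (fun i => cell s ω i t, fun i => holds φ (mobilePos s ω) src τ ω t i)

theorem netState_succ (t : ℕ) (ω : Run n) :
    netState φ s src τ (t + 1) ω = netStep φ s src τ t (netState φ s src τ t ω) (ω.2 t) := by
  refine Prod.ext rfl (funext fun j => Finset.ext fun m => ?_)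
  have h1 : mobilePos s ω (t + 1) = slotPos s (fun i => cell s ω i t) (ω.2 t) := rfl
  have h2 : senders φ ω t = slotSenders φ (ω.2 t) := rfl
  change m ∈ holds φ (mobilePos s ω) src τ ω (t + 1) j ↔ m ∈ slotHolds φ s (fun i => cell s ω i t)
    (fun i => holds φ (mobilePos s ω) src τ ω t i) (injected src τ t) (ω.2 t) j
  rw [mem_holds_succ, mem_slotHolds, h1, h2]
  simp only [injected, Finset.mem_filter, Finset.mem_univ, true_and]
  rfl

/-- The state at time `u` is built from the seeds of earlier slots only. This is the Markov property
in the form used by `lintegral_past_now`. -/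
theorem netState_resample {t u : ℕ} (h : u ≤ t) (ω : Run n) (ξ : Fin n → SlotSeed) :
    netState φ s src τ u (ω.resample t ξ) = netState φ s src τ u ω := by
  induction u with
  | zero =>
    refine Prod.ext rfl (funext fun j => Finset.ext fun m => ?_)
    change m ∈ holds φ (mobilePos s (ω.resample t ξ)) src τ (ω.resample t ξ) 0 j ↔ m ∈ holds φ (mobilePos s ω) src τ ω 0 j
    rw [mem_holds_zero, mem_holds_zero]
  | succ u ih =>
    rw [netState_succ, netState_succ, ih (by omega), Run.resample_snd_of_ne ω (by omega)]

theorem dist_toPlane (z z' : ℝ × ℝ) :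
    dist (toPlane z) (toPlane z') = Real.sqrt ((z.1 - z'.1) ^ 2 + (z.2 - z'.2) ^ 2) := by
  rw [EuclideanSpace.dist_eq, Fin.sum_univ_two, Real.dist_eq, Real.dist_eq, sq_abs, sq_abs]
  rfl

theorem measurable_dist_slotPos (c : Fin n → ℤ × ℤ) (i j : Fin n) :
    Measurable fun ξ : Fin n → SlotSeed => dist (slotPos s c ξ i) (slotPos s c ξ j) := by
  have h1 := (measurable_place s (c i)).comp (measurable_pi_apply (X := fun _ : Fin n => SlotSeed) i)
  have h2 := (measurable_place s (c j)).comp (measurable_pi_apply (X := fun _ : Fin n => SlotSeed) j)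
  simp only [slotPos, dist_toPlane]
  exact ((((measurable_fst.comp h1).sub (measurable_fst.comp h2)).pow_const 2).add
    (((measurable_snd.comp h1).sub (measurable_snd.comp h2)).pow_const 2)).sqrt

theorem measurableSet_mem_slotSenders (i : Fin n) :
    MeasurableSet {ξ : Fin n → SlotSeed | i ∈ slotSenders φ ξ} := by
  simp only [mem_slotSenders]
  exact measurableSet_lt (measurable_subtype_coe.comp
    (by fun_prop : Measurable fun ξ : Fin n → SlotSeed => (ξ i).2.2.1)) measurable_const

theorem measurable_sinr (c : Fin n → ℤ × ℤ) (i j : Fin n) :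
    Measurable fun ξ : Fin n → SlotSeed => sinr φ (slotPos s c ξ) (slotSenders φ ξ) i j := by
  classical
  have h1 : ∀ ξ : Fin n → SlotSeed, ∑ l ∈ (slotSenders φ ξ).erase i,
      φ.P * dist (slotPos s c ξ l) (slotPos s c ξ j) ^ (-φ.α) =
      ∑ l ∈ Finset.univ.erase i, {ξ : Fin n → SlotSeed | l ∈ slotSenders φ ξ}.indicator
        (fun ξ => φ.P * dist (slotPos s c ξ l) (slotPos s c ξ j) ^ (-φ.α)) ξ := by
    intro ξ
    simp only [Set.indicator_apply, Set.mem_ofPred_eq]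
    rw [← Finset.sum_filter]
    congr 1
    ext l
    simp
  have h2 : ∀ l, Measurable fun ξ : Fin n → SlotSeed =>
      φ.P * dist (slotPos s c ξ l) (slotPos s c ξ j) ^ (-φ.α) := fun l =>
    ((measurable_dist_slotPos s c l j).pow_const _).const_mul _
  unfold sinr
  simp_rw [h1]
  exact (h2 i).div (measurable_const.add (Finset.measurable_sum _ fun l _ =>
    (h2 l).indicator (measurableSet_mem_slotSenders φ l)))

theorem measurableSet_delivers (c : Fin n → ℤ × ℤ) (i j : Fin n) :
    MeasurableSet {ξ : Fin n → SlotSeed | Delivers φ (slotPos s c ξ) (slotSenders φ ξ) i j} := by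
  suffices key : MeasurableSet {ξ : Fin n → SlotSeed | ∀ j' ∉ slotSenders φ ξ,
      dist (slotPos s c ξ i) (slotPos s c ξ j) ≤ dist (slotPos s c ξ i) (slotPos s c ξ j')} by
    exact (measurableSet_mem_slotSenders φ i).inter
      ((measurableSet_mem_slotSenders φ j).compl.inter (key.inter
        (measurableSet_le measurable_const (measurable_sinr φ s c i j))))
  rw [Set.ofPred_forall]
  refine MeasurableSet.iInter fun j' => ?_
  have : {ξ : Fin n → SlotSeed | j' ∉ slotSenders φ ξ →
      dist (slotPos s c ξ i) (slotPos s c ξ j) ≤ dist (slotPos s c ξ i) (slotPos s c ξ j')} =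
      {ξ | j' ∈ slotSenders φ ξ} ∪ {ξ |
      dist (slotPos s c ξ i) (slotPos s c ξ j) ≤ dist (slotPos s c ξ i) (slotPos s c ξ j')} := by
    ext ξ
    simp only [Set.mem_ofPred_eq, Set.mem_union]
    tauto
  rw [this]
  exact (measurableSet_mem_slotSenders φ j').union (measurableSet_le
    (measurable_dist_slotPos s c i j) (measurable_dist_slotPos s c i j'))

theorem measurableSet_mem_slotHolds (c : Fin n → ℤ × ℤ) (A B : Fin n → Finset (Fin k)) (j : Fin n)
    (m : Fin k) : MeasurableSet {ξ | m ∈ slotHolds φ s c A B ξ j} := by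
  simp only [mem_slotHolds]
  suffices key : MeasurableSet {ξ : Fin n → SlotSeed | ∃ i, Delivers φ (slotPos s c ξ)
      (slotSenders φ ξ) i j ∧ Selects (ξ i).2.2.2 (A i) m} by
    exact (MeasurableSet.const _).union ((MeasurableSet.const _).union key)
  rw [Set.ofPred_exists]
  refine MeasurableSet.iUnion fun i => (measurableSet_delivers φ s c i j).inter ?_
  exact (by fun_prop : Measurable fun ξ : Fin n → SlotSeed => (ξ i).2.2.2)
    (measurableSet_Selects (A i) m)

theorem measurable_netStep (t : ℕ) (x : NetState n k) : Measurable (netStep φ s src τ t x) := by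
  refine measurable_to_countable' fun y => ?_
  have : netStep φ s src τ t x ⁻¹' {y} =
      (⋂ i, {ξ | move s (x.1 i) (ξ i).1 = y.1 i}) ∩
      ⋂ j, ⋂ m, {ξ | m ∈ slotHolds φ s x.1 x.2 (injected src τ t) ξ j ↔ m ∈ y.2 j} := by
    ext ξ
    simp only [Set.mem_preimage, Set.mem_inter_iff, Set.mem_iInter,
      Set.mem_ofPred_eq, netStep]
    constructor
    · rintro rfl
      exact ⟨fun i => rfl, fun j m => Iff.rfl⟩
    · rintro ⟨h1, h2⟩
      exact Prod.ext (funext h1) (funext fun j => Finset.ext (h2 j))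
  rw [this]
  refine MeasurableSet.inter (MeasurableSet.iInter fun i => ?_)
    (MeasurableSet.iInter fun j => MeasurableSet.iInter fun m => ?_)
  · exact (by fun_prop : Measurable fun ξ : Fin n → SlotSeed => (ξ i).1)
      (measurable_of_countable (fun d => move s (x.1 i) d) (measurableSet_singleton (y.1 i)))
  · have h := measurableSet_mem_slotHolds φ s x.1 x.2 (injected src τ t) j m
    by_cases hy : m ∈ y.2 j
    · simpa only [hy, iff_true] using h
    · simp only [hy, iff_false]
      exact h.compl

theorem measurable_netState (t : ℕ) : Measurable (netState φ s src τ t : Run n → NetState n k) := by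
  induction t with
  | zero =>
    have h : netState φ s src τ 0 = (fun c : Fin n → ℤ × ℤ =>
        ((c, fun j => Finset.univ.filter fun m => τ m = 0 ∧ src m = j) : NetState n k)) ∘
        fun ω : Run n => fun i => cell s ω i 0 := by
      funext ω
      refine Prod.ext rfl (funext fun j => Finset.ext fun m => ?_)
      change m ∈ holds φ (mobilePos s ω) src τ ω 0 j ↔
        m ∈ Finset.univ.filter fun m => τ m = 0 ∧ src m = j
      rw [mem_holds_zero]
      simp
    rw [h]
    exact (measurable_of_countable _).comp (measurable_pi_lambda _ fun i => measurable_cell s i 0)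
  | succ t ih =>
    have h : netState φ s src τ (t + 1) = Function.uncurry (netStep φ s src τ t) ∘
        fun ω : Run n => (netState φ s src τ t ω, ω.2 t) := by
      funext ω
      exact netState_succ φ s src τ t ω
    rw [h]
    exact (measurable_seed_of_countable (measurable_netStep φ s src τ t)).comp
      (ih.prodMk (by fun_prop))

open Classical in
/-- Indicator that the network has been in good states since time `t₀`. -/
noncomputable def goodSince (G : NetState n k → Prop) (t₀ d : ℕ) (ω : Run n) : ℝ≥0∞ :=
  if ∀ t ∈ Finset.Ico t₀ (t₀ + d), G (netState φ s src τ t ω) then 1 else 0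

theorem measurable_goodSince (G : NetState n k → Prop) (t₀ d : ℕ) :
    Measurable (goodSince φ s src τ G t₀ d) := by
  classical
  refine Measurable.ite ?_ measurable_const measurable_const
  have : {ω : Run n | ∀ t ∈ Finset.Ico t₀ (t₀ + d), G (netState φ s src τ t ω)} =
      ⋂ t ∈ Finset.Ico t₀ (t₀ + d), netState φ s src τ t ⁻¹' {x | G x} := by
    ext ω
    simp only [Set.mem_iInter]
    rfl
  rw [this]
  exact Finset.measurableSet_biInter _ fun t _ => measurable_netState φ s src τ t trivial

/-- A potential that contracts in every good state decays geometrically. -/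
theorem lintegral_potential_le (G : NetState n k → Prop) (w : NetState n k → ℝ≥0∞) (q : ℝ≥0∞)
    (t₀ : ℕ) (hw : ∀ t, t₀ ≤ t → ∀ x, G x →
      ∫⁻ ξ, w (netStep φ s src τ t x ξ) ∂(slotsLaw n) ≤ q * w x) (d : ℕ) :
    ∫⁻ ω, goodSince φ s src τ G t₀ d ω * w (netState φ s src τ (t₀ + d) ω) ∂(runLaw n) ≤
      q ^ d * ∫⁻ ω, w (netState φ s src τ t₀ ω) ∂(runLaw n) := by
  classical
  have hwm : Measurable w := measurable_of_countable w
  induction d with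
  | zero =>
    simp [goodSince]
  | succ d ih =>
    set F : NetState n k × ℝ≥0∞ → (Fin n → SlotSeed) → ℝ≥0∞ := fun x ξ =>
      x.2 * w (netStep φ s src τ (t₀ + d) x.1 ξ) with hF
    have hFm : Measurable (Function.uncurry F) := by
      have h1 := measurable_seed_of_countable (measurable_netStep φ s src τ (t₀ + d))
      have h2 : Measurable fun p : (NetState n k × ℝ≥0∞) × (Fin n → SlotSeed) => (p.1.1, p.2) := by
        fun_prop
      exact (measurable_snd.comp measurable_fst).mul (hwm.comp (h1.comp h2))
    have hXm : Measurable fun ω : Run n =>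
        (netState φ s src τ (t₀ + d) ω, goodSince φ s src τ G t₀ (d + 1) ω) :=
      (measurable_netState φ s src τ _).prodMk (measurable_goodSince φ s src τ G t₀ _)
    -- The indicator for `d + 1` looks at states up to time `t₀ + d`, which the seeds of slot `t₀ +
    -- d` do not influence.
    have h1 := lintegral_past_now (t₀ + d) hXm (fun ω ξ => by
      refine Prod.ext (netState_resample φ s src τ le_rfl ω ξ) ?_
      simp only [goodSince]
      congr 1
      refine propext (forall₂_congr fun t ht => ?_)
      rw [netState_resample φ s src τ (by have := Finset.mem_Ico.1 ht; omega) ω ξ]) hFm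
    have h2 : ∀ ω : Run n, goodSince φ s src τ G t₀ (d + 1) ω *
        w (netState φ s src τ (t₀ + (d + 1)) ω) =
        F (netState φ s src τ (t₀ + d) ω, goodSince φ s src τ G t₀ (d + 1) ω) (ω.2 (t₀ + d)) := by
      intro ω
      rw [hF, ← add_assoc, netState_succ]
    simp_rw [h2]
    rw [h1]
    calc ∫⁻ ω, ∫⁻ ξ, F (netState φ s src τ (t₀ + d) ω, goodSince φ s src τ G t₀ (d + 1) ω) ξ
          ∂(slotsLaw n) ∂(runLaw n)
        ≤ ∫⁻ ω, q * (goodSince φ s src τ G t₀ d ω * w (netState φ s src τ (t₀ + d) ω))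
          ∂(runLaw n) := by
          refine lintegral_mono fun ω => ?_
          simp only [hF]
          have hm : Measurable fun ξ => w (netStep φ s src τ (t₀ + d)
              (netState φ s src τ (t₀ + d) ω) ξ) := hwm.comp (measurable_netStep φ s src τ _ _)
          rw [lintegral_const_mul _ hm]
          by_cases hg : ∀ t ∈ Finset.Ico t₀ (t₀ + (d + 1)), G (netState φ s src τ t ω)
          · have hg' : ∀ t ∈ Finset.Ico t₀ (t₀ + d), G (netState φ s src τ t ω) := fun t ht =>
              hg t (by rw [Finset.mem_Ico] at *; omega)
            simp only [goodSince, if_pos hg, if_pos hg', one_mul]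
            exact hw _ (by omega) _ (hg _ (by rw [Finset.mem_Ico]; omega))
          · simp only [goodSince, if_neg hg, zero_mul]
            exact zero_le
      _ = q * ∫⁻ ω, goodSince φ s src τ G t₀ d ω * w (netState φ s src τ (t₀ + d) ω)
          ∂(runLaw n) := lintegral_const_mul _ ((measurable_goodSince φ s src τ G t₀ d).mul
            (hwm.comp (measurable_netState φ s src τ _)))
      _ ≤ q * (q ^ d * ∫⁻ ω, w (netState φ s src τ t₀ ω) ∂(runLaw n)) := by gcongr
      _ = _ := by rw [pow_succ', mul_assoc]

/-- Tail bound for the spreading time of `m` from a potential comparable to the odds. -/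
theorem measure_not_spread_le {m : Fin k} (G : NetState n k → Prop) (w : NetState n k → ℝ≥0∞)
    (q : ℝ≥0∞) (hw : ∀ t, τ m ≤ t → ∀ x, G x →
      ∫⁻ ξ, w (netStep φ s src τ t x ξ) ∂(slotsLaw n) ≤ q * w x)
    (hw1 : ∀ x : NetState n k, ENNReal.ofReal (oddsAgainst n (informed x.2 m).card) ≤ w x)
    (hw2 : ∀ x : NetState n k, w x ≤ 2 * ENNReal.ofReal (oddsAgainst n (informed x.2 m).card))
    (d : ℕ) :
    runLaw n {ω | ¬ ∀ j, m ∈ holds φ (mobilePos s ω) src τ ω (τ m + d) j} ≤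
      runLaw n {ω | ¬ ∀ t ∈ Finset.Ico (τ m) (τ m + d), G (netState φ s src τ t ω)} +
      q ^ d * (2 * (n : ℝ≥0∞) ^ 2) := by
  classical
  have hn : 0 < n := (src m).pos
  have hn' : (0 : ℝ) < n := by exact_mod_cast hn
  have hinf : ∀ (t : ℕ) (ω : Run n), τ m ≤ t →
      src m ∈ informed (netState φ s src τ t ω).2 m := fun t ω ht =>
    mem_informed.2 (holds_mono ht (mem_holds_injection.2 rfl))
  set f : Run n → ℝ≥0∞ := fun ω =>
    goodSince φ s src τ G (τ m) d ω * w (netState φ s src τ (τ m + d) ω) with hf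
  have hfm : Measurable f := (measurable_goodSince φ s src τ G _ d).mul
    ((measurable_of_countable w).comp (measurable_netState φ s src τ _))
  have hsub : {ω | ¬ ∀ j, m ∈ holds φ (mobilePos s ω) src τ ω (τ m + d) j} ⊆
      {ω | ¬ ∀ t ∈ Finset.Ico (τ m) (τ m + d), G (netState φ s src τ t ω)} ∪
      {ω | (n : ℝ≥0∞)⁻¹ ≤ f ω} := by
    intro ω hω
    by_cases hg : ∀ t ∈ Finset.Ico (τ m) (τ m + d), G (netState φ s src τ t ω)
    · right
      have hω' : ¬ ∀ j, m ∈ holds φ (mobilePos s ω) src τ ω (τ m + d) j := hω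
      push Not at hω'
      obtain ⟨j, hj⟩ := hω'
      change (n : ℝ≥0∞)⁻¹ ≤ f ω
      simp only [hf, goodSince, if_pos hg, one_mul]
      -- As long as one user is uninformed the odds exceed `1 / n`, so this level detects failure.
      refine le_trans ?_ (hw1 _)
      set S := informed (netState φ s src τ (τ m + d) ω).2 m with hS
      have hS1 : 0 < S.card := Finset.card_pos.2 ⟨_, hinf _ ω (by omega)⟩
      have hS2 : S.card < n := by
        have h1 : S ⊂ Finset.univ := by
          rw [Finset.ssubset_univ_iff]
          intro h
          have : j ∈ S := h ▸ Finset.mem_univ j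
          exact hj (mem_informed.1 this)
        simpa using Finset.card_lt_card h1
      have hS1' : (0 : ℝ) < S.card := by exact_mod_cast hS1
      have hS2' : (S.card : ℝ) + 1 ≤ n := by exact_mod_cast hS2
      rw [← ENNReal.ofReal_natCast, ← ENNReal.ofReal_inv_of_pos hn']
      apply ENNReal.ofReal_le_ofReal
      unfold oddsAgainst
      rw [inv_eq_one_div, div_le_div_iff₀ hn' hS1']
      nlinarith
    · exact Or.inl hg
  refine (measure_mono hsub).trans ((measure_union_le _ _).trans (add_le_add_right ?_ _))
  refine (meas_ge_le_lintegral_div hfm.aemeasurable (by simp) (by simp [hn.ne'])).trans ?_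
  -- The source is informed, so the initial odds are at most `n`; dividing by the level `1 / n`
  -- produces `2 n ^ 2`.
  have hint : ∫⁻ ω, w (netState φ s src τ (τ m) ω) ∂(runLaw n) ≤ 2 * n := by
    calc ∫⁻ ω, w (netState φ s src τ (τ m) ω) ∂(runLaw n)
        ≤ ∫⁻ _ω : Run n, 2 * n ∂(runLaw n) := by
          refine lintegral_mono fun ω => (hw2 _).trans ?_
          gcongr
          rw [← ENNReal.ofReal_natCast]
          apply ENNReal.ofReal_le_ofReal
          set S := informed (netState φ s src τ (τ m) ω).2 m with hS
          have hS1 : 1 ≤ S.card := Finset.card_pos.2 ⟨_, hinf _ ω le_rfl⟩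
          have hS1' : (1 : ℝ) ≤ S.card := by exact_mod_cast hS1
          unfold oddsAgainst
          rw [div_le_iff₀ (by linarith)]
          nlinarith
      _ = 2 * n := by simp
  have hdecay := lintegral_potential_le φ s src τ G w q (τ m) hw d
  calc (∫⁻ ω, f ω ∂(runLaw n)) / (n : ℝ≥0∞)⁻¹
      ≤ (q ^ d * (2 * n)) / (n : ℝ≥0∞)⁻¹ := by
        gcongr
        exact hdecay.trans (by gcongr)
    _ = _ := by
        rw [div_eq_mul_inv, inv_inv]
        ring

end Chain

/-! ### Upper bounds on the spreading time -/

/-- The users are evenly spread over the grid, and some user holds `m`. -/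
def Balanced {n k : ℕ} (s : ℕ) (m : Fin k) (x : NetState n k) : Prop :=
  (∀ l, x.1 l ∈ grid s) ∧ (informed x.2 m).Nonempty ∧ ∀ c ∈ grid s,
    (n / (s : ℝ) ^ 2) / 8 ≤ occupancy x.1 c ∧ (occupancy x.1 c : ℝ) ≤ 4 * (n / (s : ℝ) ^ 2)

theorem netState_informed_nonempty {n k : ℕ} (φ : Phy) (s : ℕ) (src : Fin k → Fin n)
    (τ : Fin k → ℕ) {m : Fin k} {t : ℕ} (ht : τ m ≤ t) (ω : Run n) :
    (informed (netState φ s src τ t ω).2 m).Nonempty :=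
  ⟨src m, mem_informed.2 (holds_mono ht (mem_holds_injection.2 rfl))⟩

theorem measure_not_balanced_le {n k s : ℕ} (φ : Phy) (hs : 1 ≤ s) (src : Fin k → Fin n)
    (τ : Fin k → ℕ) (m : Fin k) (d : ℕ) :
    runLaw n {ω | ¬ ∀ t ∈ Finset.Ico (τ m) (τ m + d), Balanced s m (netState φ s src τ t ω)} ≤
      ENNReal.ofReal (d * (s : ℝ) ^ 2 * (2 * Real.exp (-(0.4 * (n / (s : ℝ) ^ 2))))) := by
  have hsub : {ω | ¬ ∀ t ∈ Finset.Ico (τ m) (τ m + d), Balanced s m (netState φ s src τ t ω)} ⊆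
      ⋃ p ∈ Finset.Ico (τ m) (τ m + d) ×ˢ grid s,
        {ω : Run n | ¬ ((n / (s : ℝ) ^ 2) / 8 ≤ occupancy (fun i => cell s ω i p.1) p.2 ∧
          (occupancy (fun i => cell s ω i p.1) p.2 : ℝ) ≤ 4 * (n / (s : ℝ) ^ 2))} := by
    intro ω hω
    have hω' : ¬ ∀ t ∈ Finset.Ico (τ m) (τ m + d), Balanced s m (netState φ s src τ t ω) := hω
    by_contra hcon
    refine hω' fun t ht => ⟨fun l => cell_mem_grid hs ω l t,
      netState_informed_nonempty φ s src τ (Finset.mem_Ico.1 ht).1 ω, fun c hc => ?_⟩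
    by_contra hc'
    exact hcon (Set.mem_iUnion₂.2 ⟨(t, c), Finset.mem_product.2 ⟨ht, hc⟩, hc'⟩)
  refine (measure_mono hsub).trans ((measure_biUnion_finset_le _ _).trans ?_)
  refine (Finset.sum_le_sum fun p hp =>
    measure_occupancy_unbalanced_le hs p.1 (Finset.mem_product.1 hp).2).trans ?_
  rw [Finset.sum_const, Finset.card_product, card_grid, Nat.card_Ico, nsmul_eq_mul,
    ENNReal.ofReal_mul (p := d * (s : ℝ) ^ 2) (by positivity)]
  refine mul_le_mul' ?_ le_rfl
  rw [show τ m + d - τ m = d by omega, ← ENNReal.ofReal_natCast]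
  apply ENNReal.ofReal_le_ofReal
  push_cast
  exact le_rfl

/-- In a balanced state the expected odds contract by a factor `1 - κ / s`. -/
theorem exists_contraction_of_balanced (φ : Phy) (K : ℕ) :
    ∃ κ : ℝ, 0 < κ ∧ κ ≤ 1 ∧ ∀ (n k s : ℕ) (m : Fin k) (x : NetState n k)
      (B : Fin n → Finset (Fin k)), k ≤ K → 1 ≤ s → s ^ 2 ≤ n → Balanced s m x →
      ∫⁻ ξ, ENNReal.ofReal (oddsAgainst n (informed (slotHolds φ s x.1 x.2 B ξ) m).card)
        ∂(slotsLaw n) ≤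
      ENNReal.ofReal (1 - κ / s) * ENNReal.ofReal (oddsAgainst n (informed x.2 m).card) := by
  obtain ⟨κ, hκ, hκ1, h⟩ := exists_lintegral_oddsAgainst_le φ (C := 4) (by norm_num)
  -- `4096 = 2 * 2048`: the factor `2` comes from the drop of the odds, and `2048 = 2 * 32 ^ 2` from
  -- the isoperimetric inequality with occupancies within a ratio `32`.
  refine ⟨κ / (4096 * (K + 1)), by positivity, ?_, ?_⟩
  · have : (0 : ℝ) ≤ K := by positivity
    rw [div_le_one (by positivity)]
    linarith
  intro n k s m x B hk hs hsn hx
  have hs' : (0 : ℝ) < s := by positivity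
  have hsn' : (s : ℝ) ^ 2 ≤ n := by exact_mod_cast hsn
  have hn' : (0 : ℝ) < n := lt_of_lt_of_le (by positivity) hsn'
  have hk0 : (0 : ℝ) < k := by
    have := m.pos
    exact_mod_cast this
  have hkK : (k : ℝ) ≤ K + 1 := by
    have : (k : ℝ) ≤ K := by exact_mod_cast hk
    linarith
  refine (h n k s x.1 x.2 B m hs hsn hx.1 (fun c hc => (hx.2.2 c hc).2) hx.2.1).trans ?_
  have hpaths := card_mul_card_compl_le hx.1 (informed x.2 m)
    (m₀ := (n / (s : ℝ) ^ 2) / 8) (m₁ := 4 * (n / (s : ℝ) ^ 2)) (by positivity) hx.2.2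
  have hratio : 4 * ((n : ℝ) / (s : ℝ) ^ 2) / ((n / (s : ℝ) ^ 2) / 8) = 32 := by
    field_simp
    norm_num
  rw [hratio] at hpaths
  set S := informed x.2 m with hS
  have ha : (0 : ℝ) < S.card := by
    have := hx.2.1.card_pos
    exact_mod_cast this
  have hcompl : (Sᶜ.card : ℝ) = n - S.card := by
    rw [Finset.card_compl, Fintype.card_fin, Nat.cast_sub (card_le_fin S)]
  rw [hcompl] at hpaths
  set X : ℝ := ((contacts x.1 S).card : ℝ) with hX
  have hodds := oddsAgainst_nonneg (card_le_fin S)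
  have hκs : κ / (4096 * (K + 1)) / s ≤ 1 := by
    rw [div_div, div_le_one (by positivity)]
    have h1 : (1 : ℝ) ≤ s := by exact_mod_cast hs
    have h2 : (0 : ℝ) ≤ K := by positivity
    nlinarith
  rw [← ENNReal.ofReal_mul (by linarith)]
  apply ENNReal.ofReal_le_ofReal
  have hX' : S.card * (n - S.card) / (2048 * (s : ℝ) ^ 3) ≤ X := by
    rw [div_le_iff₀ (by positivity)]
    linarith
  have hodds' : (0 : ℝ) ≤ n - S.card := by
    have : (S.card : ℝ) ≤ n := by exact_mod_cast card_le_fin S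
    linarith
  -- At least order `a (n - a) / s ^ 3` contacts, each hitting with probability of order `s ^ 2 / n`
  -- and lowering the odds by order `n / a ^ 2`: the product is the odds `(n - a) / a` over `s`, for
  -- every `a`.
  have key : κ / (4096 * (K + 1)) / s * oddsAgainst n S.card ≤
      n / (2 * (S.card : ℝ) ^ 2) * (κ / k * ((s : ℝ) ^ 2 / n) * X) := by
    calc κ / (4096 * (K + 1)) / s * oddsAgainst n S.card
        ≤ κ / (4096 * k) / s * oddsAgainst n S.card := by gcongr
      _ = n / (2 * (S.card : ℝ) ^ 2) * (κ / k * ((s : ℝ) ^ 2 / n) *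
          (S.card * (n - S.card) / (2048 * (s : ℝ) ^ 3))) := by
          unfold oddsAgainst
          field_simp
          ring
      _ ≤ _ := by gcongr
  linarith

/-- The first term is the risk of meeting an unbalanced state, the second is Markov's inequality for
the decayed odds. -/
theorem exists_measure_not_spread_le (φ : Phy) (K : ℕ) :
    ∃ κ : ℝ, 0 < κ ∧ κ ≤ 1 ∧ ∀ (n k s : ℕ) (src : Fin k → Fin n) (τ : Fin k → ℕ) (m : Fin k)
      (d : ℕ), k ≤ K → 1 ≤ s → s ^ 2 ≤ n →
      runLaw n {ω | ¬ ∀ j, m ∈ holds φ (mobilePos s ω) src τ ω (τ m + d) j} ≤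
        ENNReal.ofReal (d * (s : ℝ) ^ 2 * (2 * Real.exp (-(0.4 * (n / (s : ℝ) ^ 2)))) +
          (1 - κ / s) ^ d * (2 * (n : ℝ) ^ 2)) := by
  obtain ⟨κ, hκ, hκ1, h⟩ := exists_contraction_of_balanced φ K
  refine ⟨κ, hκ, hκ1, fun n k s src τ m d hk hs hsn => ?_⟩
  have h1 : (1 : ℝ) ≤ s := by exact_mod_cast hs
  have hκs : 0 ≤ 1 - κ / s := by
    rw [sub_nonneg, div_le_one (by linarith)]
    linarith
  refine (measure_not_spread_le φ s src τ (m := m) (Balanced s m)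
    (fun x => ENNReal.ofReal (oddsAgainst n (informed x.2 m).card)) (ENNReal.ofReal (1 - κ / s))
    (fun t _ x hx => h n k s m x (injected src τ t) hk hs hsn hx) (fun x => le_rfl)
    (fun x => ?_) d).trans ?_
  · rw [two_mul]
    exact le_self_add
  · rw [ENNReal.ofReal_add (by positivity) (by positivity)]
    refine add_le_add (measure_not_balanced_le φ hs src τ m d) (le_of_eq ?_)
    rw [ENNReal.ofReal_mul (by positivity), ENNReal.ofReal_pow hκs, ENNReal.ofReal_mul zero_le_two,
      ENNReal.ofReal_pow (by positivity)]
    simp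

/-! ### Networks of bounded size -/

/-- Number of diagonal moves towards the corner after which all users are in the corner. -/
def cornerDist {n : ℕ} (c : Fin n → ℤ × ℤ) : ℕ :=
  Finset.univ.sup fun i => max (c i).1.toNat (c i).2.toNat

/-- A move towards the corner. -/
def cornerDir (c : ℤ × ℤ) : Fin 3 × Fin 3 :=
  (if 0 < c.1 then 0 else 1, if 0 < c.2 then 0 else 1)

theorem move_cornerDir {s : ℕ} {c : ℤ × ℤ} (hc : c ∈ grid s) :
    move s c (cornerDir c) = (max (c.1 - 1) 0, max (c.2 - 1) 0) := by
  rw [mem_grid] at hc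
  unfold move cornerDir
  dsimp only
  by_cases h1 : 0 < c.1 <;> by_cases h2 : 0 < c.2 <;> simp only [h1, h2, if_true, if_false] <;>
    rw [if_pos] <;> first
      | (refine Prod.ext ?_ ?_ <;> simp <;> omega)
      | (refine ⟨?_, ?_, ?_, ?_⟩ <;> simp <;> omega)

/-- Every positive coordinate decreases by one; truncated subtraction covers users that are already
in the corner. -/
theorem cornerDist_move_le {n s : ℕ} {c : Fin n → ℤ × ℤ} (hc : ∀ l, c l ∈ grid s) :
    cornerDist (fun i => move s (c i) (cornerDir (c i))) ≤ cornerDist c - 1 := by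
  unfold cornerDist
  refine Finset.sup_le fun i hi => ?_
  dsimp only
  rw [move_cornerDir (hc i)]
  have := Finset.le_sup (f := fun i => max (c i).1.toNat (c i).2.toNat) hi
  dsimp only at this ⊢
  omega

theorem cornerDist_le {n s : ℕ} {c : Fin n → ℤ × ℤ} (hc : ∀ l, c l ∈ grid s) :
    cornerDist c ≤ s := by
  refine Finset.sup_le fun i _ => ?_
  have := mem_grid.1 (hc i)
  omega

theorem eq_of_cornerDist_eq_zero {n s : ℕ} {c : Fin n → ℤ × ℤ} (hc : ∀ l, c l ∈ grid s)
    (h : cornerDist c = 0) (i j : Fin n) : c i = c j := by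
  have key : ∀ i, c i = (0, 0) := by
    intro i
    have h1 := Finset.le_sup (f := fun i => max (c i).1.toNat (c i).2.toNat) (Finset.mem_univ i)
    have h2 := mem_grid.1 (hc i)
    have h3 : max (c i).1.toNat (c i).2.toNat ≤ 0 := h1.trans h.le
    refine Prod.ext ?_ ?_ <;> dsimp only <;> omega
  rw [key i, key j]

theorem slotsLaw_cornerDir {n : ℕ} (c : Fin n → ℤ × ℤ) :
    slotsLaw n (⋂ i, {ξ | (ξ i).1 = cornerDir (c i)}) = ENNReal.ofReal ((1 / 9) ^ n) := by
  have h1 : (⋂ i, {ξ : Fin n → SlotSeed | (ξ i).1 = cornerDir (c i)}) =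
      Set.univ.pi fun i => ({cornerDir (c i)} : Set (Fin 3 × Fin 3)) ×ˢ
        ((Set.univ : Set (I × I)) ×ˢ ((Set.univ : Set I) ×ˢ (Set.univ : Set I))) := by
    ext ξ
    simp [Set.mem_pi]
  unfold slotsLaw
  rw [h1, Measure.pi_pi]
  simp_rw [slotLaw_prod, toMeasure_uniform_singleton, measure_univ, mul_one]
  rw [Finset.prod_const, Finset.card_univ, Fintype.card_fin, ENNReal.ofReal_pow (by norm_num)]

theorem lintegral_le_sub_of_add_le {α : Type*} [MeasurableSpace α] {μ : Measure α}
    [IsProbabilityMeasure μ] {f g : α → ℝ≥0∞} (hg : Measurable g) {a b : ℝ} (hb : 0 ≤ b)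
    (hfg : ∀ x, f x + g x ≤ ENNReal.ofReal a) (hbg : ENNReal.ofReal b ≤ ∫⁻ x, g x ∂μ) :
    ∫⁻ x, f x ∂μ ≤ ENNReal.ofReal (a - b) := by
  have h : ∫⁻ x, f x ∂μ + ENNReal.ofReal b ≤ ENNReal.ofReal a := by
    refine (add_le_add_right hbg _).trans ?_
    rw [← lintegral_add_right _ hg]
    refine (lintegral_mono hfg).trans ?_
    simp
  rw [ENNReal.ofReal_sub _ hb]
  exact ENNReal.le_sub_of_add_le_right ENNReal.ofReal_ne_top h

theorem oddsAgainst_netStep_le {n k : ℕ} (φ : Phy) (s : ℕ) (src : Fin k → Fin n) (τ : Fin k → ℕ)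
    (t : ℕ) {m : Fin k} {x : NetState n k} (hx : (informed x.2 m).Nonempty)
    (ξ : Fin n → SlotSeed) :
    oddsAgainst n (informed (netStep φ s src τ t x ξ).2 m).card ≤
      oddsAgainst n (informed x.2 m).card :=
  oddsAgainst_anti hx.card_pos (Finset.card_le_card fun _ hi =>
    mem_informed.2 (mem_slotHolds.2 (Or.inl (mem_informed.1 hi))))

/-- When all users share a subsquare, the expected odds contract. -/
theorem exists_contraction_of_eq (φ : Phy) (K n s : ℕ) (hs : 1 ≤ s) (hsn : s ^ 2 ≤ n) :
    ∃ b : ℝ, 0 < b ∧ b ≤ 1 / 2 ∧ ∀ (k : ℕ) (m : Fin k) (x : NetState n k)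
      (B : Fin n → Finset (Fin k)), k ≤ K → (∀ l, x.1 l ∈ grid s) → (∀ i j, x.1 i = x.1 j) →
      (informed x.2 m).Nonempty →
      ∫⁻ ξ, ENNReal.ofReal (oddsAgainst n (informed (slotHolds φ s x.1 x.2 B ξ) m).card)
        ∂(slotsLaw n) ≤
      ENNReal.ofReal ((1 - b) * oddsAgainst n (informed x.2 m).card) := by
  have hs' : (1 : ℝ) ≤ s := by exact_mod_cast hs
  have hsn' : (s : ℝ) ^ 2 ≤ n := by exact_mod_cast hsn
  have hn' : (0 : ℝ) < n := lt_of_lt_of_le (by positivity) hsn'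
  -- With `C = s ^ 2` the occupancy condition only says that a subsquare holds at most `n` users.
  -- The constant now depends on `s`, which is harmless for networks of fixed size.
  obtain ⟨κ, hκ, hκ1, h⟩ := exists_lintegral_oddsAgainst_le φ (C := (s : ℝ) ^ 2) (by positivity)
  have hK0 : (0 : ℝ) ≤ K := by positivity
  refine ⟨κ / (2 * (K + 1)), by positivity, ?_, fun k m x B hk hgrid hall hne => ?_⟩
  · rw [div_le_iff₀ (by positivity)]
    linarith
  have hk0 : (0 : ℝ) < k := by
    have := m.pos
    exact_mod_cast this
  have hkK : (k : ℝ) ≤ K + 1 := by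
    have : (k : ℝ) ≤ K := by exact_mod_cast hk
    linarith
  have hocc : ∀ c' ∈ grid s, (occupancy x.1 c' : ℝ) ≤ (s : ℝ) ^ 2 * (n / (s : ℝ) ^ 2) := by
    intro c' _
    rw [mul_div_cancel₀ _ (by positivity)]
    exact_mod_cast card_le_fin _
  refine (h n k s x.1 x.2 B m hs hsn hgrid hocc hne).trans (ENNReal.ofReal_le_ofReal ?_)
  rw [card_contacts_of_eq hall]
  have ho0 := oddsAgainst_nonneg (card_le_fin (informed x.2 m))
  have ha : (0 : ℝ) < (informed x.2 m).card := by exact_mod_cast hne.card_pos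
  have hcompl : ((informed x.2 m)ᶜ.card : ℝ) = n - (informed x.2 m).card := by
    rw [Finset.card_compl, Fintype.card_fin, Nat.cast_sub (card_le_fin _)]
  push_cast
  rw [hcompl]
  have h3 : n / (2 * ((informed x.2 m).card : ℝ) ^ 2) * (κ / k * ((s : ℝ) ^ 2 / n) *
      ((informed x.2 m).card * (n - (informed x.2 m).card))) =
      κ / (2 * k) * (s : ℝ) ^ 2 * oddsAgainst n (informed x.2 m).card := by
    unfold oddsAgainst
    field_simp
  rw [h3, sub_mul, one_mul]
  refine sub_le_sub_left (mul_le_mul_of_nonneg_right ?_ ho0) _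
  calc κ / (2 * (K + 1)) ≤ κ / (2 * k) := by gcongr
    _ = κ / (2 * k) * 1 := (mul_one _).symm
    _ ≤ κ / (2 * k) * (s : ℝ) ^ 2 := by
      gcongr
      exact one_le_pow₀ hs'

/-- The odds, discounted by the proximity of the users to the corner. -/
noncomputable def cornerWeight {n k : ℕ} (b q : ℝ) (m : Fin k) (x : NetState n k) : ℝ :=
  oddsAgainst n (informed x.2 m).card * (2 - b * q ^ cornerDist x.1)

theorem cornerWeight_le {n k : ℕ} {b q : ℝ} (hb : 0 ≤ b) (hq : 0 ≤ q) (m : Fin k)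
    (x : NetState n k) : cornerWeight b q m x ≤ 2 * oddsAgainst n (informed x.2 m).card := by
  have h1 := oddsAgainst_nonneg (card_le_fin (informed x.2 m))
  rw [cornerWeight, mul_comm]
  refine mul_le_mul_of_nonneg_right ?_ h1
  have : 0 ≤ b * q ^ cornerDist x.1 := by positivity
  linarith

theorem discount_le {b q : ℝ} (hb : 0 ≤ b) (hb1 : b ≤ 1 / 2) (hq : 0 ≤ q) (hq1 : q ≤ 1)
    (L : ℕ) : b * q ^ L ≤ 1 / 2 :=
  (mul_le_of_le_one_right hb (pow_le_one₀ hq hq1)).trans hb1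

theorem oddsAgainst_le_cornerWeight {n k : ℕ} {b q : ℝ} (hb : 0 ≤ b) (hb1 : b ≤ 1 / 2)
    (hq : 0 ≤ q) (hq1 : q ≤ 1) (m : Fin k) (x : NetState n k) :
    oddsAgainst n (informed x.2 m).card ≤ cornerWeight b q m x := by
  have h1 := oddsAgainst_nonneg (card_le_fin (informed x.2 m))
  refine le_mul_of_one_le_right h1 ?_
  have := discount_le hb hb1 hq hq1 (cornerDist x.1)
  linarith

/-- Doubling a discount `u` contracts the weight `o (2 - u)`; this closes both contraction estimates
below. -/
theorem two_sub_two_mul_le {δ u o : ℝ} (hδ : 2 * δ ≤ u) (hδ0 : 0 ≤ δ) (hu : 0 ≤ u) (ho : 0 ≤ o) :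
    (2 - 2 * u) * o ≤ (1 - δ) * (o * (2 - u)) := by
  have h : 2 - 2 * u ≤ (1 - δ) * (2 - u) := by nlinarith [mul_nonneg hδ0 hu]
  calc (2 - 2 * u) * o ≤ (1 - δ) * (2 - u) * o := mul_le_mul_of_nonneg_right h ho
    _ = _ := by ring

/-- In the corner the discount equals `b`. It may be lost entirely, but the expected odds drop by `1
- b`, so `2 - b` is replaced by at most `2 - 2 b`. -/
theorem lintegral_cornerWeight_le_of_cornerDist_eq_zero {n k s : ℕ} (φ : Phy) (src : Fin k → Fin n)
    (τ : Fin k → ℕ) (t : ℕ) {m : Fin k} {x : NetState n k} {b q δ : ℝ} (hb : 0 ≤ b) (hq : 0 ≤ q)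
    (hδ0 : 0 ≤ δ) (hδ1 : δ ≤ 1) (hδ : 2 * δ ≤ b) (h0 : cornerDist x.1 = 0)
    (h : ∫⁻ ξ, ENNReal.ofReal (oddsAgainst n
        (informed (slotHolds φ s x.1 x.2 (injected src τ t) ξ) m).card) ∂(slotsLaw n) ≤
      ENNReal.ofReal ((1 - b) * oddsAgainst n (informed x.2 m).card)) :
    ∫⁻ ξ, ENNReal.ofReal (cornerWeight b q m (netStep φ s src τ t x ξ)) ∂(slotsLaw n) ≤
      ENNReal.ofReal (1 - δ) * ENNReal.ofReal (cornerWeight b q m x) := by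
  have h2 : ∀ ξ, ENNReal.ofReal (cornerWeight b q m (netStep φ s src τ t x ξ)) ≤
      2 * ENNReal.ofReal (oddsAgainst n
        (informed (slotHolds φ s x.1 x.2 (injected src τ t) ξ) m).card) := by
    intro ξ
    rw [show (2 : ℝ≥0∞) = ENNReal.ofReal 2 by simp, ← ENNReal.ofReal_mul zero_le_two]
    exact ENNReal.ofReal_le_ofReal (cornerWeight_le hb hq m (netStep φ s src τ t x ξ))
  refine (lintegral_mono h2).trans ?_
  rw [lintegral_const_mul' _ _ (by simp)]
  refine (mul_le_mul_right h _).trans ?_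
  rw [show (2 : ℝ≥0∞) = ENNReal.ofReal 2 by simp, ← ENNReal.ofReal_mul zero_le_two,
    ← ENNReal.ofReal_mul (by linarith)]
  apply ENNReal.ofReal_le_ofReal
  have h3 := two_sub_two_mul_le hδ hδ0 hb (oddsAgainst_nonneg (card_le_fin (informed x.2 m)))
  rw [cornerWeight, h0, pow_zero, mul_one]
  linarith

theorem measurableSet_cornerDir {n : ℕ} (c : Fin n → ℤ × ℤ) :
    MeasurableSet (⋂ i, {ξ : Fin n → SlotSeed | (ξ i).1 = cornerDir (c i)}) :=
  MeasurableSet.iInter fun i =>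
    (by fun_prop : Measurable fun ξ : Fin n → SlotSeed => (ξ i).1)
      (measurableSet_singleton (cornerDir (c i)))

theorem cornerDist_netStep_le {n k s : ℕ} (φ : Phy) (src : Fin k → Fin n)
    (τ : Fin k → ℕ) (t : ℕ) {x : NetState n k} (hgrid : ∀ l, x.1 l ∈ grid s)
    {ξ : Fin n → SlotSeed} (hξ : ξ ∈ ⋂ i, {ξ : Fin n → SlotSeed | (ξ i).1 = cornerDir (x.1 i)}) :
    cornerDist (netStep φ s src τ t x ξ).1 ≤ cornerDist x.1 - 1 := by
  have h7 : (netStep φ s src τ t x ξ).1 = fun i => move s (x.1 i) (cornerDir (x.1 i)) := by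
    funext i
    have h8 := Set.mem_iInter.1 hξ i
    simp only [Set.mem_ofPred_eq] at h8
    simp only [netStep, h8]
  rw [h7]
  exact cornerDist_move_le hgrid

/-- The odds never increase, and when all users step towards the corner the new discount is at least
that of the distance reduced by one. In all other cases the discount is dropped. -/
theorem cornerWeight_netStep_add_le {n k s : ℕ} (φ : Phy) (src : Fin k → Fin n)
    (τ : Fin k → ℕ) (t : ℕ) {m : Fin k} {x : NetState n k} {b q : ℝ} (hb : 0 ≤ b)
    (hb1 : b ≤ 1 / 2) (hq : 0 ≤ q) (hq1 : q ≤ 1) (hgrid : ∀ l, x.1 l ∈ grid s)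
    (hne : (informed x.2 m).Nonempty) (ξ : Fin n → SlotSeed) :
    ENNReal.ofReal (cornerWeight b q m (netStep φ s src τ t x ξ)) +
      (⋂ i, {ξ : Fin n → SlotSeed | (ξ i).1 = cornerDir (x.1 i)}).indicator
        (fun _ => ENNReal.ofReal (oddsAgainst n (informed x.2 m).card *
          (b * q ^ (cornerDist x.1 - 1)))) ξ ≤
      ENNReal.ofReal (2 * oddsAgainst n (informed x.2 m).card) := by
  have h2 := oddsAgainst_netStep_le φ s src τ t hne ξ
  have h3 := oddsAgainst_nonneg (card_le_fin (informed (netStep φ s src τ t x ξ).2 m))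
  have ho0 := oddsAgainst_nonneg (card_le_fin (informed x.2 m))
  by_cases hξ : ξ ∈ ⋂ i, {ξ : Fin n → SlotSeed | (ξ i).1 = cornerDir (x.1 i)}
  · have h4 := discount_le hb hb1 hq hq1 (cornerDist (netStep φ s src τ t x ξ).1)
    have h5 : cornerWeight b q m (netStep φ s src τ t x ξ) ≤ oddsAgainst n (informed x.2 m).card *
        (2 - b * q ^ cornerDist (netStep φ s src τ t x ξ).1) :=
      mul_le_mul_of_nonneg_right h2 (by linarith)
    have h9 : b * q ^ (cornerDist x.1 - 1) ≤ b * q ^ cornerDist (netStep φ s src τ t x ξ).1 :=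
      mul_le_mul_of_nonneg_left
        (pow_le_pow_of_le_one hq hq1 (cornerDist_netStep_le φ src τ t hgrid hξ)) hb
    have h10 := mul_le_mul_of_nonneg_left h9 ho0
    rw [Set.indicator_of_mem hξ, ← ENNReal.ofReal_add
      (h3.trans (oddsAgainst_le_cornerWeight hb hb1 hq hq1 m _)) (by positivity)]
    apply ENNReal.ofReal_le_ofReal
    rw [mul_sub] at h5
    linarith
  · rw [Set.indicator_of_notMem hξ, add_zero]
    apply ENNReal.ofReal_le_ofReal
    have := cornerWeight_le hb hq m (netStep φ s src τ t x ξ)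
    linarith

/-- All users step towards the corner with probability `9 ^ (-n) = 2 q`. At distance `L` this turns
a possible discount `b q ^ (L - 1)` into an expected one of `2 b q ^ L`, twice the present discount.
-/
theorem lintegral_cornerWeight_le_of_cornerDist_pos {n k s : ℕ} (φ : Phy) (src : Fin k → Fin n)
    (τ : Fin k → ℕ) (t : ℕ) {m : Fin k} {x : NetState n k} {b q δ : ℝ} (hb : 0 ≤ b)
    (hb1 : b ≤ 1 / 2) (hq : 2 * q = (1 / 9) ^ n) (hδ0 : 0 ≤ δ) (hδ1 : δ ≤ 1)
    (hδ : 2 * δ ≤ b * q ^ cornerDist x.1) (hpos : 0 < cornerDist x.1)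
    (hgrid : ∀ l, x.1 l ∈ grid s) (hne : (informed x.2 m).Nonempty) :
    ∫⁻ ξ, ENNReal.ofReal (cornerWeight b q m (netStep φ s src τ t x ξ)) ∂(slotsLaw n) ≤
      ENNReal.ofReal (1 - δ) * ENNReal.ofReal (cornerWeight b q m x) := by
  have hp0 : (0 : ℝ) < (1 / 9) ^ n := by positivity
  have hp1 : ((1 : ℝ) / 9) ^ n ≤ 1 := pow_le_one₀ (by norm_num) (by norm_num)
  have hq0 : 0 ≤ q := by linarith
  have hq1 : q ≤ 1 := by linarith
  have ho0 := oddsAgainst_nonneg (card_le_fin (informed x.2 m))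
  refine (lintegral_le_sub_of_add_le (measurable_const.indicator (measurableSet_cornerDir x.1))
    (b := oddsAgainst n (informed x.2 m).card * (b * q ^ (cornerDist x.1 - 1)) * (1 / 9) ^ n)
    (by positivity) (cornerWeight_netStep_add_le φ src τ t hb hb1 hq0 hq1 hgrid hne) ?_).trans ?_
  · rw [lintegral_indicator_const (measurableSet_cornerDir x.1), slotsLaw_cornerDir,
      ← ENNReal.ofReal_mul (by positivity)]
  rw [← ENNReal.ofReal_mul (by linarith)]
  apply ENNReal.ofReal_le_ofReal
  have h2 : q ^ cornerDist x.1 = q ^ (cornerDist x.1 - 1) * q := by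
    rw [← pow_succ]
    congr 1
    omega
  have h5 := two_sub_two_mul_le hδ hδ0 (by positivity) ho0
  refine le_trans (le_of_eq ?_) h5
  rw [h2, ← hq]
  ring

/-- In a network of given size there is a fixed chance of progress in each slot: the users may all
gather in a corner. -/
theorem exists_measure_not_spread_le_geometric (φ : Phy) (K n s : ℕ) (hs : 1 ≤ s)
    (hsn : s ^ 2 ≤ n) :
    ∃ δ : ℝ, 0 < δ ∧ δ ≤ 1 ∧ ∀ (k : ℕ) (src : Fin k → Fin n) (τ : Fin k → ℕ) (m : Fin k)
      (d : ℕ), k ≤ K →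
      runLaw n {ω | ¬ ∀ j, m ∈ holds φ (mobilePos s ω) src τ ω (τ m + d) j} ≤
        ENNReal.ofReal ((1 - δ) ^ d * (2 * (n : ℝ) ^ 2)) := by
  obtain ⟨b, hb, hb1, h⟩ := exists_contraction_of_eq φ K n s hs hsn
  obtain ⟨q, hq⟩ : ∃ q : ℝ, 2 * q = (1 / 9) ^ n := ⟨(1 / 9) ^ n / 2, by ring⟩
  have hp0 : (0 : ℝ) < (1 / 9) ^ n := by positivity
  have hp1 : ((1 : ℝ) / 9) ^ n ≤ 1 := pow_le_one₀ (by norm_num) (by norm_num)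
  have hq0 : 0 < q := by linarith
  have hq1 : q ≤ 1 := by linarith
  have hqs := discount_le hb.le hb1 hq0.le hq1 s
  -- `cornerDist` never exceeds `s`, so `b * q ^ s` bounds every discount from below.
  obtain ⟨δ, hδ⟩ : ∃ δ : ℝ, 2 * δ = b * q ^ s := ⟨b * q ^ s / 2, by ring⟩
  have hδ0 : 0 < δ := by
    have : 0 < b * q ^ s := by positivity
    linarith
  have hδ1 : δ ≤ 1 := by linarith
  have hδL : ∀ L ≤ s, 2 * δ ≤ b * q ^ L := fun L hL =>
    hδ.le.trans (mul_le_mul_of_nonneg_left (pow_le_pow_of_le_one hq0.le hq1 hL) hb.le)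
  refine ⟨δ, hδ0, hδ1, fun k src τ m d hk => ?_⟩
  have hmain := measure_not_spread_le φ s src τ (m := m)
    (fun x : NetState n k => (∀ l, x.1 l ∈ grid s) ∧ (informed x.2 m).Nonempty)
    (fun x => ENNReal.ofReal (cornerWeight b q m x)) (ENNReal.ofReal (1 - δ))
    (fun t _ x hx => ?_) (fun x => ?_) (fun x => ?_) d
  -- The good states required here are certain, so no error term remains and the bound tends to `0`
  -- with `d`.
  · have hG0 : {ω : Run n | ¬ ∀ t ∈ Finset.Ico (τ m) (τ m + d),
        (∀ l, (netState φ s src τ t ω).1 l ∈ grid s) ∧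
          (informed (netState φ s src τ t ω).2 m).Nonempty} = ∅ := by
      ext ω
      simp only [Set.mem_ofPred_eq, Set.mem_empty_iff_false, iff_false, not_not]
      exact fun t ht => ⟨fun l => cell_mem_grid hs ω l t,
        netState_informed_nonempty φ s src τ (Finset.mem_Ico.1 ht).1 ω⟩
    rw [hG0, measure_empty, zero_add] at hmain
    refine hmain.trans (le_of_eq ?_)
    rw [ENNReal.ofReal_mul (pow_nonneg (by linarith) _), ENNReal.ofReal_pow (by linarith),
      ENNReal.ofReal_mul zero_le_two, ENNReal.ofReal_pow (by positivity)]
    simp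
  · rcases Nat.eq_zero_or_pos (cornerDist x.1) with h0 | hpos
    · refine lintegral_cornerWeight_le_of_cornerDist_eq_zero φ src τ t hb.le hq0.le hδ0.le hδ1
        ?_ h0 (h k m x (injected src τ t) hk hx.1 (eq_of_cornerDist_eq_zero hx.1 h0) hx.2)
      have := hδL 0 (Nat.zero_le _)
      rwa [pow_zero, mul_one] at this
    · exact lintegral_cornerWeight_le_of_cornerDist_pos φ src τ t hb.le hb1 hq hδ0.le hδ1
        (hδL _ (cornerDist_le hx.1)) hpos hx.1 hx.2
  · exact ENNReal.ofReal_le_ofReal (oddsAgainst_le_cornerWeight hb.le hb1 hq0.le hq1 m x)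
  · rw [show (2 : ℝ≥0∞) = ENNReal.ofReal 2 by simp, ← ENNReal.ofReal_mul zero_le_two]
    exact ENNReal.ofReal_le_ofReal (cornerWeight_le hb.le hq0.le m x)

/-! ### Choice of the constants -/

theorem le_measureReal_of_compl_le {α : Type*} {_ : MeasurableSpace α} {μ : Measure α}
    [IsProbabilityMeasure μ] {S : Set α} {ε : ℝ} (hε : 0 ≤ ε) (h : μ Sᶜ ≤ ENNReal.ofReal ε) :
    1 - ε ≤ μ.real S := by
  have h1 : 1 ≤ μ S + ENNReal.ofReal ε := by
    rw [← measure_univ (μ := μ), ← Set.union_compl_self S]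
    exact (measure_union_le _ _).trans (add_le_add_right h _)
  have h2 := ENNReal.toReal_mono (by finiteness) h1
  rw [ENNReal.toReal_add (by finiteness) (by finiteness), ENNReal.toReal_ofReal hε,
    ENNReal.toReal_one] at h2
  rw [Measure.real]
  linarith

theorem measure_not_forall_le {α : Type*} {_ : MeasurableSpace α} {μ : Measure α} {k : ℕ}
    {p : Fin k → α → Prop} {ε : ℝ} (h : ∀ m, μ {x | ¬ p m x} ≤ ENNReal.ofReal ε) :
    μ {x | ∀ m, p m x}ᶜ ≤ ENNReal.ofReal (k * ε) := by
  have h1 : {x | ∀ m, p m x}ᶜ ⊆ ⋃ m ∈ (Finset.univ : Finset (Fin k)), {x | ¬ p m x} := by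
    intro x hx
    obtain ⟨m, hm⟩ := not_forall.1 (show ¬ ∀ m, p m x from hx)
    exact Set.mem_iUnion₂.2 ⟨m, Finset.mem_univ m, hm⟩
  refine (measure_mono h1).trans ((measure_biUnion_finset_le _ _).trans ?_)
  refine (Finset.sum_le_sum fun m _ => h m).trans (le_of_eq ?_)
  rw [Finset.sum_const, Finset.card_univ, Fintype.card_fin, nsmul_eq_mul,
    ENNReal.ofReal_mul (by positivity), ENNReal.ofReal_natCast]

theorem measure_not_and_le {α : Type*} [MeasurableSpace α] {μ : Measure α} {p q : α → Prop}
    {ε : ℝ} (hε : 0 ≤ ε) (hp : μ {x | ¬ p x} ≤ ENNReal.ofReal ε)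
    (hq : μ {x | ¬ q x} ≤ ENNReal.ofReal ε) :
    μ {x | ¬ (p x ∧ q x)} ≤ ENNReal.ofReal (2 * ε) := by
  have h1 : {x | ¬ (p x ∧ q x)} ⊆ {x | ¬ p x} ∪ {x | ¬ q x} := fun x hx =>
    not_and_or.1 (show ¬ (p x ∧ q x) from hx)
  refine (measure_mono h1).trans ((measure_union_le _ _).trans ?_)
  rw [two_mul, ENNReal.ofReal_add hε hε]
  exact add_le_add hp hq

theorem exp_neg_mul_log {x : ℝ} (hx : 0 < x) (j : ℕ) :
    Real.exp (-(j * Real.log x)) = 1 / x ^ j := by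
  rw [Real.exp_neg, Real.exp_nat_mul, Real.exp_log hx, one_div]

/-- The velocity `1 / s` exceeds the connectivity threshold. -/
structure Dense (n s : ℕ) : Prop where
  one_le : 1 ≤ s
  one_le_log : 1 ≤ Real.log n
  log_mul_le : 32 * Real.log n * (s : ℝ) ^ 2 ≤ n

theorem dense_of_sqrt_lt {n s : ℕ} (hn : 2 ≤ n) (hs : 1 ≤ s)
    (h : Real.sqrt (32 * Real.log n / n) < 1 / (s : ℝ)) : Dense n s := by
  have hn' : (2 : ℝ) ≤ n := by exact_mod_cast hn
  have hs' : (1 : ℝ) ≤ s := by exact_mod_cast hs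
  have hlog2 : Real.log 2 ≤ Real.log n := Real.log_le_log two_pos hn'
  have hlog : 0.69 ≤ Real.log n := by linarith [Real.log_two_gt_d9]
  have h1 : 32 * Real.log n * (s : ℝ) ^ 2 < n := by
    have h2 := (Real.sqrt_lt' (by positivity)).1 h
    rw [div_pow, one_pow, div_lt_div_iff₀ (by linarith) (by positivity), one_mul] at h2
    exact h2
  refine ⟨hs, ?_, h1.le⟩
  have h3 : (3 : ℝ) ≤ n := by
    have h4 : (1 : ℝ) ≤ (s : ℝ) ^ 2 := one_le_pow₀ hs'
    nlinarith
  rw [Real.le_log_iff_exp_le (by linarith)]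
  linarith [Real.exp_one_lt_d9]

namespace Dense

variable {n s : ℕ}

theorem one_le_cast (h : Dense n s) : (1 : ℝ) ≤ s := by exact_mod_cast h.one_le

theorem sq_le_cast (h : Dense n s) : (s : ℝ) ^ 2 ≤ n := by
  have h1 := h.log_mul_le
  have h2 := h.one_le_log
  nlinarith [sq_nonneg (s : ℝ)]

theorem sq_le (h : Dense n s) : s ^ 2 ≤ n := by exact_mod_cast h.sq_le_cast

theorem le_cast (h : Dense n s) : (s : ℝ) ≤ n :=
  (le_self_pow₀ h.one_le_cast two_ne_zero).trans h.sq_le_cast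

theorem two_le (h : Dense n s) : 2 ≤ n := by
  have h1 := h.log_mul_le
  have h2 := h.one_le_log
  have h3 : (1 : ℝ) ≤ (s : ℝ) ^ 2 := one_le_pow₀ h.one_le_cast
  have h4 : (2 : ℝ) ≤ n := by nlinarith
  exact_mod_cast h4

theorem cast_pos (h : Dense n s) : (0 : ℝ) < n := by
  have := h.two_le
  positivity

theorem cube_le (h : Dense n s) : (s : ℝ) ^ 3 ≤ (n : ℝ) ^ 2 := by
  have h1 := h.le_cast
  have h2 := h.sq_le_cast
  have h3 := h.one_le_cast
  calc (s : ℝ) ^ 3 = (s : ℝ) ^ 2 * s := by ring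
    _ ≤ (n : ℝ) * n := by gcongr
    _ = _ := by ring

/-- The mean occupancy is at least `32 log n`, so any power of `n` up to `32 c` is available. -/
theorem exp_le (h : Dense n s) {c : ℝ} (j : ℕ) (hc : (j : ℝ) ≤ 32 * c) :
    Real.exp (-(c * (n / (s : ℝ) ^ 2))) ≤ 1 / (n : ℝ) ^ j := by
  rw [← exp_neg_mul_log h.cast_pos, Real.exp_le_exp, neg_le_neg_iff]
  have h1 := h.one_le_cast
  have h2 := h.one_le_log
  have h3 : 32 * Real.log n ≤ n / (s : ℝ) ^ 2 := by
    rw [le_div_iff₀ (by positivity)]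
    exact h.log_mul_le
  have hc0 : 0 ≤ c := by
    have : (0 : ℝ) ≤ j := by positivity
    linarith
  calc j * Real.log n ≤ 32 * c * Real.log n := by gcongr
    _ = c * (32 * Real.log n) := by ring
    _ ≤ _ := by gcongr

end Dense

/-- The failure probability allowed for each message. -/
noncomputable def tolerance (K n : ℕ) : ℝ := 1 / ((K + 1) * (n : ℝ) ^ 3)

theorem tolerance_nonneg (K n : ℕ) : 0 ≤ tolerance K n := by
  unfold tolerance
  positivity

/-- Failure probabilities will be of order `n ^ (-6)`; one of the three spare powers of `n` absorbs
the constant and `K + 1`. -/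
theorem le_tolerance {K n : ℕ} {c : ℝ} (hn : 2 ≤ n) (hc : c * (K + 1) ≤ n) :
    c / (n : ℝ) ^ 6 ≤ tolerance K n := by
  have hn0 : (2 : ℝ) ≤ n := by exact_mod_cast hn
  unfold tolerance
  rw [div_le_div_iff₀ (by positivity) (by positivity), one_mul]
  have h1 : (1 : ℝ) ≤ (n : ℝ) ^ 2 := one_le_pow₀ (by linarith)
  calc c * ((K + 1) * (n : ℝ) ^ 3) = c * (K + 1) * (n : ℝ) ^ 3 := by ring
    _ ≤ n * (n : ℝ) ^ 3 := by gcongr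
    _ = n ^ 4 * 1 := by ring
    _ ≤ n ^ 4 * n ^ 2 := by gcongr
    _ = _ := by ring

theorem two_mul_mul_tolerance_le {k K n : ℕ} (hk : k ≤ K) (hn : 2 ≤ n) :
    k * (2 * tolerance K n) ≤ 1 / (n : ℝ) ^ 2 := by
  have hn0 : (2 : ℝ) ≤ n := by exact_mod_cast hn
  have hk' : (k : ℝ) ≤ K + 1 := by
    have : (k : ℝ) ≤ K := by exact_mod_cast hk
    linarith
  unfold tolerance
  calc (k : ℝ) * (2 * (1 / ((K + 1) * (n : ℝ) ^ 3)))
      ≤ (K + 1) * (n * (1 / ((K + 1) * (n : ℝ) ^ 3))) := by gcongr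
    _ = _ := by
      field_simp

theorem cube_mul_exp_le {K n s : ℕ} (h : Dense n s) (hK : K + 1 ≤ n) :
    (s : ℝ) ^ 3 * Real.exp (-(n / (s : ℝ) ^ 2 / 2)) ≤ tolerance K n := by
  have hK' : (1 : ℝ) * (K + 1) ≤ n := by
    rw [one_mul]
    exact_mod_cast hK
  refine le_trans ?_ (le_tolerance h.two_le hK')
  have h1 := h.exp_le (c := 1 / 2) 8 (by norm_num)
  have h2 := h.cube_le
  have h3 := h.cast_pos
  calc (s : ℝ) ^ 3 * Real.exp (-(n / (s : ℝ) ^ 2 / 2))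
      = (s : ℝ) ^ 3 * Real.exp (-(1 / 2 * (n / (s : ℝ) ^ 2))) := by
        congr 3
        ring
    _ ≤ (n : ℝ) ^ 2 * (1 / (n : ℝ) ^ 8) := by gcongr
    _ = 1 / (n : ℝ) ^ 6 := by
      field_simp

/-! ### Bounds for one message, up to the allowed failure probability. -/

theorem ofReal_le_spreadingTime_of_le_one {n k : ℕ} (φ : Phy) (hn : 2 ≤ n)
    (pos : ℕ → Fin n → Plane) (src : Fin k → Fin n) (τ : Fin k → ℕ) (ω : Run n) (m : Fin k)
    {x : ℝ} (hx : x ≤ 1) :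
    ENNReal.ofReal x ≤ ((spreadingTime φ pos src τ ω m : ℕ∞) : ℝ≥0∞) :=
  le_spreadingTime fun d hd => by
    have h1 : 1 ≤ d := one_le_of_forall_mem_holds hn hd
    have h2 : (1 : ℝ) ≤ d := by exact_mod_cast h1
    linarith

/-- For `n ≤ K` the probability estimate may exceed the tolerance, but then `s ≤ n` makes the
claimed bound at most `1`, and a message never reaches two users in zero slots. -/
theorem exists_le_mobileTime (φ : Phy) (K : ℕ) :
    ∃ a : ℝ, 0 < a ∧ ∀ (n k s : ℕ) (src : Fin k → Fin n) (τ : Fin k → ℕ) (m : Fin k),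
      Dense n s → runLaw n {ω | ¬ ENNReal.ofReal (a * s) ≤ mobileTime φ s src τ ω m} ≤
        ENNReal.ofReal (tolerance K n) := by
  refine ⟨1 / (K + 7), by positivity, fun n k s src τ m h => ?_⟩
  rcases le_or_gt (K + 1) n with hK | hK
  · refine le_trans (measure_mono fun ω hω hcon => hω (le_trans ?_ hcon))
      ((measure_mobileTime_lt_le φ h.two_le h.one_le src τ m).trans
        (ENNReal.ofReal_le_ofReal (cube_mul_exp_le h hK)))
    apply ENNReal.ofReal_le_ofReal
    rw [one_div_mul_eq_div]
    have : (0 : ℝ) ≤ K := by positivity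
    gcongr
    linarith
  · have h1 : {ω | ¬ ENNReal.ofReal (1 / ((K : ℝ) + 7) * s) ≤ mobileTime φ s src τ ω m} = ∅ := by
      refine Set.eq_empty_of_forall_notMem fun ω hω => hω ?_
      refine ofReal_le_spreadingTime_of_le_one φ h.two_le _ src τ ω m ?_
      rw [one_div_mul_eq_div, div_le_one (by positivity)]
      have h2 : (n : ℝ) < K + 1 := by exact_mod_cast hK
      linarith [h.le_cast]
    rw [h1, measure_empty]
    exact zero_le

theorem exists_le_staticTime (φ : Phy) (K : ℕ) :
    ∃ h : ℝ, 0 < h ∧ ∀ (n k s : ℕ) (src : Fin k → Fin n) (τ : Fin k → ℕ) (m : Fin k),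
      Dense n s →
      runLaw n {ω | ¬ ENNReal.ofReal (h * (Real.sqrt n / Real.log n)) ≤ staticTime φ src τ ω m} ≤
        ENNReal.ofReal (tolerance K n) := by
  refine ⟨1 / (K + 84), by positivity, fun n k s src τ m h => ?_⟩
  have hK0 : (0 : ℝ) ≤ K := by positivity
  have hlog := h.one_le_log
  have hn := h.cast_pos
  rcases le_or_gt (K + 1) n with hK | hK
  -- `⌊x⌋₊` is the side of the finest auxiliary grid that still satisfies the density condition.
  · obtain ⟨x, hx⟩ : ∃ x, x = Real.sqrt (n / (32 * Real.log n)) := ⟨_, rfl⟩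
    have hx0 : 0 ≤ x := hx ▸ Real.sqrt_nonneg _
    have hx2 : x ^ 2 = n / (32 * Real.log n) := by
      rw [hx, Real.sq_sqrt (by positivity)]
    have hx1 : 1 ≤ x := by
      have h1 : (1 : ℝ) ≤ (s : ℝ) ^ 2 := one_le_pow₀ h.one_le_cast
      have h2 : 1 ≤ n / (32 * Real.log n) := by
        rw [one_le_div (by positivity)]
        nlinarith [h.log_mul_le]
      nlinarith
    have hr : 1 ≤ ⌊x⌋₊ := Nat.le_floor (by exact_mod_cast hx1)
    have hr1 : (1 : ℝ) ≤ ⌊x⌋₊ := by exact_mod_cast hr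
    have hrx : (⌊x⌋₊ : ℝ) ≤ x := Nat.floor_le hx0
    have hxr : x < ⌊x⌋₊ + 1 := Nat.lt_floor_add_one x
    have hexp : (⌊x⌋₊ : ℝ) ^ 3 * Real.exp (-(n / (⌊x⌋₊ : ℝ) ^ 2 / 2)) ≤ tolerance K n := by
      refine cube_mul_exp_le ⟨hr, hlog, ?_⟩ hK
      have h1 : (⌊x⌋₊ : ℝ) ^ 2 ≤ n / (32 * Real.log n) := by
        rw [← hx2]
        gcongr
      rwa [le_div_iff₀ (by positivity), mul_comm] at h1
    refine le_trans (measure_mono fun ω hω hcon => hω (le_trans ?_ hcon))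
      ((measure_staticTime_lt_le φ h.two_le hr src τ m).trans (ENNReal.ofReal_le_ofReal hexp))
    apply ENNReal.ofReal_le_ofReal
    have h1 : Real.sqrt n / Real.log n ≤ 6 * x := by
      rw [hx, div_le_iff₀ (by positivity)]
      apply Real.sqrt_le_iff.2 ⟨by positivity, ?_⟩
      rw [mul_pow, mul_pow, ← hx, hx2]
      have : (6 : ℝ) ^ 2 * (n / (32 * Real.log n)) * Real.log n ^ 2 = 36 / 32 * (n * Real.log n) := by
        field_simp
        norm_num
      rw [this]
      nlinarith
    have h0 : 0 ≤ Real.sqrt n / Real.log n := by positivity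
    -- `⌊x⌋₊ ≥ 1` gives `x ≤ 2 ⌊x⌋₊`, whence `84 = 7 * 6 * 2`.
    calc 1 / ((K : ℝ) + 84) * (Real.sqrt n / Real.log n)
        ≤ 1 / 84 * (Real.sqrt n / Real.log n) := by
          gcongr
          linarith
      _ ≤ 1 / 84 * (6 * x) := by gcongr
      _ ≤ (⌊x⌋₊ : ℝ) / 7 := by linarith
  · have h1 : {ω | ¬ ENNReal.ofReal (1 / ((K : ℝ) + 84) * (Real.sqrt n / Real.log n)) ≤
        staticTime φ src τ ω m} = ∅ := by
      refine Set.eq_empty_of_forall_notMem fun ω hω => hω ?_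
      refine ofReal_le_spreadingTime_of_le_one φ h.two_le _ src τ ω m ?_
      rw [one_div_mul_eq_div, div_le_one (by positivity)]
      have h2 : (n : ℝ) < K + 1 := by exact_mod_cast hK
      have h3 : Real.sqrt n / Real.log n ≤ n := by
        have h5 : (1 : ℝ) ≤ n := by exact_mod_cast (by have := h.two_le; omega : 1 ≤ n)
        refine (div_le_self (Real.sqrt_nonneg _) hlog).trans ?_
        exact Real.sqrt_le_iff.2 ⟨hn.le, le_self_pow₀ h5 two_ne_zero⟩
      linarith
    rw [h1, measure_empty]
    exact zero_le

theorem measure_not_mobileTime_le {n k : ℕ} (φ : Phy) (s : ℕ) (src : Fin k → Fin n)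
    (τ : Fin k → ℕ) (m : Fin k) {d : ℕ} {x : ℝ} (hd : d ≤ x) :
    runLaw n {ω | ¬ mobileTime φ s src τ ω m ≤ ENNReal.ofReal x} ≤
      runLaw n {ω | ¬ ∀ j, m ∈ holds φ (mobilePos s ω) src τ ω (τ m + d) j} :=
  measure_mono fun _ hω hcon =>
    hω ((spreadingTime_le hcon).trans (ENNReal.ofReal_le_ofReal hd))

/-- As `s ≤ n < N`, finitely many pairs `(n, s)` occur. The geometric tail gives a sufficient number
of slots for each, and the largest one serves as `b` because `log n * s ≥ 1`. -/
theorem exists_mobileTime_le_of_bounded (φ : Phy) (K N : ℕ) :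
    ∃ b : ℝ, 0 ≤ b ∧ ∀ (n k s : ℕ) (src : Fin k → Fin n) (τ : Fin k → ℕ) (m : Fin k),
      n < N → k ≤ K → Dense n s →
      runLaw n {ω | ¬ mobileTime φ s src τ ω m ≤ ENNReal.ofReal (b * (Real.log n * s))} ≤
        ENNReal.ofReal (tolerance K n) := by
  have hD : ∀ n s : ℕ, ∃ D : ℕ, Dense n s → ∀ (k : ℕ) (src : Fin k → Fin n) (τ : Fin k → ℕ)
      (m : Fin k), k ≤ K →
      runLaw n {ω | ¬ ∀ j, m ∈ holds φ (mobilePos s ω) src τ ω (τ m + D) j} ≤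
        ENNReal.ofReal (tolerance K n) := by
    intro n s
    by_cases h : Dense n s
    swap
    · exact ⟨0, fun h' => absurd h' h⟩
    have hn := h.cast_pos
    obtain ⟨δ, hδ0, hδ1, hδ⟩ := exists_measure_not_spread_le_geometric φ K n s h.one_le h.sq_le
    have htol : 0 < tolerance K n := by
      unfold tolerance
      positivity
    obtain ⟨D, hD⟩ := exists_pow_lt_of_lt_one
      (show 0 < tolerance K n / (2 * (n : ℝ) ^ 2) by positivity) (show 1 - δ < 1 by linarith)
    refine ⟨D, fun _ k src τ m hk =>
      (hδ k src τ m D hk).trans (ENNReal.ofReal_le_ofReal ?_)⟩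
    exact ((lt_div_iff₀ (by positivity)).1 hD).le
  choose D hD using hD
  obtain ⟨M, hM⟩ : ∃ M, M = (Finset.range N ×ˢ Finset.range N).sup fun p => D p.1 p.2 := ⟨_, rfl⟩
  refine ⟨M, by positivity, fun n k s src τ m hn hk h =>
    (measure_not_mobileTime_le φ s src τ m ?_).trans (hD n s h k src τ m hk)⟩
  have hsn : s ≤ n := by exact_mod_cast h.le_cast
  have h1 : D n s ≤ M := hM ▸ Finset.le_sup (f := fun p : ℕ × ℕ => D p.1 p.2)
    (b := (n, s)) (Finset.mem_product.2 ⟨Finset.mem_range.2 hn, Finset.mem_range.2 (by simp only; omega)⟩)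
  have h2 : (D n s : ℝ) ≤ M := by exact_mod_cast h1
  exact h2.trans (le_mul_of_one_le_right (by positivity)
    (one_le_mul_of_one_le_of_one_le h.one_le_log h.one_le_cast))

theorem exists_mobileTime_le_of_large (φ : Phy) (K : ℕ) :
    ∃ (b : ℝ) (N : ℕ), 0 < b ∧
      ∀ (n k s : ℕ) (src : Fin k → Fin n) (τ : Fin k → ℕ) (m : Fin k),
      N ≤ n → k ≤ K → Dense n s →
      runLaw n {ω | ¬ mobileTime φ s src τ ω m ≤ ENNReal.ofReal (b * (Real.log n * s))} ≤
        ENNReal.ofReal (tolerance K n) := by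
  obtain ⟨κ, hκ, hκ1, hfail⟩ := exists_measure_not_spread_le φ K
  -- After `(8 / κ) s log n` slots the contraction is of order `n ^ (-8)`, which the factor `2 n ^
  -- 2` reduces to `n ^ (-6)`. The numerators of the two failure terms are `2 (8 / κ)` and `6`, and
  -- the threshold on `n` lets the tolerance absorb their sum.
  refine ⟨8 / κ, ⌈(2 * (8 / κ) + 6) * (K + 1)⌉₊, by positivity,
    fun n k s src τ m hN hk h => ?_⟩
  obtain ⟨x, hx⟩ : ∃ x, x = 8 / κ * (Real.log n * s) := ⟨_, rfl⟩
  have hlog := h.one_le_log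
  have hs := h.one_le_cast
  have hn := h.cast_pos
  have hx0 : 0 ≤ x := by
    rw [hx]
    positivity
  have hd : (⌊x⌋₊ : ℝ) ≤ x := Nat.floor_le hx0
  have hd' : x < ⌊x⌋₊ + 1 := Nat.lt_floor_add_one x
  rw [← hx]
  refine (measure_not_mobileTime_le φ s src τ m hd).trans
    ((hfail n k s src τ m ⌊x⌋₊ hk h.one_le h.sq_le).trans (ENNReal.ofReal_le_ofReal ?_))
  refine le_trans ?_ (le_tolerance h.two_le (Nat.ceil_le.1 hN))
  have hlogn : Real.log n ≤ n := (Real.log_le_sub_one_of_pos hn).trans (by linarith)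
  have h1 : (⌊x⌋₊ : ℝ) * (s : ℝ) ^ 2 * (2 * Real.exp (-(0.4 * (n / (s : ℝ) ^ 2)))) ≤
      2 * (8 / κ) / (n : ℝ) ^ 6 := by
    calc (⌊x⌋₊ : ℝ) * (s : ℝ) ^ 2 * (2 * Real.exp (-(0.4 * (n / (s : ℝ) ^ 2))))
        ≤ 8 / κ * (Real.log n * s) * (s : ℝ) ^ 2 * (2 * (1 / (n : ℝ) ^ 9)) := by
          rw [← hx]
          gcongr
          exact h.exp_le 9 (by norm_num)
      _ = 8 / κ * (Real.log n * (s : ℝ) ^ 3) * (2 * (1 / (n : ℝ) ^ 9)) := by ring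
      _ ≤ 8 / κ * (n * (n : ℝ) ^ 2) * (2 * (1 / (n : ℝ) ^ 9)) := by
          gcongr
          exact h.cube_le
      _ = _ := by
          field_simp
  have h2 : (1 - κ / s) ^ ⌊x⌋₊ ≤ 3 / (n : ℝ) ^ 8 := by
    have h3 : 0 ≤ 1 - κ / s := by
      rw [sub_nonneg, div_le_one (by linarith)]
      linarith
    -- Rounding `x` down costs at most `κ / s ≤ 1` in the exponent, that is a factor `e < 3`.
    have h4 : 8 * Real.log n - 1 ≤ ⌊x⌋₊ * (κ / s) := by
      have h5 : (x - 1) * (κ / s) ≤ ⌊x⌋₊ * (κ / s) := by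
        gcongr
        linarith
      have h6 : x * (κ / s) = 8 * Real.log n := by
        rw [hx]
        field_simp
      have h7 : κ / s ≤ 1 := by linarith
      rw [sub_mul, h6, one_mul] at h5
      linarith
    calc (1 - κ / s) ^ ⌊x⌋₊ ≤ (Real.exp (-(κ / s))) ^ ⌊x⌋₊ := by
          gcongr
          linarith [Real.add_one_le_exp (-(κ / s))]
      _ = Real.exp (-(⌊x⌋₊ * (κ / s))) := by
          rw [← Real.exp_nat_mul, mul_neg]
      _ ≤ Real.exp (1 + -((8 : ℕ) * Real.log n)) := by
          rw [Real.exp_le_exp]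
          push_cast
          linarith
      _ = Real.exp 1 * (1 / (n : ℝ) ^ 8) := by
          rw [Real.exp_add, exp_neg_mul_log hn]
      _ ≤ 3 * (1 / (n : ℝ) ^ 8) := by
          gcongr
          linarith [Real.exp_one_lt_d9]
      _ = _ := by ring
  have h3 : (1 - κ / s) ^ ⌊x⌋₊ * (2 * (n : ℝ) ^ 2) ≤ 6 / (n : ℝ) ^ 6 := by
    calc (1 - κ / s) ^ ⌊x⌋₊ * (2 * (n : ℝ) ^ 2) ≤ 3 / (n : ℝ) ^ 8 * (2 * (n : ℝ) ^ 2) := by gcongr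
      _ = _ := by
        field_simp
        norm_num
  rw [add_div]
  linarith

theorem measure_not_le_ofReal_anti {α : Type*} [MeasurableSpace α] {μ : Measure α}
    (f : α → ℝ≥0∞) {x y : ℝ} (hxy : x ≤ y) :
    μ {ω | ¬ f ω ≤ ENNReal.ofReal y} ≤ μ {ω | ¬ f ω ≤ ENNReal.ofReal x} :=
  measure_mono fun _ hω hcon => hω (hcon.trans (ENNReal.ofReal_le_ofReal hxy))

theorem exists_mobileTime_le (φ : Phy) (K : ℕ) :
    ∃ b : ℝ, 0 < b ∧ ∀ (n k s : ℕ) (src : Fin k → Fin n) (τ : Fin k → ℕ) (m : Fin k),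
      k ≤ K → Dense n s →
      runLaw n {ω | ¬ mobileTime φ s src τ ω m ≤ ENNReal.ofReal (b * (Real.log n * s))} ≤
        ENNReal.ofReal (tolerance K n) := by
  obtain ⟨b₁, N, hb₁, h₁⟩ := exists_mobileTime_le_of_large φ K
  obtain ⟨b₂, hb₂, h₂⟩ := exists_mobileTime_le_of_bounded φ K N
  refine ⟨b₁ + b₂, by positivity, fun n k s src τ m hk h => ?_⟩
  have hlog := h.one_le_log
  rcases le_or_gt N n with hN | hN
  · refine (measure_not_le_ofReal_anti _ ?_).trans (h₁ n k s src τ m hN hk h)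
    gcongr
    linarith
  · refine (measure_not_le_ofReal_anti _ ?_).trans (h₂ n k s src τ m hN hk h)
    gcongr
    linarith

/-- Each of the two bounds concerns one factor of the product, so a union bound with the marginals
is enough. -/
theorem measure_prod_not_mul_le {α : Type*} [MeasurableSpace α] {μ : Measure α}
    [IsProbabilityMeasure μ] {f g : α → ℝ≥0∞} {x y z ε : ℝ} (hx : 0 ≤ x) (hε : 0 ≤ ε)
    (hxyz : x * y = z) (hf : μ {ω | ¬ f ω ≤ ENNReal.ofReal y} ≤ ENNReal.ofReal ε)
    (hg : μ {ω | ¬ ENNReal.ofReal z ≤ g ω} ≤ ENNReal.ofReal ε) :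
    (μ.prod μ) {ω | ¬ ENNReal.ofReal x * f ω.1 ≤ g ω.2} ≤ ENNReal.ofReal (2 * ε) := by
  have h1 : {ω : α × α | ¬ ENNReal.ofReal x * f ω.1 ≤ g ω.2} ⊆
      {ω | ¬ (f ω.1 ≤ ENNReal.ofReal y ∧ ENNReal.ofReal z ≤ g ω.2)} := by
    rintro ω hω ⟨h2, h3⟩
    refine hω (le_trans ?_ h3)
    rw [← hxyz, ENNReal.ofReal_mul hx]
    gcongr
  refine (measure_mono h1).trans (measure_not_and_le hε ?_ ?_)
  · have h2 : {ω : α × α | ¬ f ω.1 ≤ ENNReal.ofReal y} =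
        {ω | ¬ f ω ≤ ENNReal.ofReal y} ×ˢ Set.univ := by
      ext ω
      simp
    rw [h2, Measure.prod_prod, measure_univ, mul_one]
    exact hf
  · have h2 : {ω : α × α | ¬ ENNReal.ofReal z ≤ g ω.2} =
        Set.univ ×ˢ {ω | ¬ ENNReal.ofReal z ≤ g ω} := by
      ext ω
      simp
    rw [h2, Measure.prod_prod, measure_univ, one_mul]
    exact hg

end Gossip

theorem theorem1 (φ : Gossip.Phy) (K : ℕ) :
    ∃ a b g h : ℝ, 0 < a ∧ 0 < b ∧ 0 < g ∧ 0 < h ∧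
      ∀ (n k s : ℕ) (v : ℝ), 1 ≤ k → k ≤ K → 1 ≤ s → v = 1 / (s : ℝ) →
        Real.sqrt (32 * Real.log n / n) < v →
        ∀ (src : Fin k → Fin n) (τ : Fin k → ℕ),
          -- spreading time in the mobile network
          1 - 1 / (n : ℝ) ^ 2 ≤ (Gossip.runLaw n).real
            {ω | ∀ m, ENNReal.ofReal (a / v) ≤ Gossip.mobileTime φ s src τ ω m ∧
              Gossip.mobileTime φ s src τ ω m ≤ ENNReal.ofReal (b * (Real.log n / v))} ∧
          -- spreading time in the static network
          1 - 1 / (n : ℝ) ^ 2 ≤ (Gossip.runLaw n).real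
            {ω | ∀ m, ENNReal.ofReal (h * (Real.sqrt n / Real.log n)) ≤
              Gossip.staticTime φ src τ ω m} ∧
          -- gain of an independent mobile network over a static one
          1 - 1 / (n : ℝ) ^ 2 ≤ ((Gossip.runLaw n).prod (Gossip.runLaw n)).real
            {ω | ∀ m, ENNReal.ofReal (g * (v * Real.sqrt n / (Real.log n) ^ 2)) *
              Gossip.mobileTime φ s src τ ω.1 m ≤ Gossip.staticTime φ src τ ω.2 m} := by
  obtain ⟨a, ha, hlower⟩ := Gossip.exists_le_mobileTime φ K
  obtain ⟨b, hb, hupper⟩ := Gossip.exists_mobileTime_le φ K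
  obtain ⟨h, hh, hstatic⟩ := Gossip.exists_le_staticTime φ K
  -- The gain is a quotient of bounds: `(h / b) (v √n / log² n)` times `b log n / v` is `h √n / log
  -- n`.
  refine ⟨a, b, h / b, h, ha, hb, by positivity, hh, ?_⟩
  rintro n k s v hk hkK hs rfl hv src τ
  have hn0 : 0 < n := (src ⟨0, hk⟩).pos
  -- For `n = 1` the required probability is `0`; `n = 0` is excluded because a message has a
  -- source.
  rcases Nat.lt_or_ge n 2 with hn | hn
  · have hn1 : n = 1 := by omega
    subst hn1
    norm_num
  have hd := Gossip.dense_of_sqrt_lt hn hs hv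
  have hlog := hd.one_le_log
  have hs1 := hd.one_le_cast
  have hε := Gossip.tolerance_nonneg K n
  have htotal := ENNReal.ofReal_le_ofReal (Gossip.two_mul_mul_tolerance_le hkK hn)
  have hpos : (0 : ℝ) ≤ 1 / (n : ℝ) ^ 2 := by positivity
  rw [div_div_eq_mul_div, div_div_eq_mul_div, div_one, div_one]
  refine ⟨Gossip.le_measureReal_of_compl_le hpos (le_trans (Gossip.measure_not_forall_le fun m =>
      Gossip.measure_not_and_le hε (hlower n k s src τ m hd) (hupper n k s src τ m hkK hd)) htotal),
    Gossip.le_measureReal_of_compl_le hpos (le_trans (Gossip.measure_not_forall_le fun m =>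
      (hstatic n k s src τ m hd).trans (ENNReal.ofReal_le_ofReal (by linarith))) htotal), ?_⟩
  refine Gossip.le_measureReal_of_compl_le hpos
    (le_trans (Gossip.measure_not_forall_le fun m => ?_) htotal)
  refine Gossip.measure_prod_not_mul_le (by positivity) hε ?_
    (hupper n k s src τ m hkK hd) (hstatic n k s src τ m hd)
  field_simp
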